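/- **Setting.** Let $d\ge 1$, $p>0$, $\alpha\in(0,2)$, $T>0$. Let $\sigma\neq 0$ be a finite Borel measure on $\mathbb S^{d-1}$, $\|\sigma\|:=\sigma(\mathbb S^{d-1})$, and let $q:(0,\infty)\times\mathbb S^{d-1}\to(0,\infty)$ be a Borel function such that, for every $u$, $q(\cdot,u)$ is completely monotone with $\lim_{r\downarrow0}q(r,u)=1$ and $q(r,u)=\int_{(0,\infty)}e^{-rs}\,Q(ds|u)$ for $r>0$, where $\{Q(\cdot|u)\}_u$ is a measurable family of probability measures on $(0,\infty)$. Put, for Borel $A\subset\mathbb R^d$, $$M(A)=\int_{\mathbb S^{d-1}}\int_0^\infty \mathbf 1_A(ru)\,q(r^p,u)\,r^{-\alpha-1}\,dr\,\sigma(du),\qquad Q(A)=\int_{\mathbb S^{d-1}}\int_{(0,\infty)}\mathbf 1_A(su)\,Q(ds|u)\,\sigma(du).$$ ($M$ is the Lévy measure of a proper $p$-tempered $\alpha$-stable Lévy process.) Let $\{E_j\},\{E'_j\}$ be i.i.d. standard exponentials, $\{T_j\}$ i.i.d. uniform on $(0,T)$, $\{U_j\}$ i.i.d. uniform on $(0,1)$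 and $\{V_j\}$ i.i.d. random vectors with law $Q/\|\sigma\|$, all sequences being independent. Put $\Gamma_j=E'_1+\dots+E'_j$, $$H_j=\left(\Big(\frac{\alpha\Gamma_j}{\|\sigma\|T}\Big)^{-1/\alpha}\wedge\frac{E_j^{1/p}U_j^{1/\alpha}}{\|V_j\|^{1/p}}\right)\frac{V_j}{\|V_j\|},\qquad S^{(n)}_t=\sum_{\Gamma_j\le Tn}\mathbf 1_{(0,t]}(T_j)H_j ,\quad t\in[0,T],\ n\in\mathbb N.$$ **Theorem.** There are finite measures $M_n$ on $\mathbb R^d$ with $M_n(\{0\})=0$ and $$M_n((x,\infty)B)=\Big(n\frac{\alpha}{\|\sigma\|}x^\alpha\wedge 1\Big)M((x,\infty)B),\qquad x>0,\ B\in\mathcal B(\mathbb S^{d-1}),$$ where $(x,\infty)B=\{ru:r>x,\,u\in B\}$, such that the following holds. 1. $M_n(A)\to M(A)$ as $n\to\infty$ for every Borel set $A\subset\mathbb R^d$. 2. For every $n$, $S^{(n)}$ is a compound Poisson process on $[0,T]$ with jump measure $M_n$: it is a Lévy process with $\mathbb E\,e^{i\langle z,S^{(n)}_t\rangle}=\exp\big(t\int(e^{i\langle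 z,x\rangle}-1)M_n(dx)\big)$. 3. Suppose that the means exist, that is, $\alpha>1$ or $\int_{\{\|x\|>1\}}\|x\|\,M(dx)<\infty$. Then $\sum_{\Gamma_j\le Tn}H_j$ and $S^{(n)}_t$ are integrable and $\mathbb E[S_t^{(n)}]=\frac tT\,\mathbb E\big[\sum_{\Gamma_j\le Tn}H_j\big]$. The truncated series compensated by its mean, $$L^{(n)}_t=\sum_{\Gamma_j\le Tn}\mathbf 1_{(0,t]}(T_j)H_j-\frac tT\,\mathbb E\Big[\sum_{\Gamma_j\le Tn}H_j\Big],\qquad t\in[0,T],$$ is a (compensated compound Poisson) Lévy process on $[0,T]$ with characteristic triplet $(0,0,M_n)$ with respect to the centering function $c(x)=x$, i.e. $\mathbb E\,e^{i\langle z,L^{(n)}_t\rangle}=e^{t\psi_n(z)}$ with $\psi_n(z)=\int(e^{i\langle z,x\rangle}-1-i\langle z,x\rangle)M_n(dx)$. Moreover $(0,0,M)$ is an admissible triplet for this centering, i.e. $M(\{0\})=0$ and $\int\min(\|x\|^2,\|x\|)\,M(dx)<\infty$, and as $n\to\infty$ the triplets $(0,0,M_n)$ converge to $(0,0,M)$ in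 the following sense: $\int f\,dM_n\to\int f\,dM$ for every bounded continuous $f$ vanishing near $0$; $\lim_{\varepsilon\downarrow0}\limsup_{n}\int_{\{\|x\|\le\varepsilon\}}\langle z,x\rangle^2M_n(dx)=0$ for every $z$; and $\lim_{R\to\infty}\limsup_n\int_{\{\|x\|>R\}}\|x\|\,M_n(dx)=0$. Also $\mathbb E\,e^{i\langle z,L_t^{(n)}\rangle}\to e^{t\psi(z)}$ for all $z\in\mathbb R^d$ and $t\in[0,T]$, where $\psi(z)=\int(e^{i\langle z,x\rangle}-1-i\langle z,x\rangle)M(dx)$. -/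

import Mathlib

open MeasureTheory ProbabilityTheory Filter Topology Set
open scoped ENNReal

noncomputable section

namespace TemperedStable

/-! ### Proper tempered stable Lévy measures -/

/-- `ℝ^d` with the Euclidean norm. -/
abbrev Space (d : ℕ) : Type := EuclideanSpace ℝ (Fin d)

/-- The unit sphere of `ℝ^d`. -/
abbrev Sph (d : ℕ) : Type := Metric.sphere (0 : Space d) 1

/-- Complete monotonicity of a function on `(0, ∞)`. -/
def CompletelyMonotone (f : ℝ → ℝ) : Prop :=
  ContDiffOn ℝ ((⊤ : ℕ∞) : WithTop ℕ∞) f (Ioi 0) ∧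
    ∀ (k : ℕ) (r : ℝ), 0 < r → 0 ≤ (-1) ^ k * iteratedDerivWithin k f (Ioi 0) r

/-- `q : (0, ∞) × S^{d-1} → (0, ∞)` is a proper tempering function (only the values `q r u` with
`0 < r` matter). -/
structure IsProperTempering {d : ℕ} (q : ℝ → Sph d → ℝ) : Prop where
  pos : ∀ r u, 0 < r → 0 < q r u
  borel : Measurable fun x : Ioi (0 : ℝ) × Sph d => q x.1 x.2
  completelyMonotone : ∀ u, CompletelyMonotone fun r => q r u
  proper : ∀ u, Tendsto (fun r => q r u) (𝓝[>] 0) (𝓝 1)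

/-- The measurable family `Q(· | u)` of Borel measures on `(0, ∞)` has the tempering function as
its Laplace transform: `q(r, u) = ∫ exp(-r s) Q(ds | u)` for `r > 0`. -/
structure IsTemperingFamily {d : ℕ} (q : ℝ → Sph d → ℝ) (Q : Kernel (Sph d) ℝ) : Prop where
  supported : ∀ u, Q u (Iic 0) = 0
  laplace : ∀ u r, 0 < r →
    ∫⁻ s, ENNReal.ofReal (Real.exp (-(r * s))) ∂(Q u) = ENNReal.ofReal (q r u)

/-- The Lévy measure
`M(A) = ∫_{S^{d-1}} ∫_0^∞ 1_A(r u) q(r^p, u) r^{-α-1} dr σ(du)`. -/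
def levyMeasure {d : ℕ} (α p : ℝ) (σ : Measure (Sph d)) (q : ℝ → Sph d → ℝ) :
    Measure (Space d) :=
  ((((volume.restrict (Ioi (0 : ℝ))).prod σ).withDensity fun x =>
      ENNReal.ofReal (q (x.1 ^ p) x.2 * x.1 ^ (-α - 1))).map
    fun x => x.1 • (x.2 : Space d))

/-- The measure `Q(A) = ∫_{S^{d-1}} ∫_0^∞ 1_A(s u) Q(ds | u) σ(du)` on `ℝ^d`. -/
def spectralQ {d : ℕ} (σ : Measure (Sph d)) (Q : Kernel (Sph d) ℝ) : Measure (Space d) :=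
  (σ.compProd Q).map fun x => x.2 • (x.1 : Space d)

/-- The set `(x, ∞) B = {r u : r > x, u ∈ B}`. -/
def polarSet {d : ℕ} (x : ℝ) (B : Set (Sph d)) : Set (Space d) :=
  {y | ∃ r > x, ∃ u ∈ B, y = r • (u : Space d)}

/-- The defining double integral of the Lévy measure. -/
theorem levyMeasure_apply {d : ℕ} {α p : ℝ} (σ : Measure (Sph d)) [IsFiniteMeasure σ]
    {q : ℝ → Sph d → ℝ} (hq : IsProperTempering q) {A : Set (Space d)} (hA : MeasurableSet A) :
    levyMeasure α p σ q A = ∫⁻ u, ∫⁻ r in Ioi (0 : ℝ), A.indicator 1 (r • (u : Space d)) *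
      ENNReal.ofReal (q (r ^ p) u * r ^ (-α - 1)) ∂volume ∂σ := by
  have hm : Measurable fun x : ℝ × Sph d => x.1 • (x.2 : Space d) := by fun_prop
  set g : Ioi (0 : ℝ) × Sph d → ℝ := fun x => q x.1 x.2 with hg
  have hgm : Measurable g := hq.borel
  let proj : ℝ → Ioi (0 : ℝ) := fun r =>
    ⟨if 0 < r then r else 1, by split_ifs with h; exacts [h, mem_Ioi.2 one_pos]⟩
  have hproj : Measurable proj :=
    (Measurable.ite measurableSet_Ioi measurable_id measurable_const).subtype_mk
  have hae : AEMeasurable (fun x : ℝ × Sph d =>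
      ENNReal.ofReal (q (x.1 ^ p) x.2 * x.1 ^ (-α - 1)))
      ((volume.restrict (Ioi (0 : ℝ))).prod σ) := by
    refine ⟨fun x => ENNReal.ofReal (g (proj (x.1 ^ p), x.2) * x.1 ^ (-α - 1)), by fun_prop, ?_⟩
    have h0 : ∀ᵐ x ∂((volume.restrict (Ioi (0 : ℝ))).prod σ), x.1 ∈ Ioi (0 : ℝ) :=
      Measure.quasiMeasurePreserving_fst.ae (ae_restrict_mem measurableSet_Ioi)
    filter_upwards [h0] with x hx
    have hx' : 0 < x.1 ^ p := Real.rpow_pos_of_pos hx p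
    simp [hg, proj, hx']
  rw [levyMeasure, Measure.map_apply hm hA, withDensity_apply _ (hm hA),
    ← lintegral_indicator (hm hA), lintegral_prod_symm]
  · refine lintegral_congr fun u => lintegral_congr fun r => ?_
    by_cases h : r • (u : Space d) ∈ A <;> simp [indicator, h]
  · exact hae.indicator (hm hA)

/-! ### Lévy processes on `[0, T]` and characteristic triplets -/

/-- `X` is, on the time interval `[0, T]`, an `ℝ^d`-valued Lévy process under `P`. -/
structure IsLevyProcessOn {Ω : Type*} [MeasurableSpace Ω] {d : ℕ} (P : Measure Ω) (T : ℝ)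
    (X : ℝ → Ω → Space d) : Prop where
  aemeasurable : ∀ t ∈ Icc 0 T, AEMeasurable (X t) P
  zero : ∀ᵐ ω ∂P, X 0 ω = 0
  indep : HasIndepIncrements (fun t : Icc (0 : ℝ) T => X t) P
  stationary : ∀ s t, 0 ≤ s → s ≤ t → t ≤ T →
    IdentDistrib (fun ω => X t ω - X s ω) (X (t - s)) P P
  stochCont : ∀ t ∈ Icc 0 T, TendstoInMeasure P X (𝓝[Icc 0 T] t) (X t)
  cadlag : ∀ᵐ ω ∂P,
    (∀ t ∈ Ico 0 T, Tendsto (fun s => X s ω) (𝓝[>] t) (𝓝 (X t ω))) ∧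
    (∀ t ∈ Ioc 0 T, ∃ l, Tendsto (fun s => X s ω) (𝓝[<] t) (𝓝 l))

/-- A triplet `(γ, A, ν)`: drift, Gaussian covariance operator, measure of jumps. -/
structure Triplet (d : ℕ) where
  drift : Space d
  cov : Space d →L[ℝ] Space d
  jumps : Measure (Space d)

/-- Admissible triplets of infinitely divisible laws with finite mean: `A` is symmetric and
nonnegative, `ν({0}) = 0` and `∫ min(‖x‖², ‖x‖) ν(dx) < ∞`. -/
structure Triplet.IsAdmissible {d : ℕ} (τ : Triplet d) : Prop where
  cov_pos : τ.cov.IsPositive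
  jumps_zero : τ.jumps {0} = 0
  integrable : ∫⁻ x, ENNReal.ofReal (min (‖x‖ ^ 2) ‖x‖) ∂τ.jumps < ∞

/-- The Lévy–Khintchine exponent, with the jumps compensated by their mean (centering function
`c(x) = x`, so that `γ` is the mean of the law at time one):
`ψ(z) = i⟨γ, z⟩ - ⟨A z, z⟩ / 2 + ∫ (exp(i⟨x, z⟩) - 1 - i⟨x, z⟩) ν(dx)`. -/
def Triplet.exponent {d : ℕ} (τ : Triplet d) (z : Space d) : ℂ :=
  Complex.I * (inner ℝ τ.drift z : ℝ) - (inner ℝ (τ.cov z) z : ℝ) / 2 +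
    ∫ x, (Complex.exp (Complex.I * (inner ℝ x z : ℝ)) - 1 - Complex.I * (inner ℝ x z : ℝ))
      ∂τ.jumps

/-- `X` is a Lévy process on `[0, T]` with characteristic triplet `τ`. -/
structure HasTripletOn {Ω : Type*} [MeasurableSpace Ω] {d : ℕ} (P : Measure Ω) (T : ℝ)
    (X : ℝ → Ω → Space d) (τ : Triplet d) : Prop where
  levy : IsLevyProcessOn P T X
  admissible : τ.IsAdmissible
  charFun_eq : ∀ t ∈ Icc 0 T, ∀ z, charFun (P.map (X t)) z = Complex.exp (t * τ.exponent z)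

/-- `X` is a (pure jump, driftless) compound Poisson process on `[0, T]`: a Lévy process whose
law at time `t` has characteristic function `exp(t ∫ (exp(i⟨x, z⟩) - 1) ν(dx))` with a finite
measure `ν`, not charging `0`: the jump intensity times the law of the jumps. -/
structure IsCompoundPoissonOn {Ω : Type*} [MeasurableSpace Ω] {d : ℕ} (P : Measure Ω) (T : ℝ)
    (X : ℝ → Ω → Space d) (ν : Measure (Space d)) : Prop where
  levy : IsLevyProcessOn P T X
  finite : IsFiniteMeasure ν
  jumps_zero : ν {0} = 0
  charFun_eq : ∀ t ∈ Icc 0 T, ∀ z, charFun (P.map (X t)) z =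
    Complex.exp (t * ∫ x, (Complex.exp (Complex.I * (inner ℝ x z : ℝ)) - 1) ∂ν)

/-- Convergence of characteristic triplets (for the centering `c(x) = x`): the drifts converge,
the jump measures converge away from the origin, the small jumps only contribute to the Gaussian
covariance in the limit, and the large jumps are uniformly integrable. -/
structure TripletTendsto {d : ℕ} (τ : ℕ → Triplet d) (τ' : Triplet d) : Prop where
  drift : Tendsto (fun n => (τ n).drift) atTop (𝓝 τ'.drift)
  jumps : ∀ f : BoundedContinuousFunction (Space d) ℝ, (∀ᶠ x in 𝓝 0, f x = 0) →
    Tendsto (fun n => ∫ x, f x ∂(τ n).jumps) atTop (𝓝 (∫ x, f x ∂τ'.jumps))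
  cov : ∀ z : Space d, ∀ η > 0, ∀ᶠ ε in 𝓝[>] (0 : ℝ), ∀ᶠ n in atTop,
    |inner ℝ ((τ n).cov z) z + (∫ x in {x | ‖x‖ ≤ ε}, (inner ℝ x z : ℝ) ^ 2 ∂(τ n).jumps)
      - inner ℝ (τ'.cov z) z| < η
  tail : ∀ η > (0 : ℝ), ∀ᶠ R in atTop, ∀ᶠ n in atTop,
    ∫⁻ x in {x | R < ‖x‖}, ‖x‖ₑ ∂(τ n).jumps < ENNReal.ofReal η

/-! ### The truncated series -/

/-- The random input of the series: i.i.d. standard exponentials `E'` and `E`, i.i.d. uniforms `τ`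
on `(0, T)` and `U` on `(0, 1)`, i.i.d. vectors `V` with law `ρ`; all sequences are
independent of each other. -/
structure IsSeriesInput {Ω : Type*} [MeasurableSpace Ω] {d : ℕ} (P : Measure Ω) (T : ℝ)
    (ρ : Measure (Space d)) (E' E τ U : ℕ → Ω → ℝ) (V : ℕ → Ω → Space d) : Prop where
  meas_E' : ∀ j, Measurable (E' j)
  meas_E : ∀ j, Measurable (E j)
  meas_τ : ∀ j, Measurable (τ j)
  meas_U : ∀ j, Measurable (U j)
  meas_V : ∀ j, Measurable (V j)
  law_E' : ∀ j, P.map (E' j) = expMeasure 1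
  law_E : ∀ j, P.map (E j) = expMeasure 1
  law_τ : ∀ j, pdf.IsUniform (τ j) (Ioo 0 T) P
  law_U : ∀ j, pdf.IsUniform (U j) (Ioo 0 1) P
  law_V : ∀ j, P.map (V j) = ρ
  indep_real : iIndepFun (fun k : Fin 4 × ℕ => (![E', E, τ, U] k.1) k.2) P
  indep_V : iIndepFun V P
  indep_real_V : IndepFun (fun ω (k : Fin 4 × ℕ) => (![E', E, τ, U] k.1) k.2 ω)
    (fun ω (j : ℕ) => V j ω) P

/-- The arrival times `Γ_1 < Γ_2 < …` (`arrival E' j` is `Γ_{j+1}`). -/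
def arrival {Ω : Type*} (E' : ℕ → Ω → ℝ) (j : ℕ) (ω : Ω) : ℝ :=
  ∑ i ∈ Finset.range (j + 1), E' i ω

/-- `H(s; (v, e, u)) = ((α s / (‖σ‖ T))^{-1/α} ∧ e^{1/p} u^{1/α} / ‖v‖^{1/p}) v / ‖v‖`, where
`m = ‖σ‖`. -/
def jumpH {d : ℕ} (α p m T s : ℝ) (v : Space d) (e u : ℝ) : Space d :=
  min ((α * s / (m * T)) ^ (-1 / α)) (e ^ (1 / p) * u ^ (1 / α) / ‖v‖ ^ (1 / p)) •
    ((1 / ‖v‖) • v)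

/-- The truncated series `∑_{Γ_j ≤ T n} 1_{(0,t]}(T_j) H(Γ_j; (V_j, E_j, U_j))` (almost surely a
finite sum). -/
def truncSum {Ω : Type*} {d : ℕ} (α p m T : ℝ) (E' E τ U : ℕ → Ω → ℝ) (V : ℕ → Ω → Space d)
    (n : ℕ) (t : ℝ) (ω : Ω) : Space d := by
  classical
  exact ∑' j, if arrival E' j ω ≤ T * n ∧ τ j ω ∈ Ioc 0 t then
    jumpH α p m T (arrival E' j ω) (V j ω) (E j ω) (U j ω) else 0

/-- The sum of all jumps kept, `∑_{Γ_j ≤ T n} H(Γ_j; (V_j, E_j, U_j))`. -/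
def truncTotal {Ω : Type*} {d : ℕ} (α p m T : ℝ) (E' E U : ℕ → Ω → ℝ) (V : ℕ → Ω → Space d)
    (n : ℕ) (ω : Ω) : Space d := by
  classical
  exact ∑' j, if arrival E' j ω ≤ T * n then
    jumpH α p m T (arrival E' j ω) (V j ω) (E j ω) (U j ω) else 0

/-- The truncated series compensated by its mean,
`L_t^{(n)} = ∑_{Γ_j ≤ T n} 1_{(0,t]}(T_j) H(Γ_j; …) - (t / T) 𝔼[∑_{Γ_j ≤ T n} H(Γ_j; …)]`. -/
def truncProcess {Ω : Type*} [MeasurableSpace Ω] {d : ℕ} (P : Measure Ω) (α p m T : ℝ)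
    (E' E τ U : ℕ → Ω → ℝ) (V : ℕ → Ω → Space d) (n : ℕ) (t : ℝ) (ω : Ω) : Space d :=
  truncSum α p m T E' E τ U V n t ω - (t / T) • ∫ ω', truncTotal α p m T E' E U V n ω' ∂P

end TemperedStable

end

noncomputable section

namespace TemperedStable

/-! ### A chain rule for primitives of bounded measurable functions -/

/-! The arrival times `Γ_j` with marks `(T_j, V_j, E_j, U_j)` are a Poisson process whose intensity
is Lebesgue measure on `(0, ∞)` times the law of a mark. No random measure is built. Two formulas
for sums over the points with `Γ_j ≤ L` suffice: Campbell's formula (`integrable_pointSum`) and the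
characteristic functional (`integral_exp_tsum_point`). Both rest on one computation, the expected
product over the first points (`integral_markProd_mul`).

If the jumps are split according to disjoint windows for the time mark, each point falls in at most
one window, so the exponent of the characteristic functional is a sum over windows. This gives
independent increments whose law depends only on the length of the window, hence a compound Poisson
process. Its jump measure is `T⁻¹` times the image of the intensity on `(0, T n]` under the jump
function.

To identify this image, note that the minimum in the jump exceeds `x` exactly when both of its
entries do: the arrival time is below `‖σ‖ T / (α x ^ α)`, and the mark lies in a set of probability
`(α x ^ α / ‖σ‖) * M((x, ∞) B)`. The latter holds because averaging the exponential tail of `E` over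
the law of `V` produces the Laplace transform `q` (`markLaw_polar_tail`). With all arrival times
allowed the factors cancel and the image is `M` itself; with arrival times in `(0, T n]` the factor
`min (n α x ^ α / ‖σ‖) 1` remains.

So `M` and all `M_n` are images of one measure and of its restrictions to an increasing sequence of
sets. Hence `M_n ≤ M`, `M_n(A) → M(A)` for every Borel `A`, and integrals of `M`-integrable
functions converge. Integrability follows from the bound `c * s ^ (-1 / α)` for the norm of a jump
at arrival time `s`: its square is integrable at infinity since `α < 2`, and it is itself integrable
at `0` if `1 < α`. -/

lemma intervalIntegrable_of_norm_le {G : ℝ → ℂ} (hG : Measurable G) {C : ℝ}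
    (hb : ∀ s, ‖G s‖ ≤ C) (a b : ℝ) : IntervalIntegrable G volume a b :=
  (intervalIntegrable_const (c := C)).mono_fun hG.aestronglyMeasurable
    (ae_of_all _ fun s => (hb s).trans (le_abs_self C))

lemma continuous_primitive_of_norm_le {G : ℝ → ℂ} (hG : Measurable G) {C : ℝ}
    (hb : ∀ s, ‖G s‖ ≤ C) : Continuous fun s => ∫ r in 0..s, G r :=
  intervalIntegral.continuous_primitive (intervalIntegrable_of_norm_le hG hb) 0

/-- The fundamental theorem of calculus for `F ∘ Φ`, where `Φ` is the primitive of a bounded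
measurable function. -/
lemma integral_mul_comp_primitive {G : ℝ → ℂ} (hG : Measurable G) {C : ℝ} (hb : ∀ s, ‖G s‖ ≤ C)
    {F F' : ℂ → ℂ} (hF : ∀ z, HasDerivAt F (F' z) z) (hF' : Continuous F') (s : ℝ) :
    ∫ r in 0..s, G r * F' (∫ x in 0..r, G x) = F (∫ x in 0..s, G x) - F 0 := by
  set Φ : ℝ → ℂ := fun s => ∫ r in 0..s, G r with hΦ
  have hΦc : Continuous Φ := continuous_primitive_of_norm_le hG hb
  have hii : ∀ a b, IntervalIntegrable (fun r => G r * F' (Φ r)) volume a b := fun a b =>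
    (intervalIntegrable_of_norm_le hG hb a b).mul_continuousOn (hF'.comp hΦc).continuousOn
  have hlipΦ : LipschitzWith C.toNNReal Φ := by
    refine LipschitzWith.of_dist_le_mul fun x y => ?_
    rw [dist_eq_norm, hΦ]
    simp only
    rw [intervalIntegral.integral_interval_sub_left (intervalIntegrable_of_norm_le hG hb _ _)
      (intervalIntegrable_of_norm_le hG hb _ _)]
    refine (intervalIntegral.norm_integral_le_of_norm_le_const (C := C) fun r _ => hb r).trans ?_
    rw [Real.dist_eq, Real.coe_toNNReal _ ((norm_nonneg _).trans (hb 0))]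
  obtain ⟨B, hB⟩ := (isCompact_uIcc (a := (0 : ℝ)) (b := s)).exists_bound_of_continuousOn
    (hF'.comp hΦc).continuousOn
  have hlip1 : LipschitzOnWith (C * B).toNNReal (fun s => ∫ r in 0..s, G r * F' (Φ r))
      (uIcc 0 s) := by
    refine LipschitzOnWith.of_dist_le_mul fun x hx y hy => ?_
    rw [dist_eq_norm, intervalIntegral.integral_interval_sub_left (hii _ _) (hii _ _)]
    have hCB : 0 ≤ C * B := mul_nonneg ((norm_nonneg _).trans (hb 0))
      ((norm_nonneg _).trans (hB 0 left_mem_uIcc))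
    rw [Real.dist_eq, Real.coe_toNNReal _ hCB]
    refine intervalIntegral.norm_integral_le_of_norm_le_const (C := C * B) fun r hr => ?_
    rw [norm_mul]
    have hr' : r ∈ uIcc 0 s := uIcc_subset_uIcc hy hx (uIoc_subset_uIcc hr)
    exact mul_le_mul (hb r) (hB r hr') (norm_nonneg _) ((norm_nonneg _).trans (hb 0))
  obtain ⟨R, hR⟩ := (isCompact_uIcc (a := (0 : ℝ)) (b := s)).exists_bound_of_continuousOn
    hΦc.continuousOn
  have hFc : ContDiff ℝ 1 F := by
    have : ContDiff ℂ 1 F := contDiff_one_iff_deriv.2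
      ⟨fun z => (hF z).differentiableAt, by
        have : deriv F = F' := funext fun z => (hF z).deriv
        rwa [this]⟩
    exact this.restrict_scalars ℝ
  obtain ⟨K, hK⟩ := hFc.contDiffOn.exists_lipschitzOnWith (by decide)
    (convex_closedBall (0 : ℂ) R) (isCompact_closedBall (0 : ℂ) R)
  have hlip2 : LipschitzOnWith (K * C.toNNReal) (fun x => F (Φ x)) (uIcc 0 s) :=
    hK.comp (hlipΦ.lipschitzOnWith) fun x hx => by simpa using hR x hx
  -- `G` is only measurable, so the derivatives of the two sides are known to agree only almost
  -- everywhere; absolute continuity, from the Lipschitz bounds, is what makes the difference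
  -- constant.
  have hAC := hlip1.absolutelyContinuousOnInterval.sub hlip2.absolutelyContinuousOnInterval
  obtain ⟨c, hc⟩ := hAC.const_of_ae_hasDerivAt_zero (by
    filter_upwards [(hii 0 s).ae_hasDerivAt_integral,
      (intervalIntegrable_of_norm_le hG hb 0 s).ae_hasDerivAt_integral] with x h1 h2 hx
    have h1 := h1 hx 0 left_mem_uIcc
    have h2 := h2 hx 0 left_mem_uIcc
    have h3 := (hF (Φ x)).comp x h2
    have h4 := h1.sub h3
    rwa [mul_comm (G x), sub_self] at h4)
  have e0 := hc 0 left_mem_uIcc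
  have e1 := hc s right_mem_uIcc
  rw [← e0] at e1
  simp only [Pi.sub_apply, intervalIntegral.integral_same, hΦ] at e1
  linear_combination e1

/-! ### The exponential law -/

lemma expMeasure_one_eq : expMeasure 1 =
    (volume.restrict (Ioi (0 : ℝ))).withDensity fun s => ENNReal.ofReal (Real.exp (-s)) := by
  rw [expMeasure, gammaMeasure, ← withDensity_indicator measurableSet_Ioi]
  refine withDensity_congr_ae ?_
  -- The gamma density equals `1` at the origin, which `Ioi 0` leaves out.
  have h0 : ∀ᵐ s : ℝ, s ≠ 0 := by simp [ae_iff, measure_singleton]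
  filter_upwards [h0] with s hs
  rw [gammaPDF_eq]
  rcases lt_or_gt_of_ne hs with h | h
  · simp [indicator, not_le.2 h, not_lt.2 h.le]
  · simp [indicator, h.le, h]

instance : IsProbabilityMeasure (expMeasure 1) := isProbabilityMeasure_expMeasure one_pos

lemma integral_expMeasure_one {E : Type*} [NormedAddCommGroup E] [NormedSpace ℝ E] (f : ℝ → E) :
    ∫ s, f s ∂(expMeasure 1) = ∫ s in Ioi (0 : ℝ), Real.exp (-s) • f s := by
  rw [expMeasure_one_eq, integral_withDensity_eq_integral_toReal_smul (by fun_prop)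
    (ae_of_all _ fun _ => ENNReal.ofReal_lt_top)]
  simp [(Real.exp_pos _).le]

lemma ae_expMeasure_one_pos : ∀ᵐ s ∂(expMeasure 1), 0 < s := by
  rw [expMeasure_one_eq]
  exact (withDensity_absolutelyContinuous _ _).ae_le (ae_restrict_mem measurableSet_Ioi)

/-! ### Poisson points with independent marks -/

/-- `E'` are i.i.d. standard exponentials and `ξ` i.i.d. marks with law `μ`, independent of each
other. -/
structure IsMarkedArrival {Ω 𝓧 : Type*} [MeasurableSpace Ω] [MeasurableSpace 𝓧] (P : Measure Ω)
    (μ : Measure 𝓧) (E' : ℕ → Ω → ℝ) (ξ : ℕ → Ω → 𝓧) : Prop where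
  meas_E' : ∀ j, Measurable (E' j)
  meas_mark : ∀ j, Measurable (ξ j)
  indep : iIndepFun (fun j ω => (E' j ω, ξ j ω)) P
  law : ∀ j, P.map (fun ω => (E' j ω, ξ j ω)) = (expMeasure 1).prod μ

/-- The product `∏_{j < k} g(Γ_j, ξ_j)`. -/
def markProd {Ω 𝓧 : Type*} (E' : ℕ → Ω → ℝ) (ξ : ℕ → Ω → 𝓧) (g : ℝ → 𝓧 → ℂ) (k : ℕ) (ω : Ω) : ℂ :=
  ∏ j ∈ Finset.range k, g (arrival E' j ω) (ξ j ω)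

/-- Fubini on the triangle `r < s`. In the induction for `integral_markProd_mul` it exchanges the
times of two consecutive points. -/
lemma setIntegral_mul_setIntegral_Ioc_comm {a b : ℝ → ℂ} {L : ℝ}
    (ha : IntegrableOn a (Ioc 0 L)) (hb : IntegrableOn b (Ioc 0 L)) :
    ∫ r in Ioc 0 L, b r * ∫ s in Ioc r L, a s = ∫ s in Ioc 0 L, a s * ∫ r in 0..s, b r := by
  have h1 : ∀ r ∈ Ioc 0 L, b r * ∫ s in Ioc r L, a s =
      ∫ s in Ioc 0 L, (if r < s then a s * b r else 0) := by
    intro r hr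
    have : Ioc r L = Ioc 0 L ∩ Ioi r := by
      ext s; simp only [mem_Ioc, mem_inter_iff, mem_Ioi]; constructor
      · intro h; exact ⟨⟨hr.1.trans h.1, h.2⟩, h.1⟩
      · intro h; exact ⟨h.2, h.1.2⟩
    rw [this, ← setIntegral_indicator measurableSet_Ioi, ← integral_const_mul]
    refine integral_congr_ae (ae_of_all _ fun s => ?_)
    by_cases h : r < s <;> simp [indicator, h, mul_comm]
  have h2 : ∀ s ∈ Ioc 0 L, a s * ∫ r in 0..s, b r =
      ∫ r in Ioc 0 L, (if r < s then a s * b r else 0) := by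
    intro s hs
    have : Ioo 0 s = Ioc 0 L ∩ Iio s := by
      ext r; simp only [mem_Ioc, mem_inter_iff, mem_Iio, mem_Ioo]; constructor
      · intro h; exact ⟨⟨h.1, h.2.le.trans hs.2⟩, h.2⟩
      · intro h; exact ⟨h.1.1, h.2⟩
    rw [intervalIntegral.integral_of_le hs.1.le, integral_Ioc_eq_integral_Ioo, this,
      ← setIntegral_indicator measurableSet_Iio, ← integral_const_mul]
    refine integral_congr_ae (ae_of_all _ fun r => ?_)
    by_cases h : r < s <;> simp [indicator, h]
  rw [setIntegral_congr_fun measurableSet_Ioc h1, setIntegral_congr_fun measurableSet_Ioc h2]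
  refine integral_integral_swap ?_
  have h3 : Integrable (fun x : ℝ × ℝ => a x.2 * b x.1)
      ((volume.restrict (Ioc 0 L)).prod (volume.restrict (Ioc 0 L))) := by
    simpa only [mul_comm] using hb.mul_prod ha
  have h4 := h3.indicator (s := {x : ℝ × ℝ | x.1 < x.2}) (measurableSet_lt measurable_fst
    measurable_snd)
  refine h4.congr (ae_of_all _ fun x => ?_)
  by_cases h : x.1 < x.2 <;> simp [indicator, Function.uncurry, h]

lemma arrival_eq {Ω : Type*} (E' : ℕ → Ω → ℝ) (k : ℕ) (ω : Ω) :
    arrival E' k ω = ∑ i ∈ Finset.range k, E' i ω + E' k ω := Finset.sum_range_succ _ _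

lemma norm_markProd_le {Ω 𝓧 : Type*} {E' : ℕ → Ω → ℝ} {ξ : ℕ → Ω → 𝓧} {g : ℝ → 𝓧 → ℂ}
    (hb : ∀ s x, ‖g s x‖ ≤ 1) (k : ℕ) (ω : Ω) : ‖markProd E' ξ g k ω‖ ≤ 1 := by
  rw [markProd, norm_prod]
  exact Finset.prod_le_one (fun _ _ => norm_nonneg _) fun _ _ => hb _ _

/-! ### Expected products over the first marked points -/

namespace IsMarkedArrival

variable {Ω 𝓧 : Type*} [MeasurableSpace Ω] [MeasurableSpace 𝓧] {P : Measure Ω}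
  {μ : Measure 𝓧} {E' : ℕ → Ω → ℝ} {ξ : ℕ → Ω → 𝓧}

lemma measurable_arrival (h : IsMarkedArrival P μ E' ξ) (j : ℕ) : Measurable (arrival E' j) := by
  have := h.meas_E'
  unfold arrival
  fun_prop

lemma measurable_markProd (h : IsMarkedArrival P μ E' ξ) {g : ℝ → 𝓧 → ℂ}
    (hg : Measurable (Function.uncurry g)) (k : ℕ) : Measurable (markProd E' ξ g k) :=
  Finset.measurable_prod _ fun j _ => hg.comp ((h.measurable_arrival j).prodMk (h.meas_mark j))

/-- The past up to the `k`-th point is independent of the next waiting time and mark. -/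
lemma indepFun_past (h : IsMarkedArrival P μ E' ξ) {g : ℝ → 𝓧 → ℂ}
    (hg : Measurable (Function.uncurry g)) (k : ℕ) :
    IndepFun (fun ω => (markProd E' ξ g k ω, ∑ i ∈ Finset.range k, E' i ω))
      (fun ω => (E' k ω, ξ k ω)) P := by
  rcases Nat.eq_zero_or_pos k with rfl | hk
  · simp only [markProd, Finset.range_zero, Finset.prod_empty, Finset.sum_empty]
    have := h.indep.isProbabilityMeasure
    exact indepFun_const_left _ _
  have h1 := h.indep.indepFun_finset (Finset.range k) {k} (by simp)
    (fun j => (h.meas_E' j).prodMk (h.meas_mark j))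
  -- The finite tuple is extended to all of `ℕ` so that partial sums can be written without
  -- subtypes. The filler, entry `0`, exists because `0 < k` and is never used by `F`.
  let ext : (Finset.range k → ℝ × 𝓧) → ℕ → ℝ × 𝓧 := fun w j =>
    if hj : j ∈ Finset.range k then w ⟨j, hj⟩ else w ⟨0, by simpa using hk⟩
  have hext : ∀ j, Measurable fun w => ext w j := by
    intro j
    by_cases hj : j ∈ Finset.range k
    · simp only [ext, hj, dif_pos]; fun_prop
    · simp only [ext, hj, dif_neg, not_false_eq_true]; fun_prop
  let F : (Finset.range k → ℝ × 𝓧) → ℂ × ℝ := fun w =>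
    (∏ j ∈ Finset.range k, g (∑ i ∈ Finset.range (j + 1), (ext w i).1) (ext w j).2,
      ∑ i ∈ Finset.range k, (ext w i).1)
  have hF : Measurable F := by
    have hs : ∀ n, Measurable fun w => ∑ i ∈ Finset.range n, (ext w i).1 := fun n =>
      Finset.measurable_sum _ fun i _ => (hext i).fst
    exact Measurable.prodMk (Finset.measurable_prod _ fun j _ => hg.comp
      ((hs (j + 1)).prodMk (hext j).snd)) (hs k)
  have hproj : Measurable fun w : ({k} : Finset ℕ) → ℝ × 𝓧 => w ⟨k, Finset.mem_singleton_self k⟩ :=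
    measurable_pi_apply _
  have hFX : (fun ω => (markProd E' ξ g k ω, ∑ i ∈ Finset.range k, E' i ω)) =
      F ∘ fun ω (i : Finset.range k) => (E' i ω, ξ i ω) := by
    funext ω
    have he : ∀ j ∈ Finset.range k,
        ext (fun i : Finset.range k => (E' i ω, ξ i ω)) j = (E' j ω, ξ j ω) := by
      intro j hj; simp only [ext, hj, dif_pos]
    simp only [markProd, Function.comp, F, Prod.mk.injEq]
    refine ⟨Finset.prod_congr rfl fun j hj => ?_,
      Finset.sum_congr rfl fun i hi => by rw [he i hi]⟩
    rw [he j hj, arrival]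
    congr 1
    refine Finset.sum_congr rfl fun i hi => ?_
    rw [he i]
    simp only [Finset.mem_range] at hi hj ⊢; omega
  rw [hFX]
  exact h1.comp hF hproj

/-- Conditioning on the past: by `indepFun_past` the next waiting time and mark can be integrated
out while the past is kept fixed. -/
lemma integral_markProd_mul_step [IsProbabilityMeasure μ] (h : IsMarkedArrival P μ E' ξ)
    {g φ : ℝ → 𝓧 → ℂ} (hg : Measurable (Function.uncurry g)) (hb : ∀ s x, ‖g s x‖ ≤ 1)
    (hφ : Measurable (Function.uncurry φ)) {C : ℝ} (hφb : ∀ s x, ‖φ s x‖ ≤ C) (k : ℕ) :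
    ∫ ω, markProd E' ξ g k ω * φ (arrival E' k ω) (ξ k ω) ∂P =
      ∫ ω, markProd E' ξ g k ω *
        (∫ y, φ ((∑ i ∈ Finset.range k, E' i ω) + y.1) y.2 ∂((expMeasure 1).prod μ)) ∂P := by
  have := h.indep.isProbabilityMeasure
  set X : Ω → ℂ × ℝ := fun ω => (markProd E' ξ g k ω, ∑ i ∈ Finset.range k, E' i ω) with hX
  set Y : Ω → ℝ × 𝓧 := fun ω => (E' k ω, ξ k ω) with hY
  have hXm : Measurable X := (h.measurable_markProd hg k).prodMk
    (Finset.measurable_sum _ fun i _ => h.meas_E' i)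
  have hYm : Measurable Y := (h.meas_E' k).prodMk (h.meas_mark k)
  have hlaw := (indepFun_iff_map_prod_eq_prod_map_map hXm.aemeasurable hYm.aemeasurable).1
    (h.indepFun_past hg k)
  set f : (ℂ × ℝ) × (ℝ × 𝓧) → ℂ := fun w => w.1.1 * φ (w.1.2 + w.2.1) w.2.2 with hf
  have hfm : Measurable f := by
    refine Measurable.mul (by fun_prop) (hφ.comp (Measurable.prodMk ?_ ?_)) <;> fun_prop
  have e1 : ∫ ω, markProd E' ξ g k ω * φ (arrival E' k ω) (ξ k ω) ∂P =
      ∫ w, f w ∂(P.map fun ω => (X ω, Y ω)) := by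
    rw [integral_map (hXm.prodMk hYm).aemeasurable hfm.aestronglyMeasurable]
    simp only [hf, hX, hY, arrival_eq]
  have := Measure.isProbabilityMeasure_map (μ := P) hXm.aemeasurable
  have hint : Integrable f ((P.map X).prod ((expMeasure 1).prod μ)) := by
    rw [← h.law k, ← hlaw, integrable_map_measure hfm.aestronglyMeasurable
      (hXm.prodMk hYm).aemeasurable]
    refine Integrable.of_bound (hfm.comp (hXm.prodMk hYm)).aestronglyMeasurable C
      (ae_of_all _ fun ω => ?_)
    simp only [hf, hX, Function.comp, norm_mul]
    calc _ ≤ 1 * C := mul_le_mul (norm_markProd_le hb _ _) (hφb _ _) (norm_nonneg _) zero_le_one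
      _ = C := one_mul C
  rw [e1, hlaw, h.law k, integral_prod _ hint, integral_map hXm.aemeasurable]
  · simp only [hf, hX, integral_const_mul]
  · exact (hfm.stronglyMeasurable.integral_prod_right).aestronglyMeasurable

/-- Substituting `s = r + y.1` turns the waiting time into the absolute time of the next point. The
cut at `L` costs nothing, since `φ` vanishes beyond it. -/
lemma integral_shift_eq [IsProbabilityMeasure μ] {φ : ℝ → 𝓧 → ℂ}
    (hφ : Measurable (Function.uncurry φ)) {C : ℝ} (hφb : ∀ s x, ‖φ s x‖ ≤ C) {L : ℝ}
    (hL : ∀ s x, L < s → φ s x = 0) (r : ℝ) :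
    ∫ y, φ (r + y.1) y.2 ∂((expMeasure 1).prod μ) =
      ∫ s in Ioc r L, (Real.exp (-(s - r)) : ℂ) * ∫ x, φ s x ∂μ := by
  have hm : Measurable fun y : ℝ × 𝓧 => φ (r + y.1) y.2 :=
    hφ.comp (Measurable.prodMk (by fun_prop) (by fun_prop))
  rw [integral_prod _ (Integrable.of_bound hm.aestronglyMeasurable C
    (ae_of_all _ fun _ => hφb _ _)),
    integral_expMeasure_one, ← integral_indicator measurableSet_Ioi,
    ← integral_indicator measurableSet_Ioc,
    ← integral_sub_right_eq_self _ r]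
  refine integral_congr_ae (ae_of_all _ fun s => ?_)
  by_cases h1 : r < s
  · by_cases h2 : s ≤ L
    · simp [indicator, h1, h2]
    · simp [indicator, h1, h2, hL s _ (not_le.1 h2)]
  · simp [indicator, h1]

/-- The next point after `k` points has density `exp(-s) s ^ k / k!`, and given its time `s` the
earlier points behave like `k` independent uniform ones on `(0, s)`, each contributing the mean of
`g`. The induction does not use this conditional law: integrating out the last point gives a nested
integral, Fubini reverses it, and the chain rule for `z ^ (k + 1) / (k + 1)!` raises the power by
one. -/
theorem integral_markProd_mul [IsProbabilityMeasure μ] (h : IsMarkedArrival P μ E' ξ)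
    {g : ℝ → 𝓧 → ℂ} (hg : Measurable (Function.uncurry g)) (hb : ∀ s x, ‖g s x‖ ≤ 1) {L : ℝ}
    (k : ℕ) {φ : ℝ → 𝓧 → ℂ} (hφ : Measurable (Function.uncurry φ)) {C : ℝ}
    (hφb : ∀ s x, ‖φ s x‖ ≤ C) (hL : ∀ s x, L < s → φ s x = 0) :
    ∫ ω, markProd E' ξ g k ω * φ (arrival E' k ω) (ξ k ω) ∂P =
      ∫ s in Ioc 0 L, (Real.exp (-s) * ∫ x, φ s x ∂μ) *
        ((∫ r in 0..s, ∫ x, g r x ∂μ) ^ k / k.factorial) := by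
  have := h.indep.isProbabilityMeasure
  induction k generalizing φ C with
  | zero =>
    rw [h.integral_markProd_mul_step hg hb hφ hφb]
    have := integral_shift_eq (μ := μ) hφ hφb hL 0
    simp only [zero_add, sub_zero] at this
    simp [markProd, this]
  | succ k ih =>
    rw [h.integral_markProd_mul_step hg hb hφ hφb]
    set ψ : ℝ → ℂ := fun r => ∫ y, φ (r + y.1) y.2 ∂((expMeasure 1).prod μ) with hψ
    have hψm : Measurable ψ := by
      have : Measurable fun w : ℝ × (ℝ × 𝓧) => φ (w.1 + w.2.1) w.2.2 :=
        hφ.comp (Measurable.prodMk (by fun_prop) (by fun_prop))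
      exact this.stronglyMeasurable.integral_prod_right.measurable
    have hψb : ∀ r, ‖ψ r‖ ≤ C := fun r => by
      simpa using norm_integral_le_of_norm_le_const (μ := (expMeasure 1).prod μ)
        (f := fun y => φ (r + y.1) y.2) (ae_of_all _ fun y => hφb _ _)
    have hψL : ∀ r, L < r → ψ r = 0 := fun r hr => by
      simp only [hψ]
      rw [integral_shift_eq hφ hφb hL, Ioc_eq_empty (not_lt.2 hr.le)]; simp
    -- The last factor of the product is moved into the test function. The new one, `g s x * ψ s`,
    -- keeps the bound `C` and still vanishes beyond `L`, so the induction hypothesis applies to it.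
    have e1 : ∀ ω, markProd E' ξ g (k + 1) ω * ψ (∑ i ∈ Finset.range (k + 1), E' i ω) =
        markProd E' ξ g k ω * (fun s x => g s x * ψ s) (arrival E' k ω) (ξ k ω) := by
      intro ω
      simp only [markProd, Finset.prod_range_succ, arrival]
      ring
    rw [integral_congr_ae (ae_of_all _ e1), ih (φ := fun s x => g s x * ψ s) (C := C)]
    rotate_left
    · exact hg.mul (hψm.comp measurable_fst)
    · intro s x
      rw [norm_mul]
      exact (mul_le_mul (hb s x) (hψb s) (norm_nonneg _) zero_le_one).trans (one_mul C).le
    · intro s x hs; simp [hψL s hs]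
    set G : ℝ → ℂ := fun r => ∫ x, g r x ∂μ with hG
    have hGm : Measurable G := hg.stronglyMeasurable.integral_prod_right.measurable
    have hGb : ∀ r, ‖G r‖ ≤ 1 := fun r => by
      simpa using norm_integral_le_of_norm_le_const (μ := μ) (f := g r)
        (ae_of_all _ fun y => hb _ _)
    have hΦc : Continuous fun s => ∫ r in 0..s, G r := continuous_primitive_of_norm_le hGm hGb
    set φb : ℝ → ℂ := fun s => ∫ x, φ s x ∂μ with hφb'
    have hφbm : Measurable φb := hφ.stronglyMeasurable.integral_prod_right.measurable
    have hφbb : ∀ r, ‖φb r‖ ≤ C := fun r => by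
      simpa using norm_integral_le_of_norm_le_const (μ := μ) (f := φ r)
        (ae_of_all _ fun y => hφb _ _)
    have e2 : ∀ r, (Real.exp (-r) * ∫ x, g r x * ψ r ∂μ) *
        ((∫ r in 0..r, G r) ^ k / k.factorial) =
        (G r * ((∫ r in 0..r, G r) ^ k / k.factorial)) *
          ∫ s in Ioc r L, (Real.exp (-s) : ℂ) * φb s := by
      intro r
      rw [integral_mul_const]
      have : ψ r = Real.exp r * ∫ s in Ioc r L, (Real.exp (-s) : ℂ) * φb s := by
        simp only [hψ]
        rw [integral_shift_eq hφ hφb hL, ← integral_const_mul]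
        refine integral_congr_ae (ae_of_all _ fun s => ?_)
        simp only [hφb', ← mul_assoc, ← Complex.ofReal_mul, ← Real.exp_add]
        ring_nf
      rw [this]
      have h3 : (Real.exp (-r) : ℂ) * Real.exp r = 1 := by
        rw [← Complex.ofReal_mul, ← Real.exp_add]; simp
      linear_combination (G r * ((∫ r in 0..r, G r) ^ k / k.factorial) *
          ∫ s in Ioc r L, (Real.exp (-s) : ℂ) * φb s) * h3
    simp only [e2]
    have hF : ∀ z : ℂ, HasDerivAt (fun z => z ^ (k + 1) / ((k + 1).factorial : ℂ))
        (z ^ k / (k.factorial : ℂ)) z := by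
      intro z
      have := (hasDerivAt_pow (k + 1) z).div_const ((k + 1).factorial : ℂ)
      convert! this using 1
      have : (k.factorial : ℂ) ≠ 0 := by exact_mod_cast k.factorial_ne_zero
      have : (k + 1 : ℂ) ≠ 0 := by exact_mod_cast k.succ_ne_zero
      rw [Nat.factorial_succ]; push_cast
      field_simp
    rw [setIntegral_mul_setIntegral_Ioc_comm]
    · refine setIntegral_congr_fun measurableSet_Ioc fun s _ => ?_
      rw [integral_mul_comp_primitive hGm hGb hF (by fun_prop)]
      simp [hφb']
    · have h1 : IntegrableOn (fun s => (Real.exp (-s) : ℂ)) (Ioc 0 L) :=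
        (Continuous.integrableOn_Ioc (by fun_prop))
      exact h1.mul_bdd (c := C) hφbm.aestronglyMeasurable (ae_of_all _ hφbb)
    · have h1 : IntegrableOn (fun s => ((∫ r in 0..s, G r) ^ k / k.factorial)) (Ioc 0 L) :=
        (Continuous.integrableOn_Ioc (by fun_prop))
      exact h1.bdd_mul (c := 1) hGm.aestronglyMeasurable (ae_of_all _ hGb)

end IsMarkedArrival

/-! ### Campbell's formula and the characteristic functional -/

lemma tsum_ofReal_exp_neg_mul_pow_div_factorial {s : ℝ} (hs : 0 ≤ s) :
    ∑' k : ℕ, ENNReal.ofReal (Real.exp (-s) * (s ^ k / k.factorial)) = 1 := by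
  have h := (NormedSpace.expSeries_div_hasSum_exp s).mul_left (Real.exp (-s))
  rw [← ENNReal.ofReal_tsum_of_nonneg (fun k => by positivity) h.summable, h.tsum_eq,
    ← Real.exp_eq_exp_ℝ, ← Real.exp_add]
  simp

namespace IsMarkedArrival

variable {Ω 𝓧 : Type*} [MeasurableSpace Ω] [MeasurableSpace 𝓧] {P : Measure Ω}
  {μ : Measure 𝓧} {E' : ℕ → Ω → ℝ} {ξ : ℕ → Ω → 𝓧}

lemma measurable_point (h : IsMarkedArrival P μ E' ξ) (k : ℕ) :
    Measurable fun ω => (arrival E' k ω, ξ k ω) :=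
  (h.measurable_arrival k).prodMk (h.meas_mark k)

/-- The joint law of an arrival time (before `L`) and its mark. -/
lemma map_point_restrict [IsProbabilityMeasure μ] (h : IsMarkedArrival P μ E' ξ) (L : ℝ) (k : ℕ) :
    (P.map fun ω => (arrival E' k ω, ξ k ω)).restrict (Iic L ×ˢ univ) =
      ((volume.restrict (Ioc 0 L)).withDensity fun s =>
        ENNReal.ofReal (Real.exp (-s) * (s ^ k / k.factorial))).prod μ := by
  have := h.indep.isProbabilityMeasure
  have := Measure.isProbabilityMeasure_map (μ := P) (h.measurable_point k).aemeasurable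
  refine Measure.ext_prod fun {A B} hA hB => ?_
  have hwc : Continuous fun s : ℝ => Real.exp (-s) * (s ^ k / k.factorial) := by fun_prop
  set φ : ℝ → 𝓧 → ℂ := fun s x => ((A ∩ Iic L) ×ˢ B).indicator (fun _ => 1) (s, x) with hφ
  have hAB : MeasurableSet ((A ∩ Iic L) ×ˢ B) := (hA.inter measurableSet_Iic).prod hB
  have hφm : Measurable (Function.uncurry φ) := measurable_const.indicator hAB
  have hφb : ∀ s x, ‖φ s x‖ ≤ 1 := fun s x => by
    by_cases hx : (s, x) ∈ (A ∩ Iic L) ×ˢ B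
    · simp only [hφ, indicator_of_mem hx]; simp
    · simp only [hφ, indicator_of_notMem hx]; simp
  -- With `g = 1` only the gamma density of the arrival time survives, and an indicator as test
  -- function reads off the joint law.
  have key := h.integral_markProd_mul (g := fun _ _ => 1) (L := L) measurable_const
    (fun _ _ => by simp) k hφm hφb
    (fun s x hs => by simp [hφ, indicator, not_le.2 hs])
  have e1 : ∫ ω, markProd E' ξ (fun _ _ => 1) k ω * φ (arrival E' k ω) (ξ k ω) ∂P =
      ((P.map fun ω => (arrival E' k ω, ξ k ω)).real ((A ∩ Iic L) ×ˢ B) : ℂ) := by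
    have : ∀ ω, markProd E' ξ (fun _ _ => 1) k ω * φ (arrival E' k ω) (ξ k ω) =
      ((fun ω => (arrival E' k ω, ξ k ω)) ⁻¹' ((A ∩ Iic L) ×ˢ B)).indicator
        (fun _ => (1 : ℂ)) ω := by
      intro ω; simp only [markProd, Finset.prod_const_one, one_mul, hφ]; rfl
    rw [integral_congr_ae (ae_of_all _ this),
      integral_indicator_const _ (h.measurable_point k hAB), map_measureReal_apply
        (h.measurable_point k) hAB]
    simp
  have e2 : ∀ s, ∫ x, φ s x ∂μ = (((A ∩ Iic L).indicator (fun _ => μ.real B) s : ℝ) : ℂ) := by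
    intro s
    by_cases hs : s ∈ A ∩ Iic L
    · have : ∀ x, φ s x = B.indicator (fun _ => 1) x := fun x => by
        by_cases hx : x ∈ B
        · simp only [hφ, indicator_of_mem (mk_mem_prod hs hx), indicator_of_mem hx]
        · simp only [hφ, indicator_of_notMem
            (show (s, x) ∉ (A ∩ Iic L) ×ˢ B from fun hc => hx hc.2),
            indicator_of_notMem hx]
      rw [integral_congr_ae (ae_of_all _ this), integral_indicator_const _ hB, indicator_of_mem hs]
      simp
    · have : ∀ x, φ s x = 0 := fun x => by
        simp only [hφ, indicator_of_notMem
          (show (s, x) ∉ (A ∩ Iic L) ×ˢ B from fun hc => hs hc.1)]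
      rw [integral_congr_ae (ae_of_all _ this), indicator_of_notMem hs]; simp
  have e3 : ∫ s in Ioc 0 L, (Real.exp (-s) * ∫ x, φ s x ∂μ) *
        ((∫ r in 0..s, ∫ x, (1 : ℂ) ∂μ) ^ k / k.factorial) =
      ((∫ s in Ioc 0 L, (A.indicator (fun s =>
        Real.exp (-s) * (s ^ k / k.factorial)) s) * μ.real B : ℝ) : ℂ) := by
    rw [← integral_complex_ofReal]
    refine setIntegral_congr_fun measurableSet_Ioc fun s hs => ?_
    simp only [e2]
    by_cases hsA : s ∈ A
    · rw [indicator_of_mem (show s ∈ A ∩ Iic L from ⟨hsA, hs.2⟩), indicator_of_mem hsA]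
      simp; ring
    · rw [indicator_of_notMem (show s ∉ A ∩ Iic L from fun hc => hsA hc.1),
        indicator_of_notMem hsA]
      simp
  rw [e1, e3] at key
  have key : (P.map fun ω => (arrival E' k ω, ξ k ω)).real ((A ∩ Iic L) ×ˢ B) = _ :=
    Complex.ofReal_injective key
  rw [Measure.restrict_apply (hA.prod hB), prod_inter_prod, inter_univ, Measure.prod_prod,
    ← ofReal_measureReal, key, integral_mul_const, mul_comm, ENNReal.ofReal_mul
    measureReal_nonneg, ofReal_measureReal, mul_comm, withDensity_apply _ hA,
    ← lintegral_indicator hA, ofReal_integral_eq_lintegral_ofReal]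
  · congr 1
    refine lintegral_congr fun s => ?_
    by_cases hs : s ∈ A <;> simp [hs]
  · exact hwc.integrableOn_Ioc.indicator hA
  · filter_upwards [ae_restrict_mem measurableSet_Ioc] with s hs
    by_cases hsA : s ∈ A
    · rw [indicator_of_mem hsA]
      have := hs.1.le
      exact mul_nonneg (Real.exp_pos _).le (by positivity)
    · rw [indicator_of_notMem hsA]; rfl

/-- Campbell's formula. -/
theorem tsum_lintegral_point [IsProbabilityMeasure μ] (h : IsMarkedArrival P μ E' ξ) (L : ℝ)
    {f : ℝ × 𝓧 → ℝ≥0∞} (hf : Measurable f) :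
    ∑' k, ∫⁻ ω, (if arrival E' k ω ≤ L then f (arrival E' k ω, ξ k ω) else 0) ∂P =
      ∫⁻ y, f y ∂((volume.restrict (Ioc 0 L)).prod μ) := by
  have e1 : ∀ k, ∫⁻ ω, (if arrival E' k ω ≤ L then f (arrival E' k ω, ξ k ω) else 0) ∂P =
      ∫⁻ s in Ioc 0 L, ENNReal.ofReal (Real.exp (-s) * (s ^ k / k.factorial)) *
        ∫⁻ x, f (s, x) ∂μ := by
    intro k
    have hS : MeasurableSet (Iic L ×ˢ (univ : Set 𝓧)) := measurableSet_Iic.prod MeasurableSet.univ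
    have : ∀ ω, (if arrival E' k ω ≤ L then f (arrival E' k ω, ξ k ω) else 0) =
        (Iic L ×ˢ (univ : Set 𝓧)).indicator f (arrival E' k ω, ξ k ω) := by
      intro ω; simp [indicator]
    rw [lintegral_congr this, ← lintegral_map (hf.indicator hS) (h.measurable_point k),
      lintegral_indicator hS, h.map_point_restrict, lintegral_prod _ hf.aemeasurable,
      lintegral_withDensity_eq_lintegral_mul _ (by fun_prop) hf.lintegral_prod_right']
    rfl
  rw [lintegral_prod _ hf.aemeasurable]
  simp only [e1]
  have hfm : Measurable fun s => ∫⁻ x, f (s, x) ∂μ := hf.lintegral_prod_right'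
  rw [← lintegral_tsum (fun k => by fun_prop)]
  refine setLIntegral_congr_fun measurableSet_Ioc fun s hs => ?_
  -- The gamma densities of all arrival times add up to `1`: the mean measure of the points is
  -- Lebesgue measure.
  rw [ENNReal.tsum_mul_right, tsum_ofReal_exp_neg_mul_pow_div_factorial hs.1.le, one_mul]

/-- The expected number of points before `L` is finite, by Campbell's formula for the constant `1`.
-/
lemma ae_finite_arrival_le [IsProbabilityMeasure μ] (h : IsMarkedArrival P μ E' ξ) (L : ℝ) :
    ∀ᵐ ω ∂P, {k | arrival E' k ω ≤ L}.Finite := by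
  have h1 := h.tsum_lintegral_point L (f := fun _ => 1) measurable_const
  have hm : ∀ k, Measurable fun ω => if arrival E' k ω ≤ L then (1 : ℝ≥0∞) else 0 := fun k =>
    Measurable.ite (measurableSet_le (h.measurable_arrival k) measurable_const)
      measurable_const measurable_const
  rw [← lintegral_tsum fun k => (hm k).aemeasurable] at h1
  have h2 : ∫⁻ ω, ∑' k, (if arrival E' k ω ≤ L then (1 : ℝ≥0∞) else 0) ∂P ≠ ∞ := by
    rw [h1]; simp [lintegral_const, Measure.prod_apply]
  filter_upwards [ae_lt_top (Measurable.tsum hm) h2] with ω hω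
  have := ENNReal.finite_const_le_of_tsum_ne_top hω.ne one_ne_zero
  refine this.subset fun k hk => ?_
  simp only [mem_ofPred_eq] at hk ⊢
  simp [hk]

/-- The expectations telescope. An increment inserts the factor `g - 1` at the next point, which
vanishes beyond `L`, so `integral_markProd_mul` evaluates it. Summing over `k` turns the powers into
an exponential, which absorbs `exp(-s)` as the primitive of `-1`; the integrand is then the
derivative of `exp(∫ (G - 1))`. -/
theorem tendsto_integral_markProd [IsProbabilityMeasure μ] (h : IsMarkedArrival P μ E' ξ)
    {g : ℝ → 𝓧 → ℂ} (hg : Measurable (Function.uncurry g)) (hb : ∀ s x, ‖g s x‖ ≤ 1) {L : ℝ}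
    (hL0 : 0 ≤ L) (hL : ∀ s x, L < s → g s x = 1) :
    Tendsto (fun K => ∫ ω, markProd E' ξ g K ω ∂P) atTop
      (𝓝 (Complex.exp (∫ s in Ioc 0 L, (∫ x, g s x ∂μ) - 1))) := by
  have := h.indep.isProbabilityMeasure
  set G : ℝ → ℂ := fun r => ∫ x, g r x ∂μ with hG
  have hGm : Measurable G := hg.stronglyMeasurable.integral_prod_right.measurable
  have hGb : ∀ r, ‖G r‖ ≤ 1 := fun r => by
    simpa using norm_integral_le_of_norm_le_const (μ := μ) (f := g r)
      (ae_of_all _ fun y => hb _ _)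
  have hgi : ∀ s, Integrable (g s) μ := fun s =>
    Integrable.of_bound (hg.comp measurable_prodMk_left).aestronglyMeasurable 1
      (ae_of_all _ (hb s))
  have hmi : ∀ k, Integrable (markProd E' ξ g k) P := fun k =>
    Integrable.of_bound (h.measurable_markProd hg k).aestronglyMeasurable 1
      (ae_of_all _ (norm_markProd_le hb k))
  have hΦc : Continuous fun s => ∫ r in 0..s, G r := continuous_primitive_of_norm_le hGm hGb
  have hG1b : ∀ s, ‖G s - 1‖ ≤ 2 := fun s => (norm_sub_le _ _).trans (by
    have := hGb s
    simp only [norm_one]; linarith)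
  have hG1m : Measurable fun s => G s - 1 := hGm.sub_const 1
  set a : ℕ → ℝ → ℂ := fun k s => (Real.exp (-s) * (G s - 1)) *
    ((∫ r in 0..s, G r) ^ k / k.factorial) with ha
  have hstep : ∀ k, ∫ ω, markProd E' ξ g (k + 1) ω ∂P - ∫ ω, markProd E' ξ g k ω ∂P =
      ∫ s in Ioc 0 L, a k s := by
    intro k
    have h1 := h.integral_markProd_mul hg hb (L := L) k (φ := fun s x => g s x - 1) (C := 2)
      (hg.sub_const 1) (fun s x => (norm_sub_le _ _).trans (by
        have := hb s x
        simp only [norm_one]; linarith)) (fun s x hs => by simp [hL s x hs])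
    rw [← integral_sub (hmi _) (hmi _)]
    convert h1 using 1
    · refine integral_congr_ae (ae_of_all _ fun ω => ?_)
      simp only [markProd, Finset.prod_range_succ]; ring
    · refine setIntegral_congr_fun measurableSet_Ioc fun s _ => ?_
      simp only [ha, hG]
      rw [integral_sub (hgi s) (integrable_const _)]
      simp
  have hsum : HasSum (fun k => ∫ s in Ioc 0 L, a k s)
      (∫ s in Ioc 0 L, Real.exp (-s) * (G s - 1) * Complex.exp (∫ r in 0..s, G r)) := by
    refine hasSum_integral_of_dominated_convergence (fun k _ => 2 * (L ^ k / k.factorial))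
      (fun k => ?_) (fun k => ?_) (ae_of_all _ fun s => ?_) ?_ (ae_of_all _ fun s => ?_)
    · refine Measurable.aestronglyMeasurable ?_
      have := hΦc.measurable
      fun_prop
    · filter_upwards [ae_restrict_mem measurableSet_Ioc] with s hs
      simp only [ha, norm_mul, norm_div, norm_pow]
      have h1 : ‖∫ r in 0..s, G r‖ ≤ L := by
        refine (intervalIntegral.norm_integral_le_of_norm_le_const (C := 1)
          fun r _ => hGb r).trans ?_
        rw [sub_zero, one_mul, abs_of_pos hs.1]; exact hs.2
      have h2 : ‖(Real.exp (-s) : ℂ)‖ ≤ 1 := by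
        rw [Complex.norm_real, Real.norm_of_nonneg (Real.exp_pos _).le]
        exact Real.exp_le_one_iff.2 (by linarith [hs.1])
      have h3 : ‖(k.factorial : ℂ)‖ = k.factorial := by simp
      rw [h3]
      have := hG1b s
      gcongr
      calc _ ≤ 1 * 2 := mul_le_mul h2 (hG1b s) (norm_nonneg _) zero_le_one
        _ = 2 := by norm_num
    · exact (NormedSpace.expSeries_div_hasSum_exp L).summable.mul_left 2
    · exact integrable_const _
    · have := (NormedSpace.expSeries_div_hasSum_exp (∫ r in 0..s, G r)).mul_left
        (Real.exp (-s) * (G s - 1))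
      rw [← Complex.exp_eq_exp_ℂ] at this
      exact this
  have hval : ∫ s in Ioc 0 L, Real.exp (-s) * (G s - 1) * Complex.exp (∫ r in 0..s, G r) =
      Complex.exp (∫ s in Ioc 0 L, (G s - 1)) - 1 := by
    have h1 := integral_mul_comp_primitive hG1m hG1b (fun z => Complex.hasDerivAt_exp z)
      Complex.continuous_exp L
    rw [Complex.exp_zero, intervalIntegral.integral_of_le hL0,
      intervalIntegral.integral_of_le hL0] at h1
    rw [← h1]
    refine setIntegral_congr_fun measurableSet_Ioc fun s _ => ?_
    rw [intervalIntegral.integral_sub (intervalIntegrable_of_norm_le hGm hGb _ _)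
      intervalIntegrable_const, intervalIntegral.integral_const, sub_eq_add_neg (∫ r in 0..s, G r),
      Complex.exp_add, Complex.ofReal_exp]
    simp; ring
  rw [hval] at hsum
  have h2 := (hsum.tendsto_sum_nat.add_const 1)
  have h0 : ∫ ω, markProd E' ξ g 0 ω ∂P = 1 := by simp [markProd]
  have htel : ∀ K, ∑ k ∈ Finset.range K, ∫ s in Ioc 0 L, a k s =
      ∫ ω, markProd E' ξ g K ω ∂P - 1 := by
    intro K
    rw [← h0, ← Finset.sum_range_sub (fun k => ∫ ω, markProd E' ξ g k ω ∂P)]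
    exact Finset.sum_congr rfl fun k _ => (hstep k).symm
  simpa only [htel, sub_add_cancel] using h2

/-- The characteristic functional of the marked points up to time `L`. -/
theorem integral_exp_tsum_point [IsProbabilityMeasure μ] (h : IsMarkedArrival P μ E' ξ)
    {f : ℝ → 𝓧 → ℝ} (hf : Measurable (Function.uncurry f)) {L : ℝ} (hL : 0 ≤ L) :
    ∫ ω, Complex.exp (Complex.I * ((∑' j, if arrival E' j ω ≤ L then
        f (arrival E' j ω) (ξ j ω) else 0 : ℝ) : ℂ)) ∂P =
      Complex.exp (∫ y, (Complex.exp (Complex.I * f y.1 y.2) - 1)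
        ∂((volume.restrict (Ioc 0 L)).prod μ)) := by
  have := h.indep.isProbabilityMeasure
  -- Cutting the exponent off at `L` makes the factors of all later points equal to `1`, as
  -- `tendsto_integral_markProd` requires.
  set g : ℝ → 𝓧 → ℂ := fun s x => Complex.exp (Complex.I * (if s ≤ L then f s x else 0 : ℝ))
    with hg
  have hgm : Measurable (Function.uncurry g) := by
    have : Measurable fun y : ℝ × 𝓧 => (if y.1 ≤ L then f y.1 y.2 else 0 : ℝ) :=
      Measurable.ite (measurableSet_le measurable_fst measurable_const) hf measurable_const
    exact Complex.measurable_exp.comp ((Complex.measurable_ofReal.comp this).const_mul _)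
  have hgb : ∀ s x, ‖g s x‖ ≤ 1 := fun s x => by
    simp only [hg]; rw [mul_comm, Complex.norm_exp_ofReal_mul_I]
  have h1 := h.tendsto_integral_markProd hgm hgb hL
    (fun s x hs => by simp only [hg, if_neg (not_le.2 hs)]; simp)
  have hmk : ∀ K ω, markProd E' ξ g K ω = Complex.exp (Complex.I *
      ((∑ j ∈ Finset.range K, if arrival E' j ω ≤ L then
        f (arrival E' j ω) (ξ j ω) else 0 : ℝ) : ℂ)) := by
    intro K ω
    rw [markProd, Complex.ofReal_sum, Finset.mul_sum, Complex.exp_sum]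
  have h2 : Tendsto (fun K => ∫ ω, markProd E' ξ g K ω ∂P) atTop
      (𝓝 (∫ ω, Complex.exp (Complex.I * ((∑' j, if arrival E' j ω ≤ L then
        f (arrival E' j ω) (ξ j ω) else 0 : ℝ) : ℂ)) ∂P)) := by
    refine tendsto_integral_of_dominated_convergence (fun _ => 1)
      (fun K => (h.measurable_markProd hgm K).aestronglyMeasurable) (integrable_const _)
      (fun K => ae_of_all _ (norm_markProd_le hgb K)) ?_
    filter_upwards [h.ae_finite_arrival_le L] with ω hω
    have hs : Summable fun j => if arrival E' j ω ≤ L then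
        f (arrival E' j ω) (ξ j ω) else 0 :=
      summable_of_hasFiniteSupport (hω.subset fun j hj => by
        by_contra hc
        exact hj (if_neg hc))
    simp only [hmk]
    have h3 := hs.hasSum.tendsto_sum_nat
    have h4 : Continuous fun x : ℝ => Complex.exp (Complex.I * x) := by fun_prop
    exact (h4.tendsto _).comp h3
  rw [tendsto_nhds_unique h2 h1]
  congr 1
  have hgi : Integrable (fun y : ℝ × 𝓧 => Complex.exp (Complex.I * f y.1 y.2) - 1)
      ((volume.restrict (Ioc 0 L)).prod μ) := by
    have hm : Measurable fun y : ℝ × 𝓧 => Complex.exp (Complex.I * f y.1 y.2) - 1 :=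
      (Complex.measurable_exp.comp ((Complex.measurable_ofReal.comp hf).const_mul _)).sub_const 1
    refine Integrable.of_bound hm.aestronglyMeasurable 2 (ae_of_all _ fun y => ?_)
    refine (norm_sub_le _ _).trans ?_
    rw [mul_comm, Complex.norm_exp_ofReal_mul_I, norm_one]; norm_num
  rw [integral_prod _ hgi]
  refine setIntegral_congr_fun measurableSet_Ioc fun s hs => ?_
  have h5 : Integrable (g s) μ :=
    Integrable.of_bound (hgm.comp measurable_prodMk_left).aestronglyMeasurable 1
      (ae_of_all _ (hgb s))
  have h6 : ∀ x, g s x = Complex.exp (Complex.I * f s x) := fun x => by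
    simp only [hg, if_pos hs.2]
  simp only [← h6]
  rw [integral_sub h5 (integrable_const _)]
  simp

end IsMarkedArrival

/-! ### Sums over the points up to time `L` -/

open Classical in
/-- The sum `∑_{Γ_j ≤ L} f(Γ_j, ξ_j)` over the marked points up to time `L`. -/
def pointSum {Ω 𝓧 F : Type*} [AddCommMonoid F] [TopologicalSpace F] (E' : ℕ → Ω → ℝ)
    (ξ : ℕ → Ω → 𝓧) (L : ℝ) (f : ℝ → 𝓧 → F) (ω : Ω) : F :=
  ∑' j, if arrival E' j ω ≤ L then f (arrival E' j ω) (ξ j ω) else 0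

lemma pointSum_eq_sum {Ω 𝓧 F : Type*} [AddCommMonoid F] [TopologicalSpace F]
    {E' : ℕ → Ω → ℝ} {ξ : ℕ → Ω → 𝓧} {L : ℝ} {ω : Ω} (hω : {k | arrival E' k ω ≤ L}.Finite)
    (f : ℝ → 𝓧 → F) :
    pointSum E' ξ L f ω = ∑ j ∈ hω.toFinset, f (arrival E' j ω) (ξ j ω) := by
  classical
  rw [pointSum, tsum_eq_sum (s := hω.toFinset)]
  · refine Finset.sum_congr rfl fun j hj => if_pos ?_
    simpa using hj
  · intro j hj
    exact if_neg (by simpa using hj)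

namespace IsMarkedArrival

variable {Ω 𝓧 F : Type*} [MeasurableSpace Ω] [MeasurableSpace 𝓧] {P : Measure Ω}
  {μ : Measure 𝓧} {E' : ℕ → Ω → ℝ} {ξ : ℕ → Ω → 𝓧}

section Normed

variable [NormedAddCommGroup F] [MeasurableSpace F]

lemma measurable_pointSum_term (h : IsMarkedArrival P μ E' ξ) {f : ℝ → 𝓧 → F}
    (hf : Measurable (Function.uncurry f)) (L : ℝ) (j : ℕ) :
    Measurable fun ω => if arrival E' j ω ≤ L then f (arrival E' j ω) (ξ j ω) else 0 :=
  Measurable.ite (measurableSet_le (h.measurable_arrival j) measurable_const)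
    (hf.comp (h.measurable_point j)) measurable_const

variable [BorelSpace F] [SecondCountableTopology F]

lemma aemeasurable_pointSum [IsProbabilityMeasure μ] (h : IsMarkedArrival P μ E' ξ)
    {f : ℝ → 𝓧 → F} (hf : Measurable (Function.uncurry f)) (L : ℝ) :
    AEMeasurable (pointSum E' ξ L f) P := by
  refine aemeasurable_of_tendsto_metrizable_ae atTop
    (f := fun K ω => ∑ j ∈ Finset.range K, if arrival E' j ω ≤ L then
      f (arrival E' j ω) (ξ j ω) else 0)
    (fun K => (Finset.measurable_sum _ fun j _ =>
      h.measurable_pointSum_term hf L j).aemeasurable) ?_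
  filter_upwards [h.ae_finite_arrival_le L] with ω hω
  have hs : Summable fun j => if arrival E' j ω ≤ L then f (arrival E' j ω) (ξ j ω) else 0 :=
    summable_of_hasFiniteSupport (hω.subset fun j hj => by
      by_contra hc
      exact hj (if_neg hc))
  have := hs.hasSum.tendsto_sum_nat
  convert this using 2
  rw [pointSum]

variable [NormedSpace ℝ F]

/-- Campbell's formula for vector-valued integrands. -/
theorem integrable_pointSum [IsProbabilityMeasure μ] (h : IsMarkedArrival P μ E' ξ) {L : ℝ}
    {f : ℝ → 𝓧 → F} (hf : Measurable (Function.uncurry f))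
    (hfi : Integrable (Function.uncurry f) ((volume.restrict (Ioc 0 L)).prod μ)) :
    Integrable (pointSum E' ξ L f) P ∧
      ∫ ω, pointSum E' ξ L f ω ∂P =
        ∫ y, f y.1 y.2 ∂((volume.restrict (Ioc 0 L)).prod μ) := by
  have hS : MeasurableSet (Iic L ×ˢ (univ : Set 𝓧)) := measurableSet_Iic.prod MeasurableSet.univ
  -- Superposing the laws of the points before `L` gives the intensity, so the vector-valued formula
  -- is integration against a sum of measures.
  have hsum : Measure.sum (fun k => (P.map fun ω => (arrival E' k ω, ξ k ω)).restrict
      (Iic L ×ˢ univ)) = (volume.restrict (Ioc 0 L)).prod μ := by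
    ext A hA
    have h1 := h.tsum_lintegral_point L (f := A.indicator 1) (measurable_one.indicator hA)
    rw [lintegral_indicator_one hA] at h1
    rw [Measure.sum_apply _ hA, ← h1]
    refine tsum_congr fun k => ?_
    rw [Measure.restrict_apply hA, Measure.map_apply (h.measurable_point k) (hA.inter hS),
      ← lintegral_indicator_one (h.measurable_point k (hA.inter hS))]
    refine lintegral_congr fun ω => ?_
    by_cases h2 : arrival E' k ω ≤ L <;> by_cases h3 : (arrival E' k ω, ξ k ω) ∈ A <;>
      simp [indicator, mem_preimage, h2, h3]
  have hb : ∫⁻ ω, ∑' j, ‖if arrival E' j ω ≤ L then f (arrival E' j ω) (ξ j ω) else 0‖ₑ ∂P < ∞ := by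
    rw [lintegral_tsum fun j => (h.measurable_pointSum_term hf L j).enorm.aemeasurable]
    have h1 := h.tsum_lintegral_point L (f := fun y => ‖f y.1 y.2‖ₑ) hf.enorm
    have h2 : ∀ j ω, ‖if arrival E' j ω ≤ L then f (arrival E' j ω) (ξ j ω) else 0‖ₑ =
        if arrival E' j ω ≤ L then ‖f (arrival E' j ω) (ξ j ω)‖ₑ else 0 := by
      intro j ω; split_ifs <;> simp
    simp only [h2, h1]
    exact hfi.2
  have hint : Integrable (pointSum E' ξ L f) P := by
    refine ⟨(h.aemeasurable_pointSum hf L).aestronglyMeasurable, ?_⟩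
    refine (lintegral_mono_ae ?_).trans_lt hb
    filter_upwards [h.ae_finite_arrival_le L] with ω hω
    rw [pointSum_eq_sum hω]
    refine (enorm_sum_le _ _).trans ((Finset.sum_le_sum fun j hj => ?_).trans
      (ENNReal.sum_le_tsum hω.toFinset))
    have : arrival E' j ω ≤ L := by simpa using hj
    rw [if_pos this]
  refine ⟨hint, ?_⟩
  rw [← hsum] at hfi ⊢
  have h3 := hasSum_integral_measure hfi
  have h4 : ∀ k, ∫ y, Function.uncurry f y ∂((P.map fun ω => (arrival E' k ω, ξ k ω)).restrict
      (Iic L ×ˢ univ)) =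
      ∫ ω, (if arrival E' k ω ≤ L then f (arrival E' k ω) (ξ k ω) else 0) ∂P := by
    intro k
    rw [← integral_indicator hS, integral_map (h.measurable_point k).aemeasurable
      (hf.indicator hS).aestronglyMeasurable]
    refine integral_congr_ae (ae_of_all _ fun ω => ?_)
    by_cases h2 : arrival E' k ω ≤ L <;> simp [indicator, h2]
  simp only [h4] at h3
  have h5 : ∫ ω, pointSum E' ξ L f ω ∂P =
      ∑' k, ∫ ω, (if arrival E' k ω ≤ L then f (arrival E' k ω) (ξ k ω) else 0) ∂P := by
    rw [← integral_tsum (fun j => (h.measurable_pointSum_term hf L j).aestronglyMeasurable)]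
    · refine integral_congr_ae (ae_of_all _ fun ω => ?_)
      simp only [pointSum]
    · rw [← lintegral_tsum fun j => (h.measurable_pointSum_term hf L j).enorm.aemeasurable]
      exact hb.ne
  rw [h5, h3.tsum_eq]
  rfl

end Normed

lemma integral_exp_pointSum [IsProbabilityMeasure μ] (h : IsMarkedArrival P μ E' ξ)
    {f : ℝ → 𝓧 → ℝ} (hf : Measurable (Function.uncurry f)) {L : ℝ} (hL : 0 ≤ L) :
    ∫ ω, Complex.exp (Complex.I * (pointSum E' ξ L f ω : ℝ)) ∂P =
      Complex.exp (∫ y, (Complex.exp (Complex.I * f y.1 y.2) - 1)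
        ∂((volume.restrict (Ioc 0 L)).prod μ)) := by
  rw [← h.integral_exp_tsum_point hf hL]
  refine integral_congr_ae (ae_of_all _ fun ω => ?_)
  simp only [pointSum]

end IsMarkedArrival

/-! ### Marked points with a uniform time mark -/

/-- The jump function `H` applied to the points whose time mark is in `A`. -/
def timeCut {𝓨 F : Type*} [Zero F] (H : ℝ → 𝓨 → F) (A : Set ℝ) (s : ℝ) (x : ℝ × 𝓨) : F :=
  A.indicator (fun _ => H s x.2) x.1

/-- The intensity measure per unit of time of the jumps `H(Γ_j, y_j)`, `Γ_j ∈ I`. -/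
def jumpMeasure {𝓨 F : Type*} [MeasurableSpace 𝓨] [MeasurableSpace F] (T : ℝ) (I : Set ℝ)
    (ν : Measure 𝓨) (H : ℝ → 𝓨 → F) : Measure F :=
  ENNReal.ofReal T⁻¹ • ((volume.restrict I).prod ν).map (Function.uncurry H)

/-- The uniform law on `(0, T)`. -/
abbrev uniformTime (T : ℝ) : Measure ℝ := ProbabilityTheory.cond volume (Ioo 0 T)

lemma isProbabilityMeasure_uniformTime {T : ℝ} (hT : 0 < T) :
    IsProbabilityMeasure (uniformTime T) :=
  cond_isProbabilityMeasure_of_finite (by simp [hT]) (by simp)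

lemma uniformTime_real_Ioc {T s t : ℝ} (hT : 0 < T) (hs : 0 ≤ s) (hst : s ≤ t) (ht : t ≤ T) :
    (uniformTime T).real (Ioc s t) = (t - s) / T := by
  -- The endpoint `t = T` is allowed although `T` is outside `Ioo 0 T`; hence two inclusions instead
  -- of an equality of sets.
  have h : volume (Ioo 0 T ∩ Ioc s t) = ENNReal.ofReal (t - s) := by
    refine le_antisymm ((measure_mono inter_subset_right).trans_eq Real.volume_Ioc) ?_
    rw [← Real.volume_Ioo]
    exact measure_mono fun x hx => ⟨⟨hs.trans_lt hx.1, hx.2.trans_le ht⟩, hx.1, hx.2.le⟩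
  rw [measureReal_def, cond_apply measurableSet_Ioo, h, Real.volume_Ioo, ENNReal.toReal_mul,
    ENNReal.toReal_inv, ENNReal.toReal_ofReal (by linarith), ENNReal.toReal_ofReal (by linarith)]
  rw [sub_zero, div_eq_inv_mul]

section TimeCut

variable {𝓨 F : Type*} [MeasurableSpace 𝓨] {ν : Measure 𝓨} {T : ℝ} {A : Set ℝ}

lemma measurable_timeCut [MeasurableSpace F] [Zero F] {H : ℝ → 𝓨 → F}
    (hH : Measurable (Function.uncurry H)) (hA : MeasurableSet A) :
    Measurable (Function.uncurry (timeCut H A)) := by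
  have h1 : Measurable fun x : ℝ × (ℝ × 𝓨) => H x.1 x.2.2 :=
    hH.comp (measurable_fst.prodMk measurable_snd.snd)
  exact h1.indicator (measurable_snd.fst hA)

/-- The time mark is independent of the rest of the mark, so the window only contributes its
probability as a factor. -/
lemma integral_timeCut [NormedAddCommGroup F] [NormedSpace ℝ F] [IsProbabilityMeasure ν]
    (hT : 0 < T) (hA : MeasurableSet A) {I : Set ℝ} {K : ℝ → 𝓨 → F}
    (hK : Integrable (Function.uncurry K) ((volume.restrict I).prod ν)) :
    Integrable (Function.uncurry (timeCut K A))
        ((volume.restrict I).prod ((uniformTime T).prod ν)) ∧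
      ∫ x, timeCut K A x.1 x.2 ∂((volume.restrict I).prod ((uniformTime T).prod ν)) =
        (uniformTime T).real A • ∫ x, K x.1 x.2 ∂((volume.restrict I).prod ν) := by
  have := isProbabilityMeasure_uniformTime hT
  have hmp : MeasurePreserving (Prod.map id Prod.snd : ℝ × (ℝ × 𝓨) → ℝ × 𝓨)
      ((volume.restrict I).prod ((uniformTime T).prod ν)) ((volume.restrict I).prod ν) :=
    (MeasurePreserving.id _).prod measurePreserving_snd
  have h1 : Integrable (Function.uncurry (timeCut K A))
        ((volume.restrict I).prod ((uniformTime T).prod ν)) :=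
    ((hmp.integrable_comp hK.aestronglyMeasurable).2 hK).indicator
      (s := (fun x : ℝ × (ℝ × 𝓨) => x.2.1) ⁻¹' A) (measurable_snd.fst hA)
  refine ⟨h1, ?_⟩
  have e1 := integral_prod _ h1
  have e2 := integral_prod _ hK
  simp only [Function.uncurry] at e1 e2
  rw [e1, e2, ← integral_smul]
  refine integral_congr_ae (ae_of_all _ fun s => ?_)
  simp only
  have e3 := integral_prod_smul (μ := uniformTime T) (ν := ν) (A.indicator (fun _ => (1 : ℝ))) (K s)
  rw [integral_indicator_const _ hA, smul_eq_mul, mul_one] at e3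
  rw [← e3]
  refine integral_congr_ae (ae_of_all _ fun x => ?_)
  by_cases hx : x.1 ∈ A <;> simp [timeCut, hx]

lemma integral_jumpMeasure [NormedAddCommGroup F] [NormedSpace ℝ F] {X : Type*}
    [MeasurableSpace X] (hT : 0 < T) {I : Set ℝ} {H : ℝ → 𝓨 → X}
    (hH : Measurable (Function.uncurry H)) {φ : X → F} (hφ : StronglyMeasurable φ) :
    ∫ x, φ x ∂(jumpMeasure T I ν H) =
      T⁻¹ • ∫ x, φ (H x.1 x.2) ∂((volume.restrict I).prod ν) := by
  rw [jumpMeasure, integral_smul_measure, integral_map hH.aemeasurable hφ.aestronglyMeasurable,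
    ENNReal.toReal_ofReal (inv_pos.2 hT).le]
  rfl

lemma isFiniteMeasure_jumpMeasure [IsFiniteMeasure ν] {X : Type*} [MeasurableSpace X] (L : ℝ)
    (H : ℝ → 𝓨 → X) : IsFiniteMeasure (jumpMeasure T (Ioc 0 L) ν H) := by
  unfold jumpMeasure
  exact Measure.smul_finite _ ENNReal.ofReal_ne_top

end TimeCut

lemma norm_cexp_I_mul_sub_one_le (x : ℝ) : ‖Complex.exp (Complex.I * x) - 1‖ ≤ 2 := by
  refine (norm_sub_le _ _).trans ?_
  rw [mul_comm, Complex.norm_exp_ofReal_mul_I, norm_one]; norm_num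

namespace IsMarkedArrival

variable {Ω 𝓨 : Type*} [MeasurableSpace Ω] [MeasurableSpace 𝓨] {P : Measure Ω} {d : ℕ}
  {ν : Measure 𝓨} [IsProbabilityMeasure ν] {T L : ℝ} {E' τ : ℕ → Ω → ℝ} {y : ℕ → Ω → 𝓨}
  {H : ℝ → 𝓨 → Space d}

/-- A time mark lies in at most one of the disjoint windows, so `exp(i f) - 1` is the sum of the
contributions of the single windows. The additive exponent yields at once the law of each windowed
sum and their joint independence. The factor `T` offsets the `T⁻¹` in `jumpMeasure`. -/
theorem integral_exp_sum_inner_cut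
    (h : IsMarkedArrival P ((uniformTime T).prod ν) E' (fun j ω => (τ j ω, y j ω))) (hT : 0 < T)
    (hL : 0 ≤ L) (hH : Measurable (Function.uncurry H)) {ι : Type*} [Fintype ι] {A : ι → Set ℝ}
    (hA : ∀ i, MeasurableSet (A i)) (hd : Pairwise fun i j => Disjoint (A i) (A j))
    (z : ι → Space d) :
    ∫ ω, Complex.exp (Complex.I * (∑ i, inner ℝ
        (pointSum E' (fun j ω => (τ j ω, y j ω)) L (timeCut H (A i)) ω) (z i) : ℝ)) ∂P =
      Complex.exp (∑ i, (T * (uniformTime T).real (A i) : ℝ) *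
        ∫ x, (Complex.exp (Complex.I * (inner ℝ x (z i) : ℝ)) - 1)
          ∂(jumpMeasure T (Ioc 0 L) ν H)) := by
  have := isProbabilityMeasure_uniformTime hT
  set f : ℝ → ℝ × 𝓨 → ℝ := fun s x => ∑ i, inner ℝ (timeCut H (A i) s x) (z i) with hf
  have hfm : Measurable (Function.uncurry f) :=
    Finset.measurable_sum _ fun i _ => (measurable_timeCut hH (hA i)).inner_const
  have e1 : ∫ ω, Complex.exp (Complex.I * (∑ i, inner ℝ
        (pointSum E' (fun j ω => (τ j ω, y j ω)) L (timeCut H (A i)) ω) (z i) : ℝ)) ∂P =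
      ∫ ω, Complex.exp (Complex.I * (pointSum E' (fun j ω => (τ j ω, y j ω)) L f ω : ℝ)) ∂P := by
    refine integral_congr_ae ?_
    filter_upwards [h.ae_finite_arrival_le L] with ω hω
    simp only [pointSum_eq_sum hω, hf]
    rw [Finset.sum_comm]
    simp only [sum_inner]
  rw [e1, h.integral_exp_pointSum hfm hL]
  congr 1
  set K : ι → ℝ → 𝓨 → ℂ := fun i s v => Complex.exp (Complex.I * (inner ℝ (H s v) (z i) : ℝ)) - 1
    with hK
  have hKi : ∀ i, Integrable (Function.uncurry (K i)) ((volume.restrict (Ioc 0 L)).prod ν) := by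
    intro i
    have hm : Measurable (Function.uncurry (K i)) :=
      (Complex.measurable_exp.comp ((Complex.measurable_ofReal.comp
        (hH.inner_const (c := z i))).const_mul _)).sub_const 1
    exact Integrable.of_bound hm.aestronglyMeasurable 2
      (ae_of_all _ fun x => norm_cexp_I_mul_sub_one_le _)
  have e2 : ∀ x : ℝ × (ℝ × 𝓨), Complex.exp (Complex.I * (f x.1 x.2 : ℝ)) - 1 =
      ∑ i, timeCut (K i) (A i) x.1 x.2 := by
    intro x
    by_cases hx : ∃ i, x.2.1 ∈ A i
    · obtain ⟨i, hi⟩ := hx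
      have hne : ∀ j, j ≠ i → x.2.1 ∉ A j := fun j hj hc => (hd hj).le_bot ⟨hc, hi⟩
      rw [Finset.sum_eq_single i (fun j _ hj => by simp [timeCut, hne j hj]) (by simp)]
      simp only [hf]
      rw [Finset.sum_eq_single i (fun j _ hj => by simp [timeCut, hne j hj]) (by simp)]
      simp [timeCut, hi, hK]
    · push Not at hx
      simp [hf, timeCut, hx]
  simp only [e2]
  rw [integral_finsetSum _ fun i _ => by exact (integral_timeCut hT (hA i) (hKi i)).1]
  refine Finset.sum_congr rfl fun i _ => ?_
  rw [(integral_timeCut hT (hA i) (hKi i)).2, integral_jumpMeasure hT hH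
    (φ := fun x => Complex.exp (Complex.I * (inner ℝ x (z i) : ℝ)) - 1)]
  · simp only [hK, Complex.real_smul]
    push_cast
    have : (T : ℂ) ≠ 0 := by exact_mod_cast hT.ne'
    field_simp
  · exact Continuous.stronglyMeasurable (by fun_prop)

variable (h : IsMarkedArrival P ((uniformTime T).prod ν) E' (fun j ω => (τ j ω, y j ω)))
include h

lemma aemeasurable_cut (hT : 0 < T) (hH : Measurable (Function.uncurry H)) {A : Set ℝ}
    (hA : MeasurableSet A) :
    AEMeasurable (pointSum E' (fun j ω => (τ j ω, y j ω)) L (timeCut H A)) P := by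
  have := isProbabilityMeasure_uniformTime hT
  exact h.aemeasurable_pointSum (measurable_timeCut hH hA) L

lemma charFun_cut (hT : 0 < T) (hL : 0 ≤ L) (hH : Measurable (Function.uncurry H)) {A : Set ℝ}
    (hA : MeasurableSet A) (z : Space d) :
    charFun (P.map (pointSum E' (fun j ω => (τ j ω, y j ω)) L (timeCut H A))) z =
      Complex.exp ((T * (uniformTime T).real A : ℝ) *
        ∫ x, (Complex.exp (Complex.I * (inner ℝ x z : ℝ)) - 1)
          ∂(jumpMeasure T (Ioc 0 L) ν H)) := by
  have h1 := h.integral_exp_sum_inner_cut hT hL hH (ι := Unit) (A := fun _ => A) (fun _ => hA)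
    (fun i j hij => (hij rfl).elim) (fun _ => z)
  simp only [Finset.univ_unique, Finset.sum_const, Finset.card_singleton, one_smul] at h1
  rw [← h1, charFun_apply, integral_map (h.aemeasurable_cut hT hH hA) (by fun_prop)]
  simp only [mul_comm Complex.I]

/-- The joint characteristic function is the exponential of a sum over windows, hence the product of
the marginal ones, which characterises independence. -/
lemma iIndepFun_cut [IsProbabilityMeasure P] (hT : 0 < T) (hL : 0 ≤ L)
    (hH : Measurable (Function.uncurry H)) {ι : Type*} [Fintype ι] {A : ι → Set ℝ}
    (hA : ∀ i, MeasurableSet (A i)) (hd : Pairwise fun i j => Disjoint (A i) (A j)) :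
    iIndepFun (fun i => pointSum E' (fun j ω => (τ j ω, y j ω)) L (timeCut H (A i))) P := by
  have hm := fun i => h.aemeasurable_cut (L := L) hT hH (hA i)
  rw [iIndepFun_iff_charFun_pi hm]
  intro z
  have h1 := h.integral_exp_sum_inner_cut hT hL hH hA hd z
  rw [charFun_apply, integral_map (by fun_prop) (by fun_prop)]
  simp only [h.charFun_cut hT hL hH (hA _)]
  rw [← Complex.exp_sum, ← h1]
  simp only [PiLp.inner_apply, mul_comm Complex.I]

/-- The two series may be subtracted term by term on the almost sure event that only finitely many
points arrive before `L`. -/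
lemma cut_Ioc_sub_ae (hT : 0 < T) {s t : ℝ} (hs : 0 ≤ s) (hst : s ≤ t) :
    (fun ω => pointSum E' (fun j ω => (τ j ω, y j ω)) L (timeCut H (Ioc 0 t)) ω -
      pointSum E' (fun j ω => (τ j ω, y j ω)) L (timeCut H (Ioc 0 s)) ω) =ᵐ[P]
      pointSum E' (fun j ω => (τ j ω, y j ω)) L (timeCut H (Ioc s t)) := by
  have := isProbabilityMeasure_uniformTime hT
  filter_upwards [h.ae_finite_arrival_le L] with ω hω
  simp only [pointSum_eq_sum hω, ← Finset.sum_sub_distrib]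
  refine Finset.sum_congr rfl fun j _ => ?_
  simp only [timeCut, indicator, mem_Ioc]
  by_cases h1 : 0 < τ j ω
  · by_cases h2 : τ j ω ≤ s
    · simp [h1, h2, h2.trans hst, not_lt.2 h2]
    · by_cases h3 : τ j ω ≤ t <;> simp [h1, h2, h3, not_le.1 h2]
  · have h4 : ¬ s < τ j ω := fun hc => h1 (hs.trans_lt hc)
    simp [h1, h4]

lemma ae_time_ne (hT : 0 < T) (t : ℝ) : ∀ᵐ ω ∂P, ∀ j, τ j ω ≠ t := by
  have := isProbabilityMeasure_uniformTime hT
  refine ae_all_iff.2 fun j => ?_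
  have h1 := h.law j
  have h2 : P.map (fun ω => τ j ω) = uniformTime T := by
    have h3 := congrArg Measure.snd h1
    rw [Measure.snd_prod, Measure.snd_map_prodMk (h.meas_E' j)] at h3
    have h4 := congrArg Measure.fst h3
    rw [Measure.fst_prod, Measure.fst_map_prodMk (h.meas_mark j).snd] at h4
    exact h4
  have h5 : ∀ᵐ x ∂(uniformTime T), x ≠ t :=
    (cond_absolutelyContinuous (μ := volume) (s := Ioo 0 T)).ae_le
      (compl_mem_ae_iff.2 (measure_singleton t))
  rw [← h2] at h5
  exact ae_of_ae_map (h.meas_mark j).fst.aemeasurable h5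

/-- Almost surely a path is a finite sum of steps in `t`, hence càdlàg, and no time mark equals a
given `t`, hence stochastic continuity. Increments are sums over the windows `(s, t]`, independent
by `iIndepFun_cut` and with law depending only on `t - s` by `charFun_cut`. -/
theorem isLevyProcessOn_cut [IsProbabilityMeasure P] (hT : 0 < T) (hL : 0 ≤ L)
    (hH : Measurable (Function.uncurry H)) :
    IsLevyProcessOn P T
      (fun t => pointSum E' (fun j ω => (τ j ω, y j ω)) L (timeCut H (Ioc 0 t))) where
  aemeasurable t _ := h.aemeasurable_cut hT hH measurableSet_Ioc
  zero := by
    refine ae_of_all _ fun ω => ?_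
    simp [pointSum, timeCut]
  indep := by
    intro n t ht
    have hd : Pairwise fun i j : Fin n => Disjoint
        (Ioc (t i.castSucc : ℝ) (t i.succ)) (Ioc (t j.castSucc : ℝ) (t j.succ)) := by
      have key : ∀ i j : Fin n, i < j → Disjoint
          (Ioc (t i.castSucc : ℝ) (t i.succ)) (Ioc (t j.castSucc : ℝ) (t j.succ)) := by
        intro i j hij
        rw [Set.disjoint_left]
        intro x hx hx'
        have h1 : t i.succ ≤ t j.castSucc := ht (Fin.succ_le_castSucc_iff.2 hij)
        have h2 : (t i.succ : ℝ) ≤ t j.castSucc := h1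
        exact absurd (hx.2.trans h2) (not_le.2 hx'.1)
      intro i j hij
      rcases lt_or_gt_of_ne hij with h1 | h1
      · exact key i j h1
      · exact (key j i h1).symm
    refine (h.iIndepFun_cut hT hL hH (fun i : Fin n => measurableSet_Ioc) hd).congr fun i => ?_
    exact (h.cut_Ioc_sub_ae hT (t i.castSucc).2.1 (ht (Fin.castSucc_le_succ i))).symm
  stationary s t hs hst ht := by
    have hm := fun a b : ℝ => h.aemeasurable_cut (L := L) (A := Ioc a b) hT hH measurableSet_Ioc
    refine IdentDistrib.trans
      ⟨(hm 0 t).sub (hm 0 s), hm s t, Measure.map_congr (h.cut_Ioc_sub_ae hT hs hst)⟩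
      ⟨hm s t, hm 0 (t - s), ?_⟩
    refine Measure.ext_of_charFun (funext fun z => ?_)
    rw [h.charFun_cut hT hL hH measurableSet_Ioc, h.charFun_cut hT hL hH measurableSet_Ioc,
      uniformTime_real_Ioc hT hs hst ht, uniformTime_real_Ioc hT le_rfl (by linarith)
      (by linarith), sub_zero]
  stochCont t ht := by
    have := isProbabilityMeasure_uniformTime hT
    intro ε hε
    refine tendsto_of_seq_tendsto fun u hu => ?_
    refine tendstoInMeasure_of_tendsto_ae
      (f := fun n => pointSum E' (fun j ω => (τ j ω, y j ω)) L (timeCut H (Ioc 0 (u n))))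
      (fun n => (h.aemeasurable_cut hT hH measurableSet_Ioc).aestronglyMeasurable) ?_ ε hε
    have hu' : Tendsto u atTop (𝓝 t) := hu.mono_right nhdsWithin_le_nhds
    filter_upwards [h.ae_finite_arrival_le L, h.ae_time_ne hT t] with ω hω hne
    simp only [pointSum_eq_sum hω]
    refine tendsto_finsetSum _ fun j _ => ?_
    refine tendsto_const_nhds.congr' ?_
    rcases lt_or_gt_of_ne (hne j) with h1 | h1
    · filter_upwards [hu'.eventually (lt_mem_nhds h1)] with n hn
      simp [timeCut, indicator, hn.le, h1.le]
    · filter_upwards [hu'.eventually (gt_mem_nhds h1)] with n hn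
      simp [timeCut, indicator, not_le.2 hn, not_le.2 h1]
  cadlag := by
    have := isProbabilityMeasure_uniformTime hT
    filter_upwards [h.ae_finite_arrival_le L] with ω hω
    simp only [pointSum_eq_sum hω]
    refine ⟨fun t _ => tendsto_finsetSum _ fun j _ => tendsto_const_nhds.congr' ?_, fun t _ =>
      ⟨∑ j ∈ hω.toFinset, timeCut H (Ioo 0 t) (arrival E' j ω) (τ j ω, y j ω),
        tendsto_finsetSum _ fun j _ => tendsto_const_nhds.congr' ?_⟩⟩
    · by_cases h1 : τ j ω ≤ t
      · filter_upwards [self_mem_nhdsWithin] with s hs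
        simp [timeCut, indicator, h1, h1.trans (mem_Ioi.1 hs).le]
      · filter_upwards [nhdsWithin_le_nhds (gt_mem_nhds (not_le.1 h1))] with s hs
        have hs : s < τ j ω := hs
        simp [timeCut, indicator, h1, not_le.2 hs]
    · by_cases h1 : τ j ω < t
      · filter_upwards [nhdsWithin_le_nhds (lt_mem_nhds h1)] with s hs
        have hs : τ j ω < s := hs
        simp [timeCut, indicator, h1, hs.le]
      · filter_upwards [self_mem_nhdsWithin] with s hs
        have hs : s < t := hs
        simp [timeCut, indicator, h1, not_le.2 (hs.trans_le (not_lt.1 h1))]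

theorem isCompoundPoissonOn_cut [IsProbabilityMeasure P] (hT : 0 < T) (hL : 0 ≤ L)
    (hH : Measurable (Function.uncurry H)) (h0 : jumpMeasure T (Ioc 0 L) ν H {0} = 0) :
    IsCompoundPoissonOn P T
      (fun t => pointSum E' (fun j ω => (τ j ω, y j ω)) L (timeCut H (Ioc 0 t)))
      (jumpMeasure T (Ioc 0 L) ν H) where
  levy := h.isLevyProcessOn_cut hT hL hH
  finite := isFiniteMeasure_jumpMeasure L H
  jumps_zero := h0
  charFun_eq t ht z := by
    rw [h.charFun_cut hT hL hH measurableSet_Ioc, uniformTime_real_Ioc hT le_rfl ht.1 ht.2,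
      sub_zero, mul_div_cancel₀ _ hT.ne']

end IsMarkedArrival

/-! ### Compensation by the mean -/

/-- Subtracting a deterministic linear drift to a Lévy process. -/
lemma IsLevyProcessOn.sub_drift {Ω : Type*} [MeasurableSpace Ω] {d : ℕ} {P : Measure Ω}
    [IsProbabilityMeasure P] {T : ℝ} {X : ℝ → Ω → Space d} (h : IsLevyProcessOn P T X)
    (b : Space d) : IsLevyProcessOn P T fun t ω => X t ω - t • b where
  aemeasurable t ht := (h.aemeasurable t ht).sub_const _
  zero := by filter_upwards [h.zero] with ω hω; simp [hω]
  indep := by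
    intro n t ht
    have h1 := (h.indep n t ht).comp
      (fun i x => x - ((t i.succ : ℝ) - t i.castSucc) • b) (fun i => measurable_id.sub_const _)
    convert! h1 using 2 with i
    funext ω
    simp only [Function.comp]
    module
  stationary s t hs hst ht := by
    have h1 := (h.stationary s t hs hst ht).comp
      (u := fun x => x - (t - s) • b) (measurable_id.sub_const _)
    convert! h1 using 1
    funext ω
    simp only [Function.comp]
    module
  stochCont t ht := by
    intro ε hε
    refine tendsto_of_seq_tendsto fun u hu => ?_
    have hu0 := hu
    rw [tendsto_nhdsWithin_iff] at hu
    have h1 : Tendsto (fun n => edist (u n • b) (t • b)) atTop (𝓝 0) := by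
      have : Tendsto (fun n => u n • b) atTop (𝓝 (t • b)) := hu.1.smul_const b
      exact tendsto_iff_edist_tendsto_0.1 this
    have hε2 : 0 < ε / 2 := ENNReal.half_pos hε.ne'
    have h2 := (h.stochCont t ht (ε / 2) hε2).comp hu0
    refine tendsto_of_tendsto_of_tendsto_of_le_of_le' tendsto_const_nhds h2
      (Eventually.of_forall fun _ => zero_le) ?_
    -- Once the drift has moved by less than `ε / 2`, a deviation of at least `ε` of the shifted
    -- process forces one of at least `ε / 2` of `X`.
    filter_upwards [h1.eventually (gt_mem_nhds hε2)] with n hn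
    refine measure_mono fun ω hω => ?_
    simp only [mem_ofPred_eq] at hω ⊢
    by_contra hc
    have h3 : edist (X (u n) ω - u n • b) (X t ω - t • b) ≤
        edist (X (u n) ω) (X t ω) + edist (u n • b) (t • b) := by
      rw [edist_eq_enorm_sub, edist_eq_enorm_sub, edist_eq_enorm_sub]
      refine le_trans (le_of_eq ?_) (enorm_sub_le)
      congr 1; abel
    have h4 := ENNReal.add_lt_add (not_le.1 hc) hn
    rw [ENNReal.add_halves] at h4
    exact absurd (hω.trans h3) (not_le.2 h4)
  cadlag := by
    filter_upwards [h.cadlag] with ω hω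
    have hc : ∀ t : ℝ, Tendsto (fun s : ℝ => s • b) (𝓝 t) (𝓝 (t • b)) := fun t =>
      tendsto_id.smul_const b
    refine ⟨fun t ht => (hω.1 t ht).sub ((hc t).mono_left nhdsWithin_le_nhds), fun t ht => ?_⟩
    obtain ⟨l, hl⟩ := hω.2 t ht
    exact ⟨l - t • b, hl.sub ((hc t).mono_left nhdsWithin_le_nhds)⟩

lemma integrable_cexp_inner_sub_one {d : ℕ} (M : Measure (Space d)) [IsFiniteMeasure M]
    (z : Space d) :
    Integrable (fun x : Space d => Complex.exp (Complex.I * (inner ℝ x z : ℝ)) - 1) M :=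
  Integrable.of_bound (by fun_prop) 2 (ae_of_all _ fun _ => norm_cexp_I_mul_sub_one_le _)

lemma exponent_pureJump {d : ℕ} (M : Measure (Space d)) (z : Space d) :
    (⟨0, 0, M⟩ : Triplet d).exponent z =
      ∫ x, (Complex.exp (Complex.I * (inner ℝ x z : ℝ)) - 1 -
        Complex.I * (inner ℝ x z : ℝ)) ∂M := by
  simp [Triplet.exponent]

lemma exponent_pureJump_eq_sub {d : ℕ} (M : Measure (Space d)) [IsFiniteMeasure M]
    (hM : Integrable (fun x => x) M) (z : Space d) :
    (⟨0, 0, M⟩ : Triplet d).exponent z =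
      (∫ x, (Complex.exp (Complex.I * (inner ℝ x z : ℝ)) - 1) ∂M) -
        Complex.I * (inner ℝ (∫ x, x ∂M) z : ℝ) := by
  have h1 : Integrable (fun x : Space d => (inner ℝ x z : ℝ)) M := hM.inner_const z
  have h2 : Integrable (fun x : Space d => Complex.I * ((inner ℝ x z : ℝ) : ℂ)) M :=
    h1.ofReal.const_mul _
  rw [exponent_pureJump, integral_sub (integrable_cexp_inner_sub_one M z) h2,
    integral_const_mul, integral_complex_ofReal]
  congr 4
  simp only [real_inner_comm z]
  exact integral_inner hM z

/-- Subtracting `t • b` multiplies the characteristic function by `exp(-i t ⟨b, z⟩)`; for `b` the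
mean of `M` this is exactly the compensating term of the exponent. -/
lemma IsCompoundPoissonOn.hasTripletOn_sub {Ω : Type*} [MeasurableSpace Ω] {d : ℕ}
    {P : Measure Ω} [IsProbabilityMeasure P] {T : ℝ} {X : ℝ → Ω → Space d}
    {M : Measure (Space d)} (h : IsCompoundPoissonOn P T X M) (hM : Integrable (fun x => x) M) :
    HasTripletOn P T (fun t ω => X t ω - t • ∫ x, x ∂M) ⟨0, 0, M⟩ where
  levy := h.levy.sub_drift _
  admissible :=
    { cov_pos := ContinuousLinearMap.isPositive_zero
      jumps_zero := h.jumps_zero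
      integrable := by
        refine (lintegral_mono fun x => ?_).trans_lt hM.2
        rw [← ofReal_norm]
        exact ENNReal.ofReal_le_ofReal (min_le_right _ _) }
  charFun_eq t ht z := by
    have := h.finite
    set b := ∫ x, x ∂M
    have h1 : P.map (fun ω => X t ω - t • b) = (P.map (X t)).map (· + (-(t • b))) := by
      rw [AEMeasurable.map_map_of_aemeasurable (by fun_prop) (h.levy.aemeasurable t ht)]
      simp only [Function.comp_def, sub_eq_add_neg]
    rw [h1, charFun_map_add_const, h.charFun_eq t ht z, exponent_pureJump_eq_sub M hM z,
      ← Complex.exp_add]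
    congr 1
    rw [inner_neg_left, real_inner_smul_left]
    push_cast
    ring

namespace IsMarkedArrival

variable {Ω 𝓨 : Type*} [MeasurableSpace Ω] [MeasurableSpace 𝓨] {P : Measure Ω} {d : ℕ}
  {ν : Measure 𝓨} [IsProbabilityMeasure ν] {T L : ℝ} {E' τ : ℕ → Ω → ℝ} {y : ℕ → Ω → 𝓨}
  {H : ℝ → 𝓨 → Space d}

/-- Campbell's formula in units of time: `T * (uniformTime T).real A` is the length of the part of
`A` in `(0, T)`. -/
theorem integrable_cut
    (h : IsMarkedArrival P ((uniformTime T).prod ν) E' (fun j ω => (τ j ω, y j ω)))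
    (hT : 0 < T) (hH : Measurable (Function.uncurry H))
    (hHi : Integrable (Function.uncurry H) ((volume.restrict (Ioc 0 L)).prod ν)) {A : Set ℝ}
    (hA : MeasurableSet A) :
    Integrable (pointSum E' (fun j ω => (τ j ω, y j ω)) L (timeCut H A)) P ∧
      ∫ ω, pointSum E' (fun j ω => (τ j ω, y j ω)) L (timeCut H A) ω ∂P =
        (T * (uniformTime T).real A) • ∫ x, x ∂(jumpMeasure T (Ioc 0 L) ν H) := by
  have := isProbabilityMeasure_uniformTime hT
  have h1 := integral_timeCut hT hA hHi
  have h2 := h.integrable_pointSum (measurable_timeCut hH hA) h1.1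
  refine ⟨h2.1, ?_⟩
  rw [h2.2, h1.2, integral_jumpMeasure hT hH (φ := fun x => x) stronglyMeasurable_id, smul_smul]
  congr 1
  field_simp

end IsMarkedArrival

/-! ### Independence of the series input -/

/-- Pairing two independent families of independent variables. -/
lemma iIndepFun_prodMk {Ω ι 𝓧 𝓨 : Type*} [MeasurableSpace Ω] [MeasurableSpace 𝓧]
    [MeasurableSpace 𝓨] {P : Measure Ω} {X : ι → Ω → 𝓧} {Y : ι → Ω → 𝓨}
    (hX : iIndepFun X P) (hY : iIndepFun Y P) (hXm : ∀ i, Measurable (X i))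
    (hYm : ∀ i, Measurable (Y i))
    (hXY : IndepFun (fun ω i => X i ω) (fun ω i => Y i ω) P) :
    iIndepFun (fun i ω => (X i ω, Y i ω)) P := by
  have := hX.isProbabilityMeasure
  -- Preimages of rectangles form a π-system generating the σ-algebra of the pair, so independence
  -- has to be checked only there.
  have key : iIndepSets (fun i => {s | ∃ A : Set 𝓧, ∃ B : Set 𝓨, MeasurableSet A ∧
      MeasurableSet B ∧ s = X i ⁻¹' A ∩ Y i ⁻¹' B}) P := by
    rw [iIndepSets_iff]
    intro S f hf
    have hex : ∀ i, ∃ A : Set 𝓧, ∃ B : Set 𝓨, MeasurableSet A ∧ MeasurableSet B ∧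
        (i ∈ S → f i = X i ⁻¹' A ∩ Y i ⁻¹' B) := by
      intro i
      by_cases hi : i ∈ S
      · obtain ⟨A, B, hA, hB, h⟩ := hf i hi
        exact ⟨A, B, hA, hB, fun _ => h⟩
      · exact ⟨univ, univ, .univ, .univ, fun h => absurd h hi⟩
    choose A B hA hB hfi using hex
    have e1 : ⋂ i ∈ S, f i = (⋂ i ∈ S, X i ⁻¹' A i) ∩ ⋂ i ∈ S, Y i ⁻¹' B i := by
      ext ω
      simp only [mem_iInter, mem_inter_iff]
      constructor
      · intro h
        exact ⟨fun i hi => (hfi i hi ▸ h i hi).1, fun i hi => (hfi i hi ▸ h i hi).2⟩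
      · intro h i hi
        rw [hfi i hi]
        exact ⟨h.1 i hi, h.2 i hi⟩
    have e2 : P ((⋂ i ∈ S, X i ⁻¹' A i) ∩ ⋂ i ∈ S, Y i ⁻¹' B i) =
        P (⋂ i ∈ S, X i ⁻¹' A i) * P (⋂ i ∈ S, Y i ⁻¹' B i) := by
      have h1 := hXY.measure_inter_preimage_eq_mul {x | ∀ i ∈ S, x i ∈ A i}
        {x | ∀ i ∈ S, x i ∈ B i}
        (by
          have : {x : ι → 𝓧 | ∀ i ∈ S, x i ∈ A i} = ⋂ i ∈ S, (fun x => x i) ⁻¹' A i := by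
            ext; simp
          rw [this]
          exact Finset.measurableSet_biInter _ fun i _ => measurable_pi_apply i (hA i))
        (by
          have : {x : ι → 𝓨 | ∀ i ∈ S, x i ∈ B i} = ⋂ i ∈ S, (fun x => x i) ⁻¹' B i := by
            ext; simp
          rw [this]
          exact Finset.measurableSet_biInter _ fun i _ => measurable_pi_apply i (hB i))
      convert h1 using 2
      · congr 1 <;> (ext; simp)
      · congr 1; ext; simp
      · congr 1; ext; simp
    rw [e1, e2, hX.measure_inter_preimage_eq_mul S fun i _ => hA i,
      hY.measure_inter_preimage_eq_mul S fun i _ => hB i, ← Finset.prod_mul_distrib]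
    refine Finset.prod_congr rfl fun i hi => ?_
    rw [hfi i hi]
    have h2 : IndepFun (X i) (Y i) P :=
      hXY.comp (measurable_pi_apply i) (measurable_pi_apply i)
    exact (h2.measure_inter_preimage_eq_mul _ _ (hA i) (hB i)).symm
  refine (iIndepFun_iff_iIndep _ _ _).2 (iIndepSets.iIndep (fun i => ?_) _ (fun i => ?_)
    (fun i => ?_) key)
  · exact ((hXm i).prodMk (hYm i)).comap_le
  · rintro _ ⟨A, B, hA, hB, rfl⟩ _ ⟨A', B', hA', hB', rfl⟩ -
    refine ⟨A ∩ A', B ∩ B', hA.inter hA', hB.inter hB', ?_⟩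
    ext; simp only [mem_inter_iff, mem_preimage]; tauto
  · have : (Prod.instMeasurableSpace : MeasurableSpace (𝓧 × 𝓨)) =
        MeasurableSpace.generateFrom
          (image2 (· ×ˢ ·) {s : Set 𝓧 | MeasurableSet s} {t : Set 𝓨 | MeasurableSet t}) :=
      generateFrom_prod.symm
    rw [this, MeasurableSpace.comap_generateFrom]
    congr 1
    ext s
    constructor
    · rintro ⟨_, ⟨A, hA, B, hB, rfl⟩, rfl⟩
      exact ⟨A, B, hA, hB, rfl⟩
    · rintro ⟨A, B, hA, hB, rfl⟩
      exact ⟨A ×ˢ B, ⟨A, hA, B, hB, rfl⟩, rfl⟩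

/-- The law of the marks `(V, E, U)`. -/
def markLaw {d : ℕ} (ρ : Measure (Space d)) : Measure (Space d × ℝ × ℝ) :=
  ρ.prod ((expMeasure 1).prod (uniformTime 1))

lemma isProbabilityMeasure_markLaw {d : ℕ} (ρ : Measure (Space d)) [IsProbabilityMeasure ρ] :
    IsProbabilityMeasure (markLaw ρ) := by
  have := isProbabilityMeasure_uniformTime one_pos
  unfold markLaw
  infer_instance

/-- The input is independent family by family, whereas a marked arrival process needs independence
point by point. The real variables are grouped by their index `j`, paired with `V j`, and rearranged
into waiting time and mark. -/
theorem IsSeriesInput.isMarkedArrival {Ω : Type*} [MeasurableSpace Ω] {P : Measure Ω}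
    [IsProbabilityMeasure P] {d : ℕ} {T : ℝ} (hT : 0 < T) {ρ : Measure (Space d)}
    {E' E τ U : ℕ → Ω → ℝ} {V : ℕ → Ω → Space d} (h : IsSeriesInput P T ρ E' E τ U V) :
    IsMarkedArrival P ((uniformTime T).prod (markLaw ρ)) E'
      (fun j ω => (τ j ω, (V j ω, E j ω, U j ω))) := by
  set R : Fin 4 × ℕ → Ω → ℝ := fun k => (![E', E, τ, U] k.1) k.2 with hR
  have hRm : ∀ k, Measurable (R k) := by
    rintro ⟨i, j⟩
    fin_cases i
    · exact h.meas_E' j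
    · exact h.meas_E j
    · exact h.meas_τ j
    · exact h.meas_U j
  have hRi : iIndepFun R P := h.indep_real
  -- Grouping is read off the laws: currying the product measure over `ℕ × Fin 4` gives a product
  -- over `ℕ` of products over `Fin 4`.
  have hblock : iIndepFun (fun (j : ℕ) ω (i : Fin 4) => R (i, j) ω) P := by
    have h1 : iIndepFun (fun (k : ℕ × Fin 4) => R (k.2, k.1)) P :=
      hRi.precomp (g := fun k : ℕ × Fin 4 => (k.2, k.1)) fun a b hab => by
        simp only [Prod.mk.injEq] at hab
        exact Prod.ext hab.2 hab.1
    have hm := fun k => Measure.isProbabilityMeasure_map (μ := P) (hRm k).aemeasurable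
    have h2 := h1.map_fun_eq_infinitePi_map fun k : ℕ × Fin 4 => hRm (k.2, k.1)
    have h3 := Measure.infinitePi_map_curry (ι := ℕ) (κ := Fin 4) (X := ℝ)
      fun j i => P.map (R (i, j))
    have h0 : Measurable fun ω (k : ℕ × Fin 4) => R (k.2, k.1) ω :=
      measurable_pi_lambda _ fun k => hRm (k.2, k.1)
    rw [← h2, Measure.map_map (MeasurableEquiv.measurable _) h0] at h3
    rw [iIndepFun_iff_map_fun_eq_infinitePi_map
      fun j => measurable_pi_lambda _ fun i => hRm (i, j)]
    refine Eq.trans ?_ (h3.trans ?_)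
    · rfl
    · congr 1
      funext j
      have h4 : iIndepFun (fun i : Fin 4 => R (i, j)) P :=
        hRi.precomp (g := fun i : Fin 4 => (i, j)) fun a b hab => (Prod.mk.inj hab).1
      exact (h4.map_fun_eq_infinitePi_map fun i => hRm (i, j)).symm
  have hRV : IndepFun (fun ω k => R k ω) (fun ω (j : ℕ) => V j ω) P := h.indep_real_V
  have hcurry : Measurable fun (x : Fin 4 × ℕ → ℝ) (j : ℕ) (i : Fin 4) => x (i, j) :=
    measurable_pi_lambda _ fun j => measurable_pi_lambda _ fun i => measurable_pi_apply _
  have hRV' : IndepFun (fun ω (j : ℕ) (i : Fin 4) => R (i, j) ω) (fun ω j => V j ω) P :=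
    hRV.comp hcurry measurable_id
  have hpair := iIndepFun_prodMk hblock h.indep_V
    (fun j => measurable_pi_lambda _ fun i => hRm (i, j)) h.meas_V
    hRV'
  refine ⟨h.meas_E', fun j => (h.meas_τ j).prodMk ((h.meas_V j).prodMk
    ((h.meas_E j).prodMk (h.meas_U j))), ?_, fun j => ?_⟩
  · exact hpair.comp (fun _ x => (x.1 0, (x.1 2, (x.2, x.1 1, x.1 3)))) fun _ => by fun_prop
  · have := isProbabilityMeasure_uniformTime hT
    have := isProbabilityMeasure_uniformTime one_pos
    have : IsProbabilityMeasure ρ := by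
      rw [← h.law_V 0]; exact Measure.isProbabilityMeasure_map (h.meas_V 0).aemeasurable
    have i1 : IndepFun (fun ω => (E' j ω, τ j ω)) (fun ω => (E j ω, U j ω)) P :=
      hRi.indepFun_prodMk_prodMk hRm (0, j) (2, j) (1, j) (3, j) (by simp) (by simp) (by simp)
        (by simp)
    have i2 : IndepFun (E' j) (τ j) P := hRi.indepFun (i := (0, j)) (j := (2, j)) (by simp)
    have i3 : IndepFun (E j) (U j) P := hRi.indepFun (i := (1, j)) (j := (3, j)) (by simp)
    have i4 : IndepFun (fun ω => ((E' j ω, τ j ω), (E j ω, U j ω))) (V j) P :=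
      hRV.comp (φ := fun x => ((x (0, j), x (2, j)), (x (1, j), x (3, j)))) (ψ := fun x => x j)
        (by fun_prop) (by fun_prop)
    have m1 := (h.meas_E' j).prodMk (h.meas_τ j)
    have m2 := (h.meas_E j).prodMk (h.meas_U j)
    have l1 := (indepFun_iff_map_prod_eq_prod_map_map m1.aemeasurable m2.aemeasurable).1 i1
    have l2 := (indepFun_iff_map_prod_eq_prod_map_map (h.meas_E' j).aemeasurable
      (h.meas_τ j).aemeasurable).1 i2
    have l3 := (indepFun_iff_map_prod_eq_prod_map_map (h.meas_E j).aemeasurable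
      (h.meas_U j).aemeasurable).1 i3
    have l4 := (indepFun_iff_map_prod_eq_prod_map_map (m1.prodMk m2).aemeasurable
      (h.meas_V j).aemeasurable).1 i4
    have hτ : P.map (τ j) = uniformTime T := h.law_τ j
    have hU : P.map (U j) = uniformTime 1 := h.law_U j
    rw [l1, l2, l3, h.law_E', h.law_E, h.law_V, hτ, hU] at l4
    -- Reassociates `(((E', τ), (E, U)), V)` into `(E', (τ, (V, (E, U))))`.
    have hmp := (measurePreserving_prodAssoc (expMeasure 1) (uniformTime T)
      (ρ.prod ((expMeasure 1).prod (uniformTime 1)))).comp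
      ((MeasurePreserving.prod (MeasurePreserving.id ((expMeasure 1).prod (uniformTime T)))
        (Measure.measurePreserving_swap (μ := (expMeasure 1).prod (uniformTime 1)) (ν := ρ))).comp
        (measurePreserving_prodAssoc ((expMeasure 1).prod (uniformTime T))
          ((expMeasure 1).prod (uniformTime 1)) ρ))
    rw [markLaw, ← hmp.map_eq, ← l4, Measure.map_map hmp.measurable
      ((m1.prodMk m2).prodMk (h.meas_V j))]
    rfl

/-! ### Polar coordinates -/

open Classical in
/-- The direction `y / ‖y‖` of a vector (`u₀` for `y = 0`). -/
def polarDir {d : ℕ} (u₀ : Sph d) (y : Space d) : Sph d :=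
  ⟨if y = 0 then u₀ else ‖y‖⁻¹ • y, by
    split_ifs with h
    · exact u₀.2
    · rw [mem_sphere_zero_iff_norm, norm_smul, norm_inv, norm_norm,
        inv_mul_cancel₀ (norm_ne_zero_iff.2 h)]⟩

section Polar

variable {d : ℕ} (u₀ : Sph d)

lemma measurable_polarDir : Measurable (polarDir u₀) := by
  refine Measurable.subtype_mk (Measurable.ite (measurableSet_singleton 0) measurable_const ?_)
  fun_prop

lemma norm_smul_polarDir (y : Space d) : ‖y‖ • (polarDir u₀ y : Space d) = y := by
  by_cases h : y = 0
  · simp [h]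
  · simp [polarDir, h, smul_smul]

lemma norm_smul_sph {r : ℝ} (hr : 0 ≤ r) (u : Sph d) : ‖r • (u : Space d)‖ = r := by
  rw [norm_smul, mem_sphere_zero_iff_norm.1 u.2, mul_one, Real.norm_of_nonneg hr]

lemma polarDir_smul {r : ℝ} (hr : 0 < r) (u : Sph d) : polarDir u₀ (r • (u : Space d)) = u := by
  have h : r • (u : Space d) ≠ 0 := by
    rw [← norm_ne_zero_iff, norm_smul_sph hr.le]; exact hr.ne'
  refine Subtype.ext ?_
  simp only [polarDir, h, if_false, norm_smul_sph hr.le, smul_smul, inv_mul_cancel₀ hr.ne',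
    one_smul]

lemma mem_polarSet_iff {x : ℝ} (hx : 0 ≤ x) {B : Set (Sph d)} {y : Space d} :
    y ∈ polarSet x B ↔ x < ‖y‖ ∧ polarDir u₀ y ∈ B := by
  constructor
  · rintro ⟨r, hr, u, hu, rfl⟩
    have hr0 : 0 < r := hx.trans_lt hr
    rw [norm_smul_sph hr0.le, polarDir_smul u₀ hr0]
    exact ⟨hr, hu⟩
  · rintro ⟨h1, h2⟩
    exact ⟨‖y‖, h1, _, h2, (norm_smul_polarDir u₀ y).symm⟩

include u₀

lemma measurableSet_polarSet {x : ℝ} (hx : 0 ≤ x) {B : Set (Sph d)} (hB : MeasurableSet B) :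
    MeasurableSet (polarSet x B) := by
  have : polarSet x B = {y | x < ‖y‖} ∩ polarDir u₀ ⁻¹' B := by
    ext y; exact mem_polarSet_iff u₀ hx
  rw [this]
  exact (measurableSet_lt measurable_const measurable_norm).inter (measurable_polarDir u₀ hB)

/-- A measure without mass at the origin is determined by its values on the sets `(x, ∞) B`. -/
theorem ext_of_polarSet {μ μ' : Measure (Space d)} (h0 : μ {0} = 0) (h0' : μ' {0} = 0)
    (hfin : ∀ x, 0 < x → μ (polarSet x univ) < ∞)
    (h : ∀ x, 0 < x → ∀ B, MeasurableSet B → μ (polarSet x B) = μ' (polarSet x B)) : μ = μ' := by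
  set Ψ : Space d → ℝ × Sph d := fun y => (‖y‖, polarDir u₀ y) with hΨ
  have hΨm : Measurable Ψ := measurable_norm.prodMk (measurable_polarDir u₀)
  have hpre : ∀ x, 0 < x → ∀ B, Ψ ⁻¹' (Ioi x ×ˢ B) = polarSet x B := fun x hx B => by
    ext y; rw [mem_polarSet_iff u₀ hx.le]; rfl
  have hinv : ∀ M : Measure (Space d), (M.map Ψ).map (fun w => w.1 • (w.2 : Space d)) = M := by
    intro M
    rw [Measure.map_map (by fun_prop) hΨm]
    convert! Measure.map_id
    funext y
    exact norm_smul_polarDir u₀ y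
  suffices hs : μ.map Ψ = μ'.map Ψ by rw [← hinv μ, hs, hinv]
  have hval : ∀ x, 0 < x → ∀ B, MeasurableSet B →
      μ.map Ψ (Ioi x ×ˢ B) = μ'.map Ψ (Ioi x ×ˢ B) := fun x hx B hB => by
    rw [Measure.map_apply hΨm (measurableSet_Ioi.prod hB),
      Measure.map_apply hΨm (measurableSet_Ioi.prod hB), hpre x hx, h x hx B hB]
  have hfin' : ∀ x, 0 < x → μ.map Ψ (Ioi x ×ˢ univ) < ∞ := fun x hx => by
    rw [Measure.map_apply hΨm (measurableSet_Ioi.prod .univ), hpre x hx]; exact hfin x hx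
  have hzero : ∀ M : Measure (Space d), M {0} = 0 → M.map Ψ (Iic 0 ×ˢ univ) = 0 := by
    intro M hM
    rw [Measure.map_apply hΨm (measurableSet_Iic.prod .univ)]
    refine measure_mono_null (fun y hy => ?_) hM
    have : ‖y‖ ≤ 0 := hy.1
    simpa using this
  -- The mass may be infinite near the origin, so the measures are compared on the pieces of radius
  -- above `1 / (k + 1)`, where `hfin` gives finiteness, and on the null piece of radius at most
  -- `0`.
  refine (Measure.ext_iff_of_iUnion_eq_univ (s := fun k : Option ℕ => k.elim
    (Iic (0 : ℝ) ×ˢ (univ : Set (Sph d))) fun k => Ioi (1 / ((k : ℝ) + 1)) ×ˢ univ) ?_).2 ?_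
  · refine eq_univ_of_forall fun w => mem_iUnion.2 ?_
    by_cases hw : w.1 ≤ 0
    · exact ⟨none, hw, trivial⟩
    · obtain ⟨k, hk⟩ := exists_nat_one_div_lt (not_le.1 hw)
      exact ⟨some k, hk, trivial⟩
  · rintro (_ | k)
    · simp only [Option.elim]
      rw [Measure.restrict_eq_zero.2 (hzero μ h0), Measure.restrict_eq_zero.2 (hzero μ' h0')]
    · simp only [Option.elim]
      set ε : ℝ := 1 / ((k : ℝ) + 1) with hε
      have hε0 : 0 < ε := by positivity
      have hf1 : IsFiniteMeasure ((μ.map Ψ).restrict (Ioi ε ×ˢ univ)) :=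
        ⟨by rw [Measure.restrict_apply_univ]; exact hfin' ε hε0⟩
      refine Measure.ext_prod fun {s t} hs ht => ?_
      have hslice : ∀ M : Measure (ℝ × Sph d), ∀ s, MeasurableSet s →
          M.restrict (Ioi ε ×ˢ univ) (s ×ˢ t) = (M.restrict (Ioi ε ×ˢ t)).map Prod.fst s := by
        intro M s hs
        rw [Measure.restrict_apply (hs.prod ht), Measure.map_apply measurable_fst hs,
          Measure.restrict_apply (measurable_fst hs)]
        congr 1
        ext w
        simp only [mem_inter_iff, mem_prod, mem_univ, mem_preimage]
        tauto
      -- For a fixed set `t` of directions this is an equality of two measures on the line, which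
      -- half-lines determine because the first is finite.
      rw [hslice _ s hs, hslice _ s hs]
      congr 1
      have hf2 : IsFiniteMeasure ((μ.map Ψ).restrict (Ioi ε ×ˢ t)) :=
        ⟨by
          rw [Measure.restrict_apply_univ]
          exact (measure_mono (prod_mono_right (subset_univ t))).trans_lt (hfin' ε hε0)⟩
      have hIoi : ∀ M : Measure (ℝ × Sph d), ∀ a,
          (M.restrict (Ioi ε ×ˢ t)).map Prod.fst (Ioi a) = M (Ioi (max a ε) ×ˢ t) := by
        intro M a
        rw [Measure.map_apply measurable_fst measurableSet_Ioi,
          Measure.restrict_apply (measurable_fst measurableSet_Ioi)]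
        congr 1
        ext w
        simp only [mem_inter_iff, mem_prod, mem_preimage, mem_Ioi, max_lt_iff]
        tauto
      refine ext_of_generate_finite (range Ioi) (borel_eq_generateFrom_Ioi ℝ ▸
        (BorelSpace.measurable_eq : (inferInstance : MeasurableSpace ℝ) = borel ℝ)) isPiSystem_Ioi
        ?_ ?_
      · rintro _ ⟨a, rfl⟩
        rw [hIoi, hIoi]
        exact hval _ (lt_max_of_lt_right hε0) t ht
      · rw [Measure.map_apply measurable_fst .univ, Measure.map_apply measurable_fst .univ,
          preimage_univ, Measure.restrict_apply_univ, Measure.restrict_apply_univ]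
        exact hval ε hε0 t ht

end Polar

/-! ### Tail of the radial factor -/

lemma expMeasure_one_Ioi {a : ℝ} (ha : 0 ≤ a) :
    expMeasure 1 (Ioi a) = ENNReal.ofReal (Real.exp (-a)) := by
  rw [expMeasure_one_eq, withDensity_apply _ measurableSet_Ioi,
    Measure.restrict_restrict measurableSet_Ioi, inter_eq_left.2 (Ioi_subset_Ioi ha),
    ← ofReal_integral_eq_lintegral_ofReal (integrableOn_exp_neg_Ioi a)
      (ae_of_all _ fun x => (Real.exp_pos _).le), integral_exp_neg_Ioi]

/-- The tail of `E^{1/p} U^{1/α} / w^{1/p}`. -/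
lemma measure_radial_tail {α p w x : ℝ} (hα : 0 < α) (hp : 0 < p) (hw : 0 < w) (hx : 0 < x) :
    ((expMeasure 1).prod (uniformTime 1))
        {y | x < y.1 ^ (1 / p) * y.2 ^ (1 / α) / w ^ (1 / p)} =
      ∫⁻ r in Ioi x, ENNReal.ofReal (α * x ^ α * r ^ (-α - 1)) *
        ENNReal.ofReal (Real.exp (-(r ^ p * w))) := by
  have := isProbabilityMeasure_uniformTime one_pos
  have hm : MeasurableSet {y : ℝ × ℝ | x < y.1 ^ (1 / p) * y.2 ^ (1 / α) / w ^ (1 / p)} :=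
    measurableSet_lt measurable_const (by fun_prop)
  have hunif : uniformTime 1 = volume.restrict (Ioo (0 : ℝ) 1) := by
    simp [uniformTime, ProbabilityTheory.cond]
  rw [Measure.prod_apply_symm hm, hunif]
  have e1 : ∀ u ∈ Ioo (0 : ℝ) 1, expMeasure 1 ((fun e => (e, u)) ⁻¹'
      {y : ℝ × ℝ | x < y.1 ^ (1 / p) * y.2 ^ (1 / α) / w ^ (1 / p)}) =
      ENNReal.ofReal (Real.exp (-((x * u ^ (-1 / α)) ^ p * w))) := by
    intro u hu
    have hu0 := hu.1
    rw [← expMeasure_one_Ioi (by positivity)]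
    refine measure_congr ?_
    filter_upwards [ae_expMeasure_one_pos] with e he
    refine propext ?_
    change x < e ^ (1 / p) * u ^ (1 / α) / w ^ (1 / p) ↔ (x * u ^ (-1 / α)) ^ p * w < e
    have h1 : u ^ (-1 / α) = (u ^ (1 / α))⁻¹ := by
      rw [← Real.rpow_neg hu0.le]; congr 1; ring
    rw [h1, lt_div_iff₀ (by positivity), ← div_lt_iff₀ (by positivity), one_div,
      Real.lt_rpow_inv_iff_of_pos (by positivity) he.le hp]
    have h2 : (x * w ^ p⁻¹ / u ^ (1 / α)) = (x * (u ^ (1 / α))⁻¹) * w ^ p⁻¹ := by ring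
    rw [h2, Real.mul_rpow (by positivity) (by positivity), Real.rpow_inv_rpow hw.le hp.ne']
  rw [setLIntegral_congr_fun measurableSet_Ioo e1]
  -- The substitution `r = x * u ^ (-1 / α)` turns the exponent in `e1` into `r ^ p * w`; its
  -- Jacobian is the stable density `α x ^ α r ^ (-α - 1)`.
  have himg : (fun r : ℝ => (x / r) ^ α) '' Ioi x = Ioo 0 1 := by
    ext u
    constructor
    · rintro ⟨r, hr, rfl⟩
      have hr0 : 0 < r := hx.trans hr
      exact ⟨by positivity, Real.rpow_lt_one (by positivity) ((div_lt_one hr0).2 hr) hα⟩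
    · rintro ⟨hu0, hu1⟩
      refine ⟨x * u ^ (-1 / α), ?_, ?_⟩
      · have : 1 < u ^ (-1 / α) := Real.one_lt_rpow_of_pos_of_lt_one_of_neg hu0 hu1
          (div_neg_of_neg_of_pos (by norm_num) hα)
        exact lt_mul_of_one_lt_right hx this
      · simp only
        rw [← div_div, div_self hx.ne', one_div, ← Real.rpow_neg hu0.le, ← Real.rpow_mul hu0.le]
        have : -(-1 / α) * α = 1 := by field_simp
        rw [this, Real.rpow_one]
  have hderiv : ∀ r ∈ Ioi x, HasDerivWithinAt (fun r : ℝ => (x / r) ^ α)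
      (-(α * x ^ α * r ^ (-α - 1))) (Ioi x) r := by
    intro r hr
    have hr0 : 0 < r := hx.trans hr
    have h1 : HasDerivAt (fun r : ℝ => x ^ α * r ^ (-α)) (x ^ α * (-α * r ^ (-α - 1))) r :=
      (Real.hasDerivAt_rpow_const (Or.inl hr0.ne')).const_mul _
    refine ((h1.congr_of_eventuallyEq ?_).congr_deriv (by ring)).hasDerivWithinAt
    filter_upwards [lt_mem_nhds hr0] with s hs
    rw [Real.div_rpow hx.le hs.le, Real.rpow_neg hs.le]; rfl
  have hinj : InjOn (fun r : ℝ => (x / r) ^ α) (Ioi x) := by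
    intro r hr s hs hrs
    have hr0 : 0 < r := hx.trans hr
    have hs0 : 0 < s := hx.trans hs
    have := (Real.rpow_left_inj (by positivity) (by positivity) hα.ne').1 hrs
    field_simp at this
    exact this.symm
  rw [← himg, lintegral_image_eq_lintegral_abs_deriv_mul measurableSet_Ioi hderiv hinj]
  refine setLIntegral_congr_fun measurableSet_Ioi fun r hr => ?_
  have hr0 : 0 < r := hx.trans hr
  rw [abs_neg, abs_of_nonneg (by positivity)]
  congr 4
  rw [← Real.rpow_mul (by positivity)]
  have : α * (-1 / α) = -1 := by field_simp
  rw [this, Real.rpow_neg_one, inv_div]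
  field_simp

/-! ### The jumps of the series -/

/-- The jump function of the series, as a function of the arrival time and the mark `(V, E, U)`. -/
def seriesJump {d : ℕ} (α p m T : ℝ) (s : ℝ) (y : Space d × ℝ × ℝ) : Space d :=
  jumpH α p m T s y.1 y.2.1 y.2.2

lemma measurable_seriesJump {d : ℕ} (α p m T : ℝ) :
    Measurable (Function.uncurry (seriesJump (d := d) α p m T)) := by
  unfold seriesJump jumpH Function.uncurry
  fun_prop

/-- The law of the vectors `V_j`. -/
def directionLaw {d : ℕ} (σ : Measure (Sph d)) (Q : Kernel (Sph d) ℝ) : Measure (Space d) :=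
  (σ univ)⁻¹ • spectralQ σ Q

lemma ae_pos_of_temperingFamily {d : ℕ} {q : ℝ → Sph d → ℝ}
    {Q : Kernel (Sph d) ℝ} (hQ : IsTemperingFamily q Q) (u : Sph d) :
    ∀ᵐ s ∂(Q u), 0 < s := by
  have : {s : ℝ | ¬ 0 < s} = Iic 0 := by ext; simp
  rw [ae_iff, this]
  exact hQ.supported u

section Spectral

variable {d : ℕ} {σ : Measure (Sph d)} [IsFiniteMeasure σ] {q : ℝ → Sph d → ℝ}
  {Q : Kernel (Sph d) ℝ} [IsMarkovKernel Q]

lemma lintegral_spectralQ {f : Space d → ℝ≥0∞} (hf : Measurable f) :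
    ∫⁻ v, f v ∂(spectralQ σ Q) = ∫⁻ u, ∫⁻ s, f (s • (u : Space d)) ∂(Q u) ∂σ := by
  have hm : Measurable fun x : Sph d × ℝ => x.2 • (x.1 : Space d) := by fun_prop
  rw [spectralQ, lintegral_map hf hm]
  exact Measure.lintegral_compProd (f := fun x : Sph d × ℝ => f (x.2 • (x.1 : Space d)))
    (hf.comp hm)

lemma isProbabilityMeasure_directionLaw (hσ : σ ≠ 0) :
    IsProbabilityMeasure (directionLaw σ Q) := by
  refine ⟨?_⟩
  have h1 : spectralQ σ Q univ = σ univ := by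
    rw [← lintegral_one, lintegral_spectralQ measurable_const]
    simp
  rw [directionLaw, Measure.smul_apply, h1, smul_eq_mul,
    ENNReal.inv_mul_cancel (by simpa using hσ) (measure_ne_top _ _)]

lemma ae_directionLaw_ne_zero (hQ : IsTemperingFamily q Q) :
    ∀ᵐ v ∂(directionLaw σ Q), v ≠ 0 := by
  refine (Measure.smul_absolutelyContinuous (μ := spectralQ σ Q)
    (c := (σ univ)⁻¹)).ae_le (?_ : ∀ᵐ v ∂(spectralQ σ Q), v ≠ 0)
  have h0 : spectralQ σ Q {0} = 0 := by
    rw [← lintegral_indicator_one (measurableSet_singleton 0),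
      lintegral_spectralQ (measurable_one.indicator (measurableSet_singleton 0))]
    refine (lintegral_congr fun u => ?_).trans lintegral_zero
    refine (lintegral_congr_ae ?_).trans lintegral_zero
    filter_upwards [ae_pos_of_temperingFamily hQ u] with s hs
    refine indicator_of_notMem (fun hc => hs.ne' ?_) _
    rw [← norm_smul_sph hs.le u, mem_singleton_iff.1 hc, norm_zero]
  exact compl_mem_ae_iff.2 h0

lemma ae_markLaw (hσ : σ ≠ 0) (hQ : IsTemperingFamily q Q) :
    ∀ᵐ y ∂(markLaw (directionLaw σ Q)), y.1 ≠ 0 ∧ 0 < y.2.1 ∧ 0 < y.2.2 := by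
  have := isProbabilityMeasure_directionLaw (Q := Q) hσ
  have := isProbabilityMeasure_uniformTime one_pos
  have h1 : ∀ᵐ u ∂(uniformTime 1), 0 < u := by
    have : ∀ᵐ u ∂(uniformTime 1), u ∈ Ioo (0 : ℝ) 1 := ae_cond_mem measurableSet_Ioo
    filter_upwards [this] with u hu using hu.1
  have hq1 : Measure.QuasiMeasurePreserving (Prod.fst : Space d × ℝ × ℝ → Space d)
      (markLaw (directionLaw σ Q)) (directionLaw σ Q) := Measure.quasiMeasurePreserving_fst
  have hq2 : Measure.QuasiMeasurePreserving (Prod.snd : Space d × ℝ × ℝ → ℝ × ℝ)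
      (markLaw (directionLaw σ Q)) ((expMeasure 1).prod (uniformTime 1)) :=
    Measure.quasiMeasurePreserving_snd
  filter_upwards [hq1.ae (ae_directionLaw_ne_zero hQ),
    hq2.ae (Measure.quasiMeasurePreserving_fst.ae ae_expMeasure_one_pos),
    hq2.ae (Measure.quasiMeasurePreserving_snd.ae h1)] with y h1 h2 h3 using ⟨h1, h2, h3⟩

variable {α p T : ℝ}

/-- The polar tail of the radial variable `E^{1/p} U^{1/α} / ‖V‖^{1/p}`. -/
theorem markLaw_polar_tail (hσ : σ ≠ 0) (hα : 0 < α) (hp : 0 < p) (hq : IsProperTempering q)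
    (hQ : IsTemperingFamily q Q) (u₀ : Sph d) {x : ℝ} (hx : 0 < x) {B : Set (Sph d)}
    (hB : MeasurableSet B) :
    markLaw (directionLaw σ Q)
        {y | x < y.2.1 ^ (1 / p) * y.2.2 ^ (1 / α) / ‖y.1‖ ^ (1 / p) ∧ polarDir u₀ y.1 ∈ B} =
      ENNReal.ofReal (α * x ^ α / σ.real univ) * levyMeasure α p σ q (polarSet x B) := by
  have := isProbabilityMeasure_directionLaw (Q := Q) hσ
  have := isProbabilityMeasure_uniformTime one_pos
  have hσ0 : 0 < σ.real univ := by
    rw [measureReal_def]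
    exact ENNReal.toReal_pos (by simpa using hσ) (measure_ne_top _ _)
  set S : Set (Space d × ℝ × ℝ) :=
    {y | x < y.2.1 ^ (1 / p) * y.2.2 ^ (1 / α) / ‖y.1‖ ^ (1 / p) ∧ polarDir u₀ y.1 ∈ B} with hS
  have hSm : MeasurableSet S := by
    have h1 : MeasurableSet {y : Space d × ℝ × ℝ |
        x < y.2.1 ^ (1 / p) * y.2.2 ^ (1 / α) / ‖y.1‖ ^ (1 / p)} :=
      measurableSet_lt measurable_const (by fun_prop)
    exact h1.inter ((measurable_polarDir u₀).comp measurable_fst hB)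
  set f : Space d → ℝ≥0∞ := fun v => ((expMeasure 1).prod (uniformTime 1)) (Prod.mk v ⁻¹' S) with hf
  have hfm : Measurable f := measurable_measure_prodMk_left hSm
  have hfs : ∀ (u : Sph d) (s : ℝ), 0 < s → f (s • (u : Space d)) =
      B.indicator 1 u * ∫⁻ r in Ioi x, ENNReal.ofReal (α * x ^ α * r ^ (-α - 1)) *
        ENNReal.ofReal (Real.exp (-(r ^ p * s))) := by
    intro u s hs
    by_cases hu : u ∈ B
    · rw [indicator_of_mem hu, Pi.one_apply, one_mul, ← measure_radial_tail hα hp hs hx]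
      simp only [hf]
      congr 1
      ext y
      simp [hS, polarDir_smul u₀ hs, norm_smul_sph hs.le, hu]
    · rw [indicator_of_notMem hu, zero_mul]
      have : Prod.mk (s • (u : Space d)) ⁻¹' S = ∅ := by
        ext y
        simp [hS, polarDir_smul u₀ hs, hu]
      simp only [hf, this, measure_empty]
  have hx0 : 0 ≤ α * x ^ α := by positivity
  have hu : ∀ u : Sph d, ∫⁻ s, f (s • (u : Space d)) ∂(Q u) = ENNReal.ofReal (α * x ^ α) *
      ∫⁻ r in Ioi (0 : ℝ), (polarSet x B).indicator 1 (r • (u : Space d)) *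
        ENNReal.ofReal (q (r ^ p) u * r ^ (-α - 1)) := by
    intro u
    have e1 : ∫⁻ s, f (s • (u : Space d)) ∂(Q u) = B.indicator 1 u *
        ∫⁻ s, ∫⁻ r in Ioi x, ENNReal.ofReal (α * x ^ α * r ^ (-α - 1)) *
          ENNReal.ofReal (Real.exp (-(r ^ p * s))) ∂volume ∂(Q u) := by
      rw [← lintegral_const_mul]
      · refine lintegral_congr_ae ?_
        filter_upwards [ae_pos_of_temperingFamily hQ u] with s hs using hfs u s hs
      · refine Measurable.lintegral_prod_right' (f := fun z : ℝ × ℝ =>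
          ENNReal.ofReal (α * x ^ α * z.2 ^ (-α - 1)) *
          ENNReal.ofReal (Real.exp (-(z.2 ^ p * z.1)))) ?_
        fun_prop
    -- Here the tempering enters: after Tonelli, the average of `exp(-r ^ p s)` over `Q(ds | u)` is
    -- `q(r ^ p, u)`.
    have e2 : ∫⁻ s, ∫⁻ r in Ioi x, ENNReal.ofReal (α * x ^ α * r ^ (-α - 1)) *
          ENNReal.ofReal (Real.exp (-(r ^ p * s))) ∂volume ∂(Q u) =
        ∫⁻ r in Ioi x, ENNReal.ofReal (α * x ^ α) *
          ENNReal.ofReal (q (r ^ p) u * r ^ (-α - 1)) := by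
      rw [lintegral_lintegral_swap]
      · refine setLIntegral_congr_fun measurableSet_Ioi fun r hr => ?_
        have hr0 : 0 < r := hx.trans hr
        rw [lintegral_const_mul _ (by fun_prop), hQ.laplace u (r ^ p) (Real.rpow_pos_of_pos hr0 p),
          ENNReal.ofReal_mul hx0, ENNReal.ofReal_mul (hq.pos _ u (Real.rpow_pos_of_pos hr0 p)).le]
        ring
      · have : Measurable (Function.uncurry fun (s r : ℝ) =>
            ENNReal.ofReal (α * x ^ α * r ^ (-α - 1)) *
            ENNReal.ofReal (Real.exp (-(r ^ p * s)))) := by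
          unfold Function.uncurry
          fun_prop
        exact this.aemeasurable
    rw [e1, e2, lintegral_const_mul' _ _ ENNReal.ofReal_ne_top, mul_left_comm]
    congr 1
    have hsub : ∀ r ∈ Ioi (0 : ℝ), (polarSet x B).indicator 1 (r • (u : Space d)) *
        ENNReal.ofReal (q (r ^ p) u * r ^ (-α - 1)) = B.indicator 1 u * (Ioi x).indicator
          (fun r => ENNReal.ofReal (q (r ^ p) u * r ^ (-α - 1))) r := by
      intro r hr
      have hr0 : 0 < r := hr
      have hiff : r • (u : Space d) ∈ polarSet x B ↔ x < r ∧ u ∈ B := by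
        rw [mem_polarSet_iff u₀ hx.le, norm_smul_sph hr0.le, polarDir_smul u₀ hr0]
      by_cases h1 : x < r <;> by_cases h2 : u ∈ B <;> simp [indicator, hiff, h1, h2]
    have hBne : B.indicator (1 : Sph d → ℝ≥0∞) u ≠ ∞ := by
      by_cases h2 : u ∈ B <;> simp [h2]
    rw [setLIntegral_congr_fun measurableSet_Ioi hsub, lintegral_const_mul' _ _ hBne,
      lintegral_indicator measurableSet_Ioi, Measure.restrict_restrict measurableSet_Ioi,
      inter_eq_left.2 (Ioi_subset_Ioi hx.le)]
  rw [markLaw, Measure.prod_apply hSm, directionLaw, lintegral_smul_measure,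
    lintegral_spectralQ hfm]
  simp only [hu]
  rw [lintegral_const_mul' _ _ ENNReal.ofReal_ne_top, ← levyMeasure_apply σ hq
    (measurableSet_polarSet u₀ hx.le hB), smul_eq_mul, ← mul_assoc, div_eq_inv_mul,
    ENNReal.ofReal_mul (inv_nonneg.2 hσ0.le), ENNReal.ofReal_inv_of_pos hσ0, ofReal_measureReal]

lemma lt_rpow_neg_inv_iff {c s x : ℝ} (hα : 0 < α) (hc : 0 < c) (hs : 0 < s) (hx : 0 < x) :
    x < (α * s / c) ^ (-1 / α) ↔ s < c / (α * x ^ α) := by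
  have h1 : (α * s / c) ^ (-1 / α) = (c / (α * s)) ^ α⁻¹ := by
    rw [show -1 / α = -α⁻¹ by ring, Real.rpow_neg (by positivity), ← Real.inv_rpow (by positivity),
      inv_div]
  rw [h1, Real.lt_rpow_inv_iff_of_pos hx.le (by positivity) hα, lt_div_iff₀ (by positivity),
    lt_div_iff₀ (by positivity)]
  ring_nf

/-- A minimum exceeds `x` exactly when both entries do. The condition separates into one on the
arrival time and one on the mark, so it defines a product set for the intensity. -/
lemma seriesJump_mem_polarSet_iff {m s x : ℝ} (hmT : 0 < m * T) (hα : 0 < α) (hs : 0 < s)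
    (hx : 0 < x) (u₀ : Sph d) {y : Space d × ℝ × ℝ} (hy : y.1 ≠ 0 ∧ 0 < y.2.1 ∧ 0 < y.2.2)
    (B : Set (Sph d)) :
    seriesJump α p m T s y ∈ polarSet x B ↔ s < m * T / (α * x ^ α) ∧
      (x < y.2.1 ^ (1 / p) * y.2.2 ^ (1 / α) / ‖y.1‖ ^ (1 / p) ∧ polarDir u₀ y.1 ∈ B) := by
  obtain ⟨h1, h2, h3⟩ := hy
  have hn : 0 < ‖y.1‖ := norm_pos_iff.2 h1
  have hdir : seriesJump α p m T s y = min ((α * s / (m * T)) ^ (-1 / α))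
      (y.2.1 ^ (1 / p) * y.2.2 ^ (1 / α) / ‖y.1‖ ^ (1 / p)) • (polarDir u₀ y.1 : Space d) := by
    simp [seriesJump, jumpH, polarDir, h1]
  have hpos : 0 < min ((α * s / (m * T)) ^ (-1 / α))
      (y.2.1 ^ (1 / p) * y.2.2 ^ (1 / α) / ‖y.1‖ ^ (1 / p)) :=
    lt_min (by positivity) (by positivity)
  rw [hdir, mem_polarSet_iff u₀ hx.le, norm_smul_sph hpos.le, polarDir_smul u₀ hpos, lt_min_iff,
    lt_rpow_neg_inv_iff hα hmT hs hx, and_assoc]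

lemma seriesJump_ne_zero {m s : ℝ} (hmT : 0 < m * T) (hα : 0 < α) (hs : 0 < s)
    {y : Space d × ℝ × ℝ} (hy : y.1 ≠ 0 ∧ 0 < y.2.1 ∧ 0 < y.2.2) :
    seriesJump α p m T s y ≠ 0 := by
  obtain ⟨h1, h2, h3⟩ := hy
  have hn : 0 < ‖y.1‖ := norm_pos_iff.2 h1
  have hpos : 0 < min ((α * s / (m * T)) ^ (-1 / α))
      (y.2.1 ^ (1 / p) * y.2.2 ^ (1 / α) / ‖y.1‖ ^ (1 / p)) :=
    lt_min (by positivity) (by positivity)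
  exact smul_ne_zero hpos.ne' (smul_ne_zero (by positivity) h1)

lemma ae_pos_and_mark (hσ : σ ≠ 0) (hQ : IsTemperingFamily q Q) {I : Set ℝ}
    (hI : MeasurableSet I) (hI0 : I ⊆ Ioi 0) :
    ∀ᵐ x ∂((volume.restrict I).prod (markLaw (directionLaw σ Q))),
      0 < x.1 ∧ (x.2.1 ≠ 0 ∧ 0 < x.2.2.1 ∧ 0 < x.2.2.2) := by
  have := isProbabilityMeasure_directionLaw (Q := Q) hσ
  have := isProbabilityMeasure_markLaw (directionLaw σ Q)
  have h1 : ∀ᵐ s ∂(volume.restrict I), 0 < s := by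
    filter_upwards [ae_restrict_mem hI] with s hs using hI0 hs
  filter_upwards [Measure.quasiMeasurePreserving_fst.ae h1,
    Measure.quasiMeasurePreserving_snd.ae (ae_markLaw hσ hQ)] with x h1 h2 using ⟨h1, h2⟩

lemma jumpMeasure_seriesJump_zero {m : ℝ} (hmT : 0 < m * T) (hσ : σ ≠ 0) (hα : 0 < α)
    (hQ : IsTemperingFamily q Q) {I : Set ℝ} (hI : MeasurableSet I) (hI0 : I ⊆ Ioi 0) :
    jumpMeasure T I (markLaw (directionLaw σ Q)) (seriesJump α p m T) {0} = 0 := by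
  rw [jumpMeasure, Measure.smul_apply, Measure.map_apply (measurable_seriesJump α p m T)
    (measurableSet_singleton 0)]
  have : ((volume.restrict I).prod (markLaw (directionLaw σ Q)))
      (Function.uncurry (seriesJump α p m T) ⁻¹' {0}) = 0 := by
    rw [← nonpos_iff_eq_zero, ← measure_empty (μ := (volume.restrict I).prod
      (markLaw (directionLaw σ Q)))]
    refine measure_mono_ae ?_
    filter_upwards [ae_pos_and_mark hσ hQ hI hI0] with x hx hc
    exact seriesJump_ne_zero hmT hα hx.1 hx.2 hc
  rw [this, smul_zero]

/-- The mass of a product set: a length of arrival times times a probability of marks. A general `I`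
serves both the truncated and the full series. -/
theorem jumpMeasure_seriesJump_polarSet (hT : 0 < T) (hσ : σ ≠ 0) (hα : 0 < α) (hp : 0 < p)
    (hq : IsProperTempering q) (hQ : IsTemperingFamily q Q) (u₀ : Sph d) {I : Set ℝ}
    (hI : MeasurableSet I) (hI0 : I ⊆ Ioi 0) {x : ℝ} (hx : 0 < x) {B : Set (Sph d)}
    (hB : MeasurableSet B) :
    jumpMeasure T I (markLaw (directionLaw σ Q)) (seriesJump α p (σ.real univ) T)
        (polarSet x B) =
      ENNReal.ofReal T⁻¹ * volume (I ∩ Iio (σ.real univ * T / (α * x ^ α))) *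
        (ENNReal.ofReal (α * x ^ α / σ.real univ) * levyMeasure α p σ q (polarSet x B)) := by
  have := isProbabilityMeasure_directionLaw (Q := Q) hσ
  have := isProbabilityMeasure_markLaw (directionLaw σ Q)
  have hσ0 : 0 < σ.real univ := by
    rw [measureReal_def]
    exact ENNReal.toReal_pos (by simpa using hσ) (measure_ne_top _ _)
  rw [jumpMeasure, Measure.smul_apply, Measure.map_apply (measurable_seriesJump _ _ _ _)
    (measurableSet_polarSet u₀ hx.le hB), smul_eq_mul, mul_assoc,
    ← markLaw_polar_tail hσ hα hp hq hQ u₀ hx hB, inter_comm,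
    ← Measure.restrict_apply measurableSet_Iio, ← Measure.prod_prod]
  congr 1
  refine measure_congr ?_
  filter_upwards [ae_pos_and_mark hσ hQ hI hI0] with y hy
  exact propext (seriesJump_mem_polarSet_iff (mul_pos hσ0 hT) hα hy.1 hx u₀ hy.2 B)

/-- The untruncated jump measure is the Lévy measure. -/
theorem jumpMeasure_Ioi_eq_levyMeasure (hT : 0 < T) (hσ : σ ≠ 0) (hα : 0 < α) (hp : 0 < p)
    (hq : IsProperTempering q) (hQ : IsTemperingFamily q Q) (u₀ : Sph d) :
    jumpMeasure T (Ioi 0) (markLaw (directionLaw σ Q)) (seriesJump α p (σ.real univ) T) =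
      levyMeasure α p σ q := by
  have hσ0 : 0 < σ.real univ := by
    rw [measureReal_def]
    exact ENNReal.toReal_pos (by simpa using hσ) (measure_ne_top _ _)
  have := isProbabilityMeasure_directionLaw (Q := Q) hσ
  have := isProbabilityMeasure_markLaw (directionLaw σ Q)
  have hpol : ∀ x, 0 < x → ∀ B, MeasurableSet B →
      jumpMeasure T (Ioi 0) (markLaw (directionLaw σ Q)) (seriesJump α p (σ.real univ) T)
        (polarSet x B) = levyMeasure α p σ q (polarSet x B) := by
    intro x hx B hB
    have hc : 0 < α * x ^ α := by positivity
    rw [jumpMeasure_seriesJump_polarSet hT hσ hα hp hq hQ u₀ measurableSet_Ioi subset_rfl hx hB,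
      Ioi_inter_Iio, Real.volume_Ioo, sub_zero, ← mul_assoc, ← ENNReal.ofReal_mul (by positivity),
      ← ENNReal.ofReal_mul (by positivity)]
    have : T⁻¹ * (σ.real univ * T / (α * x ^ α)) * (α * x ^ α / σ.real univ) = 1 := by
      field_simp
    rw [this, ENNReal.ofReal_one, one_mul]
  refine ext_of_polarSet u₀ (jumpMeasure_seriesJump_zero (mul_pos hσ0 hT) hσ hα hQ
    measurableSet_Ioi subset_rfl) ?_ (fun x hx => ?_) hpol
  · rw [levyMeasure_apply σ hq (measurableSet_singleton 0)]
    refine (lintegral_congr fun u => ?_).trans lintegral_zero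
    refine (setLIntegral_congr_fun measurableSet_Ioi fun r hr => ?_).trans lintegral_zero
    have hr0 : 0 < r := hr
    have : r • (u : Space d) ∉ ({0} : Set (Space d)) := fun hc => hr0.ne' (by
      rw [← norm_smul_sph hr0.le u, mem_singleton_iff.1 hc, norm_zero])
    simp [indicator_of_notMem this]
  · rw [hpol x hx univ .univ]
    have hc : 0 < α * x ^ α / σ.real univ := by positivity
    -- Tails of the Lévy measure are finite because a positive multiple of them is a probability.
    have h1 := markLaw_polar_tail hσ hα hp hq hQ u₀ hx (B := univ) .univ
    have h2 : ENNReal.ofReal (α * x ^ α / σ.real univ) *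
        levyMeasure α p σ q (polarSet x univ) ≠ ∞ := by
      rw [← h1]; exact measure_ne_top _ _
    exact ENNReal.lt_top_of_mul_ne_top_right h2 (by simpa using hc)

/-- Truncation shortens the admissible arrival times from length `‖σ‖ T / (α x ^ α)` to its minimum
with `T n`; the quotient of the two lengths is the factor. -/
theorem jumpMeasure_Ioc_polarSet (hT : 0 < T) (hσ : σ ≠ 0) (hα : 0 < α) (hp : 0 < p)
    (hq : IsProperTempering q) (hQ : IsTemperingFamily q Q) (u₀ : Sph d) (n : ℕ) {x : ℝ}
    (hx : 0 < x) {B : Set (Sph d)} (hB : MeasurableSet B) :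
    jumpMeasure T (Ioc 0 (T * n)) (markLaw (directionLaw σ Q))
        (seriesJump α p (σ.real univ) T) (polarSet x B) =
      ENNReal.ofReal (min (n * α / σ.real univ * x ^ α) 1) *
        levyMeasure α p σ q (polarSet x B) := by
  have hσ0 : 0 < σ.real univ := by
    rw [measureReal_def]
    exact ENNReal.toReal_pos (by simpa using hσ) (measure_ne_top _ _)
  have hc : 0 < α * x ^ α := by positivity
  have hvol : volume (Ioc 0 (T * n) ∩ Iio (σ.real univ * T / (α * x ^ α))) =
      ENNReal.ofReal (min (T * n) (σ.real univ * T / (α * x ^ α))) := by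
    refine le_antisymm ?_ ?_
    · rw [← sub_zero (min (T * (n : ℝ)) _), ← Real.volume_Ioc]
      exact measure_mono fun s hs => ⟨hs.1.1, le_min hs.1.2 (le_of_lt hs.2)⟩
    · rw [← sub_zero (min (T * (n : ℝ)) _), ← Real.volume_Ioo]
      exact measure_mono fun s hs => ⟨⟨hs.1, (hs.2.trans_le (min_le_left _ _)).le⟩,
        hs.2.trans_le (min_le_right _ _)⟩
  rw [jumpMeasure_seriesJump_polarSet hT hσ hα hp hq hQ u₀ measurableSet_Ioc
    (fun s hs => hs.1) hx hB, hvol, ← mul_assoc, ← ENNReal.ofReal_mul (by positivity),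
    ← ENNReal.ofReal_mul (by positivity)]
  congr 2
  rw [mul_right_comm, mul_min_of_nonneg _ _ (by positivity)]
  congr 1 <;> field_simp

end Spectral

/-! ### Convergence of the truncated jump measures -/

lemma monotone_Iic_prod {𝓨 : Type*} {T : ℝ} (hT : 0 < T) :
    Monotone fun n : ℕ => Iic (T * n) ×ˢ (univ : Set 𝓨) := fun a b hab =>
  prod_mono_left (Iic_subset_Iic.2 (by gcongr))

lemma iUnion_Iic_prod {𝓨 : Type*} {T : ℝ} (hT : 0 < T) :
    ⋃ n : ℕ, Iic (T * n) ×ˢ (univ : Set 𝓨) = univ := by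
  refine eq_univ_of_forall fun x => mem_iUnion.2 ?_
  obtain ⟨n, hn⟩ := exists_nat_ge (x.1 / T)
  exact ⟨n, by rwa [div_le_iff₀' hT] at hn, trivial⟩

section Truncation

variable {𝓨 X : Type*} [MeasurableSpace 𝓨] [MeasurableSpace X] {ν : Measure 𝓨}
  [IsProbabilityMeasure ν] {T : ℝ} {H : ℝ → 𝓨 → X}

/-- All truncated intensities are restrictions of a single measure. Domination by the limit and
every convergence statement come from this. -/
lemma restrict_Ioc_prod (L : ℝ) : (volume.restrict (Ioc 0 L)).prod ν =
    ((volume.restrict (Ioi 0)).prod ν).restrict (Iic L ×ˢ univ) := by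
  rw [← Measure.restrict_univ (μ := ν), Measure.prod_restrict, Measure.prod_restrict,
    Measure.restrict_restrict (measurableSet_Iic.prod .univ), prod_inter_prod, inter_self,
    inter_comm, Ioi_inter_Iic]

lemma jumpMeasure_Ioc_le (hH : Measurable (Function.uncurry H)) (L : ℝ) :
    jumpMeasure T (Ioc 0 L) ν H ≤ jumpMeasure T (Ioi 0) ν H := by
  refine Measure.le_iff.2 fun A hA => ?_
  rw [jumpMeasure, jumpMeasure, restrict_Ioc_prod, Measure.smul_apply, Measure.smul_apply]
  gcongr
  exact Measure.restrict_le_self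

/-- Continuity from below, which needs no finiteness of the limit; sets of infinite Lévy measure are
covered. -/
lemma tendsto_jumpMeasure_apply (hT : 0 < T) (hH : Measurable (Function.uncurry H)) {A : Set X}
    (hA : MeasurableSet A) :
    Tendsto (fun n : ℕ => jumpMeasure T (Ioc 0 (T * n)) ν H A) atTop
      (𝓝 (jumpMeasure T (Ioi 0) ν H A)) := by
  simp only [jumpMeasure, restrict_Ioc_prod, Measure.smul_apply, smul_eq_mul,
    Measure.map_apply hH hA, Measure.restrict_apply (hH hA)]
  refine ENNReal.Tendsto.const_mul ?_ (Or.inr ENNReal.ofReal_ne_top)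
  have h1 := tendsto_measure_iUnion_atTop (μ := (volume.restrict (Ioi 0)).prod ν)
    (s := fun n : ℕ => Function.uncurry H ⁻¹' A ∩ Iic (T * n) ×ˢ univ)
    (fun a b hab => inter_subset_inter_right _ (monotone_Iic_prod hT hab))
  rwa [← inter_iUnion, iUnion_Iic_prod hT, inter_univ] at h1

lemma tendsto_integral_jumpMeasure {F : Type*} [NormedAddCommGroup F] [NormedSpace ℝ F]
    (hT : 0 < T) (hH : Measurable (Function.uncurry H)) {f : X → F} (hf : StronglyMeasurable f)
    (hfi : Integrable f (jumpMeasure T (Ioi 0) ν H)) :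
    Tendsto (fun n : ℕ => ∫ x, f x ∂(jumpMeasure T (Ioc 0 (T * n)) ν H)) atTop
      (𝓝 (∫ x, f x ∂(jumpMeasure T (Ioi 0) ν H))) := by
  simp only [integral_jumpMeasure hT hH hf, restrict_Ioc_prod]
  refine Tendsto.const_smul ?_ _
  have hT' : ENNReal.ofReal T⁻¹ ≠ 0 := by simpa using hT
  have hi : Integrable (fun x : ℝ × 𝓨 => f (H x.1 x.2)) ((volume.restrict (Ioi 0)).prod ν) := by
    rw [jumpMeasure, integrable_smul_measure hT' ENNReal.ofReal_ne_top,
      integrable_map_measure hf.aestronglyMeasurable hH.aemeasurable] at hfi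
    exact hfi
  have h1 := tendsto_setIntegral_of_monotone (μ := (volume.restrict (Ioi 0)).prod ν)
    (fun n : ℕ => measurableSet_Iic.prod MeasurableSet.univ) (monotone_Iic_prod (𝓨 := 𝓨) hT)
    hi.integrableOn
  rwa [iUnion_Iic_prod hT, setIntegral_univ] at h1

/-- The marks have total mass one, so a bound by the arrival time alone reduces moments to
one-dimensional integrals. -/
lemma lintegral_jumpMeasure_Ioi_le (hH : Measurable (Function.uncurry H)) {φ : X → ℝ≥0∞}
    (hφ : Measurable φ) {ψ : ℝ → ℝ≥0∞} (hψ : Measurable ψ)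
    (h : ∀ᵐ x ∂((volume.restrict (Ioi 0)).prod ν), φ (H x.1 x.2) ≤ ψ x.1) :
    ∫⁻ x, φ x ∂(jumpMeasure T (Ioi 0) ν H) ≤
      ENNReal.ofReal T⁻¹ * ∫⁻ s in Ioi (0 : ℝ), ψ s := by
  rw [jumpMeasure, lintegral_smul_measure, lintegral_map hφ hH, smul_eq_mul]
  gcongr
  refine (lintegral_mono_ae h).trans_eq ?_
  rw [lintegral_prod _ (by fun_prop)]
  simp

end Truncation

/-! ### Moments of the Lévy measure -/

lemma lintegral_Ioc_Ioi_rpow_lt_top {a b c c' : ℝ} (ha : -1 < a) (hb : b < -1) :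
    ∫⁻ s in Ioi (0 : ℝ), (if s ≤ 1 then ENNReal.ofReal (c * s ^ a) else
      ENNReal.ofReal (c' * s ^ b)) < ∞ := by
  rw [← Ioc_union_Ioi_eq_Ioi zero_le_one, lintegral_union measurableSet_Ioi
    (Ioc_disjoint_Ioi le_rfl)]
  refine ENNReal.add_lt_top.2 ⟨?_, ?_⟩
  · have h1 : ∀ s ∈ Ioc (0 : ℝ) 1, (if s ≤ 1 then ENNReal.ofReal (c * s ^ a) else
      ENNReal.ofReal (c' * s ^ b)) = ENNReal.ofReal (c * s ^ a) := fun s hs => if_pos hs.2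
    rw [setLIntegral_congr_fun measurableSet_Ioc h1]
    have h2 : IntegrableOn (fun s : ℝ => c * s ^ a) (Ioc 0 1) :=
      ((intervalIntegrable_iff_integrableOn_Ioc_of_le zero_le_one).1
        (intervalIntegral.intervalIntegrable_rpow' ha)).const_mul c
    exact h2.lintegral_lt_top
  · have h1 : ∀ s ∈ Ioi (1 : ℝ), (if s ≤ 1 then ENNReal.ofReal (c * s ^ a) else
      ENNReal.ofReal (c' * s ^ b)) = ENNReal.ofReal (c' * s ^ b) :=
      fun s hs => if_neg (not_le.2 hs)
    rw [setLIntegral_congr_fun measurableSet_Ioi h1]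
    have h2 : IntegrableOn (fun s : ℝ => c' * s ^ b) (Ioi 1) :=
      (integrableOn_Ioi_rpow_of_lt hb one_pos).const_mul c'
    exact h2.lintegral_lt_top

section Moments

variable {d : ℕ} {σ : Measure (Sph d)} [IsFiniteMeasure σ] {q : ℝ → Sph d → ℝ}
  {Q : Kernel (Sph d) ℝ} [IsMarkovKernel Q] {α p T : ℝ}

lemma norm_seriesJump_le {m s : ℝ} (hmT : 0 < m * T) (hα : 0 < α) (hs : 0 < s)
    {y : Space d × ℝ × ℝ} (hy : y.1 ≠ 0 ∧ 0 < y.2.1 ∧ 0 < y.2.2) :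
    ‖seriesJump α p m T s y‖ ≤ (α / (m * T)) ^ (-1 / α) * s ^ (-1 / α) := by
  obtain ⟨h1, h2, h3⟩ := hy
  have hn : 0 < ‖y.1‖ := norm_pos_iff.2 h1
  have hpos : 0 < min ((α * s / (m * T)) ^ (-1 / α))
      (y.2.1 ^ (1 / p) * y.2.2 ^ (1 / α) / ‖y.1‖ ^ (1 / p)) :=
    lt_min (by positivity) (by positivity)
  rw [seriesJump, jumpH, norm_smul, norm_smul, Real.norm_of_nonneg hpos.le, norm_div, norm_one,
    norm_norm, one_div_mul_cancel hn.ne', mul_one, ← Real.mul_rpow (by positivity) hs.le]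
  refine (min_le_left _ _).trans_eq ?_
  congr 1; ring

lemma rpow_neg_inv_sq {c s : ℝ} (hs : 0 < s) :
    (c * s ^ (-1 / α)) ^ 2 = c ^ 2 * s ^ (-2 / α) := by
  rw [mul_pow, ← Real.rpow_natCast (s ^ (-1 / α)), ← Real.rpow_mul hs.le]
  congr 2
  push_cast; ring

/-- Arrival times up to `1` are bounded by `1`; later ones by `c ^ 2 * s ^ (-2 / α)`, integrable at
infinity because `α < 2`. -/
theorem lintegral_min_sq_one_levyMeasure_lt_top (hα : α ∈ Ioo (0 : ℝ) 2) (hp : 0 < p) (hT : 0 < T)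
    (hσ : σ ≠ 0) (hq : IsProperTempering q) (hQ : IsTemperingFamily q Q) (u₀ : Sph d) :
    ∫⁻ x, ENNReal.ofReal (min (‖x‖ ^ 2) 1) ∂(levyMeasure α p σ q) < ∞ := by
  have hσ0 : 0 < σ.real univ := by
    rw [measureReal_def]
    exact ENNReal.toReal_pos (by simpa using hσ) (measure_ne_top _ _)
  have := isProbabilityMeasure_directionLaw (Q := Q) hσ
  have := isProbabilityMeasure_markLaw (directionLaw σ Q)
  rw [← jumpMeasure_Ioi_eq_levyMeasure hT hσ hα.1 hp hq hQ u₀]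
  set c : ℝ := (α / (σ.real univ * T)) ^ (-1 / α)
  refine (lintegral_jumpMeasure_Ioi_le (measurable_seriesJump _ _ _ _) (by fun_prop)
    (ψ := fun s => if s ≤ 1 then ENNReal.ofReal (1 * s ^ (0 : ℝ)) else
      ENNReal.ofReal (c ^ 2 * s ^ (-2 / α)))
    (Measurable.ite measurableSet_Iic (by fun_prop) (by fun_prop)) ?_).trans_lt
    (ENNReal.mul_lt_top ENNReal.ofReal_lt_top
      (lintegral_Ioc_Ioi_rpow_lt_top (by norm_num) ?_))
  · filter_upwards [ae_pos_and_mark hσ hQ measurableSet_Ioi subset_rfl] with x hx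
    have h1 := norm_seriesJump_le (p := p) (mul_pos hσ0 hT) hα.1 hx.1 hx.2
    split_ifs with h2
    · exact ENNReal.ofReal_le_ofReal (by simp)
    · refine ENNReal.ofReal_le_ofReal ((min_le_left _ _).trans ?_)
      rw [← rpow_neg_inv_sq hx.1]
      exact pow_le_pow_left₀ (norm_nonneg _) h1 2
  · rw [neg_div, neg_lt_neg_iff, lt_div_iff₀ hα.1]; linarith [hα.2]

/-- For early arrivals `s ^ (-1 / α)` is integrable at `0` because `1 < α`. It is not integrable at
infinity, but where `1 < ‖x‖` the norm is at most its square, so `s ^ (-2 / α)` can be used for late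
arrivals. -/
theorem lintegral_norm_levyMeasure_lt_top (hα : α ∈ Ioo (0 : ℝ) 2) (hp : 0 < p) (hT : 0 < T)
    (hσ : σ ≠ 0) (hq : IsProperTempering q) (hQ : IsTemperingFamily q Q) (u₀ : Sph d)
    (hα1 : 1 < α) :
    ∫⁻ x in {x | 1 < ‖x‖}, ‖x‖ₑ ∂(levyMeasure α p σ q) < ∞ := by
  have hσ0 : 0 < σ.real univ := by
    rw [measureReal_def]
    exact ENNReal.toReal_pos (by simpa using hσ) (measure_ne_top _ _)
  have := isProbabilityMeasure_directionLaw (Q := Q) hσ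
  have := isProbabilityMeasure_markLaw (directionLaw σ Q)
  have hS : MeasurableSet {x : Space d | 1 < ‖x‖} :=
    measurableSet_lt measurable_const measurable_norm
  rw [← lintegral_indicator hS, ← jumpMeasure_Ioi_eq_levyMeasure hT hσ hα.1 hp hq hQ u₀]
  set c : ℝ := (α / (σ.real univ * T)) ^ (-1 / α)
  refine (lintegral_jumpMeasure_Ioi_le (measurable_seriesJump _ _ _ _)
    (measurable_enorm.indicator hS)
    (ψ := fun s => if s ≤ 1 then ENNReal.ofReal (c * s ^ (-1 / α)) else
      ENNReal.ofReal (c ^ 2 * s ^ (-2 / α)))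
    (Measurable.ite measurableSet_Iic (by fun_prop) (by fun_prop)) ?_).trans_lt
    (ENNReal.mul_lt_top ENNReal.ofReal_lt_top
      (lintegral_Ioc_Ioi_rpow_lt_top ?_ ?_))
  · filter_upwards [ae_pos_and_mark hσ hQ measurableSet_Ioi subset_rfl] with x hx
    have h1 := norm_seriesJump_le (p := p) (mul_pos hσ0 hT) hα.1 hx.1 hx.2
    by_cases h3 : 1 < ‖seriesJump α p (σ.real univ) T x.1 x.2‖
    · rw [indicator_of_mem (by exact h3), ← ofReal_norm]
      split_ifs with h2
      · exact ENNReal.ofReal_le_ofReal h1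
      · refine ENNReal.ofReal_le_ofReal ?_
        rw [← rpow_neg_inv_sq hx.1]
        exact (le_self_pow₀ h3.le two_ne_zero).trans (pow_le_pow_left₀ (norm_nonneg _) h1 2)
    · rw [indicator_of_notMem (by exact h3)]
      exact zero_le
  · rw [neg_div, neg_lt_neg_iff, div_lt_one hα.1]; exact hα1
  · rw [neg_div, neg_lt_neg_iff, lt_div_iff₀ hα.1]; linarith [hα.2]

end Moments

/-! ### Convergence of pure jump triplets -/

section PureJump

variable {d : ℕ} {M : Measure (Space d)}

lemma lintegral_min_sq_norm_lt_top
    (h1 : ∫⁻ x, ENNReal.ofReal (min (‖x‖ ^ 2) 1) ∂M < ∞)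
    (h2 : ∫⁻ x in {x | 1 < ‖x‖}, ‖x‖ₑ ∂M < ∞) :
    ∫⁻ x, ENNReal.ofReal (min (‖x‖ ^ 2) ‖x‖) ∂M < ∞ := by
  have hS : MeasurableSet {x : Space d | 1 < ‖x‖} :=
    measurableSet_lt measurable_const measurable_norm
  rw [← lintegral_indicator hS] at h2
  refine lt_of_le_of_lt ?_ (ENNReal.add_lt_top.2 ⟨h1, h2⟩)
  rw [← lintegral_add_left (by fun_prop)]
  refine lintegral_mono fun x => ?_
  rcases le_or_gt ‖x‖ 1 with hx | hx
  · exact (ENNReal.ofReal_le_ofReal (min_le_min_left _ hx)).trans le_self_add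
  · rw [indicator_of_mem (by exact hx), ← ofReal_norm]
    exact (ENNReal.ofReal_le_ofReal (min_le_right _ _)).trans le_add_self

lemma integrable_min_sq_norm (h : ∫⁻ x, ENNReal.ofReal (min (‖x‖ ^ 2) ‖x‖) ∂M < ∞) :
    Integrable (fun x : Space d => min (‖x‖ ^ 2) ‖x‖) M :=
  (lintegral_ofReal_ne_top_iff_integrable (by fun_prop)
    (ae_of_all _ fun _ => le_min (by positivity) (norm_nonneg _))).1 h.ne

lemma integrable_id_of_le {N : Measure (Space d)} [IsFiniteMeasure N] (hN : N ≤ M)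
    (h : ∫⁻ x in {x | 1 < ‖x‖}, ‖x‖ₑ ∂M < ∞) : Integrable (fun x => x) N := by
  have hS : MeasurableSet {x : Space d | 1 < ‖x‖} :=
    measurableSet_lt measurable_const measurable_norm
  refine ⟨by fun_prop, ?_⟩
  rw [HasFiniteIntegral, ← lintegral_add_compl _ hS]
  refine ENNReal.add_lt_top.2 ⟨(lintegral_mono' (Measure.restrict_mono subset_rfl hN)
    le_rfl).trans_lt h, ?_⟩
  refine (setLIntegral_mono' (g := fun _ => 1) hS.compl fun x hx => ?_).trans_lt
    (by simp)
  rw [← ofReal_norm, ← ENNReal.ofReal_one]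
  exact ENNReal.ofReal_le_ofReal (not_lt.1 hx)

/-- The linear bound always holds and the quadratic one by Taylor for `|θ| ≤ 1`; beyond that the
linear bound implies it. This matches the integrability condition of an admissible triplet. -/
lemma norm_cexp_I_mul_sub_one_sub_le (θ : ℝ) :
    ‖Complex.exp (Complex.I * θ) - 1 - Complex.I * θ‖ ≤ 2 * min (θ ^ 2) |θ| := by
  have h1 : ‖Complex.I * (θ : ℂ)‖ = |θ| := by simp
  have h2 : ‖Complex.exp (Complex.I * θ) - 1 - Complex.I * θ‖ ≤ 2 * |θ| := by
    refine (norm_sub_le _ _).trans ?_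
    rw [h1, two_mul]
    gcongr
    exact Real.norm_exp_I_mul_ofReal_sub_one_le
  rw [mul_min_of_nonneg _ _ zero_le_two]
  refine le_min ?_ h2
  rcases le_or_gt |θ| 1 with h | h
  · have h3 := Complex.norm_exp_sub_one_sub_id_le (x := Complex.I * θ) (by rwa [h1])
    rw [h1, sq_abs] at h3
    nlinarith [sq_nonneg θ]
  · refine h2.trans ?_
    rw [← sq_abs θ]
    nlinarith

lemma min_sq_abs_inner_le (x z : Space d) :
    min ((inner ℝ x z : ℝ) ^ 2) |inner ℝ x z| ≤
      (‖z‖ ^ 2 + ‖z‖) * min (‖x‖ ^ 2) ‖x‖ := by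
  have h := abs_real_inner_le_norm x z
  have hx := norm_nonneg x
  have hz := norm_nonneg z
  rw [mul_min_of_nonneg _ _ (by positivity)]
  refine min_le_min ?_ ?_
  · rw [← sq_abs]
    refine (pow_le_pow_left₀ (abs_nonneg _) h 2).trans ?_
    nlinarith [mul_nonneg hz (sq_nonneg ‖x‖)]
  · nlinarith [mul_nonneg (sq_nonneg ‖z‖) hx]

lemma integrable_exponent (hM : Integrable (fun x : Space d => min (‖x‖ ^ 2) ‖x‖) M)
    (z : Space d) :
    Integrable (fun x : Space d => Complex.exp (Complex.I * (inner ℝ x z : ℝ)) - 1 -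
      Complex.I * (inner ℝ x z : ℝ)) M := by
  refine ((hM.const_mul (‖z‖ ^ 2 + ‖z‖)).const_mul 2).mono' (by fun_prop)
    (ae_of_all _ fun x => (norm_cexp_I_mul_sub_one_sub_le _).trans ?_)
  have := min_sq_abs_inner_le x z
  gcongr

lemma tendsto_setIntegral_inner_sq
    (hM : Integrable (fun x : Space d => min (‖x‖ ^ 2) ‖x‖) M) (z : Space d) :
    Tendsto (fun ε : ℝ => ∫ x in {x | ‖x‖ ≤ ε}, (inner ℝ x z : ℝ) ^ 2 ∂M) (𝓝[>] 0) (𝓝 0) := by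
  have hS : ∀ ε : ℝ, MeasurableSet {x : Space d | ‖x‖ ≤ ε} := fun ε =>
    measurableSet_le measurable_norm measurable_const
  simp only [← integral_indicator (hS _)]
  rw [show 𝓝 (0 : ℝ) = 𝓝 (∫ _, (0 : ℝ) ∂M) by simp]
  refine tendsto_integral_filter_of_dominated_convergence
    (fun x => ‖z‖ ^ 2 * min (‖x‖ ^ 2) ‖x‖)
    (Eventually.of_forall fun ε =>
      (Measurable.indicator (by fun_prop) (hS ε)).aestronglyMeasurable) ?_
    (hM.const_mul _) (ae_of_all _ fun x => ?_)
  · filter_upwards [Ioc_mem_nhdsGT one_pos] with ε hε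
    refine ae_of_all _ fun x => ?_
    by_cases hx : ‖x‖ ≤ ε
    · rw [indicator_of_mem (by exact hx), norm_pow, Real.norm_eq_abs,
        min_eq_left (by nlinarith [norm_nonneg x, hε.2] : ‖x‖ ^ 2 ≤ ‖x‖)]
      refine (pow_le_pow_left₀ (abs_nonneg _) (abs_real_inner_le_norm x z) 2).trans_eq ?_
      ring
    · rw [indicator_of_notMem (by exact hx), norm_zero]
      positivity
  · rcases eq_or_ne x 0 with rfl | hx
    · refine tendsto_const_nhds.congr fun ε => ?_
      by_cases h : (0 : Space d) ∈ {x : Space d | ‖x‖ ≤ ε}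
      · rw [indicator_of_mem h]; simp
      · rw [indicator_of_notMem h]
    · refine tendsto_const_nhds.congr' ?_
      filter_upwards [Ioo_mem_nhdsGT (norm_pos_iff.2 hx)] with ε hε
      rw [indicator_of_notMem (by exact not_le.2 hε.2)]

lemma tendsto_setLIntegral_norm
    (hM : ∫⁻ x, ENNReal.ofReal (min (‖x‖ ^ 2) ‖x‖) ∂M < ∞) :
    Tendsto (fun R : ℝ => ∫⁻ x in {x | R < ‖x‖}, ‖x‖ₑ ∂M) atTop (𝓝 0) := by
  have hS : ∀ R : ℝ, MeasurableSet {x : Space d | R < ‖x‖} := fun R =>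
    measurableSet_lt measurable_const measurable_norm
  simp only [← lintegral_indicator (hS _)]
  have h0 : (0 : ℝ≥0∞) = ∫⁻ _, (0 : ℝ≥0∞) ∂M := by simp
  rw [h0]
  refine tendsto_lintegral_filter_of_dominated_convergence _
    (Eventually.of_forall fun R => measurable_enorm.indicator (hS R)) ?_ hM.ne
    (ae_of_all _ fun x => ?_)
  · filter_upwards [eventually_ge_atTop 1] with R hR
    refine ae_of_all _ fun x => ?_
    by_cases hx : R < ‖x‖
    · rw [indicator_of_mem (by exact hx), ← ofReal_norm]
      exact ENNReal.ofReal_le_ofReal (le_min (le_self_pow₀ (hR.trans hx.le) two_ne_zero) le_rfl)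
    · rw [indicator_of_notMem (by exact hx)]
      exact zero_le
  · refine tendsto_const_nhds.congr' ?_
    filter_upwards [eventually_ge_atTop ‖x‖] with R hR
    rw [indicator_of_notMem (by exact not_lt.2 hR)]

/-- Convergence of the triplets of pure jump processes whose measures of jumps are dominated by
the limit. -/
theorem tripletTendsto_of_le {N : ℕ → Measure (Space d)} (hN : ∀ n, N n ≤ M)
    (hM : ∫⁻ x, ENNReal.ofReal (min (‖x‖ ^ 2) ‖x‖) ∂M < ∞)
    (hlim : ∀ f : Space d → ℝ, StronglyMeasurable f → Integrable f M →
      Tendsto (fun n => ∫ x, f x ∂(N n)) atTop (𝓝 (∫ x, f x ∂M))) :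
    TripletTendsto (fun n => ⟨0, 0, N n⟩) ⟨0, 0, M⟩ where
  drift := tendsto_const_nhds
  jumps f hf := by
    refine hlim f f.continuous.stronglyMeasurable ?_
    obtain ⟨ε, hε, hf⟩ := Metric.eventually_nhds_iff.1 hf
    -- `f` vanishes on the ball of radius `ε`, and outside it `min (‖x‖ ^ 2) ‖x‖` is at least `min
    -- (ε ^ 2) ε`.
    refine ((integrable_min_sq_norm hM).const_mul (‖f‖ / min (ε ^ 2) ε)).mono'
      f.continuous.aestronglyMeasurable (ae_of_all _ fun x => ?_)
    rcases lt_or_ge ‖x‖ ε with hx | hx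
    · rw [hf (by simpa using hx), norm_zero]
      positivity
    · rw [div_mul_eq_mul_div, le_div_iff₀ (by positivity)]
      gcongr
      exact f.norm_coe_le_norm x
  cov z η hη := by
    filter_upwards [(tendsto_setIntegral_inner_sq (integrable_min_sq_norm hM) z).eventually
      (gt_mem_nhds hη), Ioc_mem_nhdsGT one_pos] with ε hε hε1
    refine Eventually.of_forall fun n => ?_
    have hS : MeasurableSet {x : Space d | ‖x‖ ≤ ε} :=
      measurableSet_le measurable_norm measurable_const
    have hi : IntegrableOn (fun x : Space d => (inner ℝ x z : ℝ) ^ 2) {x | ‖x‖ ≤ ε} M := by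
      refine ((integrable_min_sq_norm hM).const_mul (‖z‖ ^ 2)).integrableOn.mono' (by fun_prop) ?_
      filter_upwards [ae_restrict_mem hS] with x hx
      have hx' : ‖x‖ ≤ ε := hx
      rw [norm_pow, Real.norm_eq_abs,
        min_eq_left (by nlinarith [norm_nonneg x, hε1.2] : ‖x‖ ^ 2 ≤ ‖x‖)]
      refine (pow_le_pow_left₀ (abs_nonneg _) (abs_real_inner_le_norm x z) 2).trans_eq ?_
      ring
    have h1 : ∫ x in {x | ‖x‖ ≤ ε}, (inner ℝ x z : ℝ) ^ 2 ∂(N n) ≤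
        ∫ x in {x | ‖x‖ ≤ ε}, (inner ℝ x z : ℝ) ^ 2 ∂M :=
      integral_mono_measure (Measure.restrict_mono subset_rfl (hN n))
        (ae_of_all _ fun _ => sq_nonneg _) hi
    have h2 : 0 ≤ ∫ x in {x | ‖x‖ ≤ ε}, (inner ℝ x z : ℝ) ^ 2 ∂(N n) :=
      integral_nonneg fun _ => sq_nonneg _
    simpa [abs_of_nonneg h2] using h1.trans_lt hε
  tail η hη := by
    filter_upwards [(tendsto_setLIntegral_norm hM).eventually
      (gt_mem_nhds (ENNReal.ofReal_pos.2 hη))] with R hR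
    exact Eventually.of_forall fun n =>
      (lintegral_mono' (Measure.restrict_mono subset_rfl (hN n)) le_rfl).trans_lt hR

end PureJump

/-! ### The truncated series as a sum over marked points -/

section Identification

variable {Ω : Type*} {d : ℕ} {α p m T : ℝ} {E' E τ U : ℕ → Ω → ℝ} {V : ℕ → Ω → Space d}

lemma truncSum_eq_pointSum (n : ℕ) (t : ℝ) :
    truncSum α p m T E' E τ U V n t =
      pointSum E' (fun j ω => (τ j ω, (V j ω, E j ω, U j ω))) (T * n)
        (timeCut (seriesJump α p m T) (Ioc 0 t)) := by
  funext ω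
  simp only [truncSum, pointSum, timeCut, seriesJump, indicator, ite_and]
  exact tsum_congr fun j => by split_ifs <;> rfl

/-- The window `univ` imposes no condition on the time marks, so the total falls under the same
formulas as the series; `τ` on the right is arbitrary. -/
lemma truncTotal_eq_pointSum (n : ℕ) :
    truncTotal α p m T E' E U V n =
      pointSum E' (fun j ω => (τ j ω, (V j ω, E j ω, U j ω))) (T * n)
        (timeCut (seriesJump α p m T) univ) := by
  funext ω
  simp only [truncTotal, pointSum, timeCut, seriesJump, indicator_univ]

end Identification

end TemperedStable

end

/-! ### The main theorem -/

open TemperedStable in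
theorem theorem2 {Ω : Type*} [MeasurableSpace Ω] (P : Measure Ω) [IsProbabilityMeasure P]
    {d : ℕ} (α p T : ℝ) (hα : α ∈ Ioo (0 : ℝ) 2) (hp : 0 < p) (hT : 0 < T)
    (σ : Measure (Sph d)) [IsFiniteMeasure σ] (hσ : σ ≠ 0)
    (q : ℝ → Sph d → ℝ) (hq : IsProperTempering q)
    (Q : Kernel (Sph d) ℝ) [IsMarkovKernel Q] (hQ : IsTemperingFamily q Q)
    (E' E τ U : ℕ → Ω → ℝ) (V : ℕ → Ω → Space d)
    (hin : IsSeriesInput P T ((σ univ)⁻¹ • spectralQ σ Q) E' E τ U V) :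
    ∃ Mn : ℕ → Measure (Space d),
      -- the explicit form of the truncated Lévy measures
      (∀ n, Mn n {0} = 0 ∧ ∀ x : ℝ, 0 < x → ∀ B : Set (Sph d), MeasurableSet B →
        Mn n (polarSet x B) =
          ENNReal.ofReal (min (n * α / σ.real univ * x ^ α) 1) *
            levyMeasure α p σ q (polarSet x B)) ∧
      -- they converge to the Lévy measure, on every Borel set
      (∀ A : Set (Space d), MeasurableSet A →
        Tendsto (fun n => Mn n A) atTop (𝓝 (levyMeasure α p σ q A))) ∧
      -- the truncated series is a compound Poisson process with jump measure `Mn n`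
      (∀ n, IsCompoundPoissonOn P T (truncSum α p (σ.real univ) T E' E τ U V n) (Mn n)) ∧
      -- whenever the means exist (always if `1 < α`):
      ((1 < α ∨ ∫⁻ x in {x | 1 < ‖x‖}, ‖x‖ₑ ∂(levyMeasure α p σ q) < ∞) →
        -- the compensator is the mean of the truncated series
        (∀ n, Integrable (truncTotal α p (σ.real univ) T E' E U V n) P ∧
          ∀ t ∈ Icc 0 T, Integrable (truncSum α p (σ.real univ) T E' E τ U V n t) P ∧
            ∫ ω, truncSum α p (σ.real univ) T E' E τ U V n t ω ∂P =
              (t / T) • ∫ ω, truncTotal α p (σ.real univ) T E' E U V n ω ∂P) ∧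
        -- the compensated truncated series has the triplet `(0, 0, Mn n)`
        (∀ n, HasTripletOn P T (truncProcess P α p (σ.real univ) T E' E τ U V n)
          ⟨0, 0, Mn n⟩) ∧
        -- the triplets converge to `(0, 0, M)`, and so do the laws
        (⟨0, 0, levyMeasure α p σ q⟩ : Triplet d).IsAdmissible ∧
        TripletTendsto (fun n => ⟨0, 0, Mn n⟩) ⟨0, 0, levyMeasure α p σ q⟩ ∧
        (∀ t ∈ Icc 0 T, ∀ z : Space d, Tendsto
          (fun n => charFun (P.map (truncProcess P α p (σ.real univ) T E' E τ U V n t)) z) atTop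
          (𝓝 (Complex.exp
            (t * (⟨0, 0, levyMeasure α p σ q⟩ : Triplet d).exponent z))))) := by
  -- `u₀` is only the conventional direction of the zero vector. Since `σ ≠ 0`, the sphere is
  -- nonempty, which also excludes `d = 0`.
  obtain ⟨u₀⟩ : Nonempty (Sph d) := by
    by_contra h
    rw [not_nonempty_iff] at h
    exact hσ (Measure.eq_zero_of_isEmpty σ)
  have hσ0 : 0 < σ.real univ := by
    rw [measureReal_def]
    exact ENNReal.toReal_pos (by simpa using hσ) (measure_ne_top _ _)
  have := isProbabilityMeasure_directionLaw (Q := Q) hσ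
  have := isProbabilityMeasure_markLaw (directionLaw σ Q)
  have := isProbabilityMeasure_uniformTime hT
  have hH := measurable_seriesJump (d := d) α p (σ.real univ) T
  have hmT : 0 < σ.real univ * T := mul_pos hσ0 hT
  have hM := jumpMeasure_Ioi_eq_levyMeasure hT hσ hα.1 hp hq hQ u₀
  set ν := markLaw (directionLaw σ Q)
  set H := seriesJump (d := d) α p (σ.real univ) T
  have hL : ∀ n : ℕ, 0 ≤ T * (n : ℝ) := fun n => by positivity
  have hmark : IsMarkedArrival P ((uniformTime T).prod ν) E'
      (fun j ω => (τ j ω, (V j ω, E j ω, U j ω))) := hin.isMarkedArrival hT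
  have hzero : ∀ I : Set ℝ, MeasurableSet I → I ⊆ Ioi 0 → jumpMeasure T I ν H {0} = 0 :=
    fun I hI hI0 => jumpMeasure_seriesJump_zero hmT hσ hα.1 hQ hI hI0
  have hCP : ∀ n, IsCompoundPoissonOn P T (truncSum α p (σ.real univ) T E' E τ U V n)
      (jumpMeasure T (Ioc 0 (T * n)) ν H) := fun n => by
    rw [funext (truncSum_eq_pointSum (T := T) n)]
    exact hmark.isCompoundPoissonOn_cut hT (hL n) hH
      (hzero _ measurableSet_Ioc Ioc_subset_Ioi_self)
  have hle : ∀ n : ℕ, jumpMeasure T (Ioc 0 (T * n)) ν H ≤ levyMeasure α p σ q := fun n =>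
    hM ▸ jumpMeasure_Ioc_le hH _
  -- The witness is the image of the intensity of arrivals in `(0, T n]`, not a measure built from
  -- the polar formula; domination and convergence are then immediate.
  refine ⟨fun n => jumpMeasure T (Ioc 0 (T * n)) ν H, fun n =>
    ⟨hzero _ measurableSet_Ioc Ioc_subset_Ioi_self, fun x hx B hB =>
      jumpMeasure_Ioc_polarSet hT hσ hα.1 hp hq hQ u₀ n hx hB⟩,
    fun A hA => hM ▸ tendsto_jumpMeasure_apply hT hH hA, hCP, fun hmean => ?_⟩
  have htail : ∫⁻ x in {x | 1 < ‖x‖}, ‖x‖ₑ ∂(levyMeasure α p σ q) < ∞ :=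
    hmean.elim (lintegral_norm_levyMeasure_lt_top hα hp hT hσ hq hQ u₀) id
  have hmin := lintegral_min_sq_norm_lt_top
    (lintegral_min_sq_one_levyMeasure_lt_top hα hp hT hσ hq hQ u₀) htail
  have hint : ∀ n : ℕ, Integrable (fun x => x) (jumpMeasure T (Ioc 0 (T * n)) ν H) := fun n => by
    have := isFiniteMeasure_jumpMeasure (T := T) (ν := ν) (T * n) H
    exact integrable_id_of_le (hle n) htail
  have hHi : ∀ n : ℕ, Integrable (Function.uncurry H)
      ((volume.restrict (Ioc 0 (T * n))).prod ν) := fun n => by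
    have h1 := hint n
    rw [jumpMeasure, integrable_smul_measure (by simpa using hT) ENNReal.ofReal_ne_top,
      integrable_map_measure (by fun_prop) hH.aemeasurable] at h1
    exact h1
  have htotal : ∀ n : ℕ, Integrable (truncTotal α p (σ.real univ) T E' E U V n) P ∧
      ∫ ω, truncTotal α p (σ.real univ) T E' E U V n ω ∂P =
        T • ∫ x, x ∂(jumpMeasure T (Ioc 0 (T * n)) ν H) := fun n => by
    rw [truncTotal_eq_pointSum (τ := τ)]
    have h1 := hmark.integrable_cut hT hH (hHi n) MeasurableSet.univ
    simpa using h1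
  have hsum : ∀ n : ℕ, ∀ t ∈ Icc 0 T,
      Integrable (truncSum α p (σ.real univ) T E' E τ U V n t) P ∧
      ∫ ω, truncSum α p (σ.real univ) T E' E τ U V n t ω ∂P =
        t • ∫ x, x ∂(jumpMeasure T (Ioc 0 (T * n)) ν H) := fun n t ht => by
    rw [truncSum_eq_pointSum]
    have h1 := hmark.integrable_cut hT hH (hHi n) (measurableSet_Ioc (a := 0) (b := t))
    rwa [uniformTime_real_Ioc hT le_rfl ht.1 ht.2, sub_zero, mul_div_cancel₀ _ hT.ne'] at h1
  have htriplet : ∀ n, HasTripletOn P T (truncProcess P α p (σ.real univ) T E' E τ U V n)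
      ⟨0, 0, jumpMeasure T (Ioc 0 (T * n)) ν H⟩ := fun n => by
    have h1 : truncProcess P α p (σ.real univ) T E' E τ U V n = fun t ω =>
        truncSum α p (σ.real univ) T E' E τ U V n t ω -
          t • ∫ x, x ∂(jumpMeasure T (Ioc 0 (T * n)) ν H) := by
      funext t ω
      rw [truncProcess, (htotal n).2, smul_smul, div_mul_cancel₀ _ hT.ne']
    rw [h1]
    exact (hCP n).hasTripletOn_sub (hint n)
  refine ⟨fun n => ⟨(htotal n).1, fun t ht => ⟨(hsum n t ht).1, ?_⟩⟩, htriplet, ?_, ?_,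
    fun t ht z => ?_⟩
  · rw [(hsum n t ht).2, (htotal n).2, smul_smul, div_mul_cancel₀ _ hT.ne']
  · exact
      { cov_pos := ContinuousLinearMap.isPositive_zero
        jumps_zero := hM ▸ hzero _ measurableSet_Ioi subset_rfl
        integrable := hmin }
  · exact tripletTendsto_of_le hle hmin fun f hf hfi =>
      hM ▸ tendsto_integral_jumpMeasure hT hH hf (hM.symm ▸ hfi)
  -- Since the characteristic functions are explicit, it suffices that the exponents converge; their
  -- integrand is integrable for the limit measure.
  · simp only [(htriplet _).charFun_eq t ht z, exponent_pureJump]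
    have h1 := integrable_exponent (integrable_min_sq_norm hmin) z
    rw [← hM] at h1 ⊢
    exact (Complex.continuous_exp.tendsto _).comp
      ((tendsto_integral_jumpMeasure hT hH (by fun_prop) h1).const_mul _)
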